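/- A \emph{Perron number} is a positive real algebraic integer $\lambda$ that is strictly larger than the absolute value of each of its other Galois conjugates. Let $\lambda>1$ be a Perron number. Then: (a) there is a primitive square matrix $M$ with non-negative integer entries (some positive power has only positive entries) and spectral radius $\lambda$; (b) for every such $M=(m_{ij})_{1\le i,j\le n}$ the construction below can be carried out (all choices exist) in such a way that the top left corner of $Q_1$ is a periodic point of $f_L$; (c) whenever the choices are made so that the top left corner of $Q_1$ is a periodic point of $f_L$, there is $k\ge1$ with $f_0^k(Q_1)\cap Q_i\ne\emptyset$ for all $i$, and the surface $\Sigma$ is connected. \emph{Construction.} Let $\eta,\omega$ be positive right and left eigenvectors of $M$ for $\lambda$, and let $Q_1,\dots,Q_n$ be disjoint rectangles, $Q_i$ of width $\omega_i$ and height $\eta_i$. Divide $Q_k$ from left to right into vertical strips labelled $V^{(k)}_{i,j}$, $1\le j\le m_{ik}$, and from top to bottom into horizontal strips labelled $H^{(k)}_{i,j}$, $1\le j\le m_{ki}$, both in lexicographic order of $(i,j)$. Choose permutations $\tau_k$ of the vertical and $\sigma_k$ of the horizontal strips of $Q_k$; the widths and heights are such that $\tau_k^{-1}(V^{(k)}_{i,j})$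 has width $\lambda^{-1}\omega_i$ and $\sigma_k(H^{(k)}_{i,j})$ has height $\lambda^{-1}\eta_i$. The piece map $f_0$ sends the open strip $\tau_k^{-1}(V^{(k)}_{i,j})$ onto the open strip $\sigma_i(H^{(i)}_{k,j})$ by the affine map preserving left/right and top/bottom; $f_0^k(Q_1)$ is computed on the points where the iterate is defined. Let $f_L,f_R$ be the continuous extensions of $f_0$ to the left, respectively right, edges of the vertical strips, and $f_T^{-1},f_B^{-1}$ those of $f_0^{-1}$ to the top, respectively bottom, edges of the horizontal strips. They have finitely many periodic points. Choose one initial point in each periodic orbit, so that a corner that is periodic for two edge maps is initial for both or for neither. Let $x_0,\dots,x_{p-1}$ be a periodic orbit of $f_L$ (or $f_R$), $x_{j+1}=f_L(x_j)$, or of $f_T^{-1}$ (or $f_B^{-1}$), $x_{j}=f_T^{-1}(x_{j+1})$, indices mod $p$, with initial point $x_0$ on the edge $e$ of a rectangle. Glue an infinite strip $E(x_j)=[0,1]\times[0,\infty)$ by an affine map of $[0,1]\times\{0\}$ onto the segment $f_L^{2p+j}(e)$, respectively $f_T^{-2p+j}(e)$. This gives $\Sigma_1$. The set $L_1$ consists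 of the left edges of the vertical strips, without the segments where infinite strips are glued, together with the boundary rays of the infinite strips glued on left edges, except those rays that start at a corner of a rectangle; $R_1,T_1,B_1$ are defined likewise. The extended edge maps $f_{1,L}:L_1\to L_1$, $f_{1,R}$, $f_{1,T}^{-1}$, $f_{1,B}^{-1}$ are continuous, are injective on the part of their domain coming from one edge of one rectangle and its infinite strip, act on the rays of infinite strips by $(z,w)_{x}\mapsto(z,w+\delta)_{x'}$, where $x'$ is the image of $x$ under the edge map of $f_0$ and $\delta=1$ for the step (in the direction of $f_0$) that arrives at the initial point and $\delta=0$ otherwise, and equal the edge maps of $f_0$ on the edges, in both cases except on the switch set, where they are otherwise arbitrary. The switch set consists, for left and right edges, of the segments $f_L^{p+j}(e)$ at $x_j$, and for top and bottom edges of the segment $f_T^{-p}(e)$ at $x_0$ and of the parts $0\le w\le 1$ of the boundary rays at $x_j$, $1\le j<p$. Let $\sim$ be the equivalence relation on $\Sigma_1$ generated by $f_{1,L}^N(x)\sim f_{1,R}^N(x)$ for $x\in L_1\cap R_1$, $N\ge1$, and $f_{1,T}^{-N}(y)\sim f_{1,B}^{-N}(y)$ for $y\in T_1\cap B_1$, $N\ge1$,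 and let $\Sigma_2=\Sigma_1/\!\sim$. Let $G$ be any locally finite (possibly empty) set of points on the boundary rays of infinite strips that start at corners of rectangles. Replace in $\Sigma_2$ each point given by an infinite equivalence class, and each point of $G$, by its link; this gives the surface with boundary $\Sigma_2'$, and $\Sigma$ is the double of $\Sigma_2'$ along its boundary. -/

import Mathlib

/-- A Perron number: a positive real algebraic integer that is strictly larger than the absolute
value of each of its other Galois conjugates. -/
def IsPerron (lam : ℝ) : Prop :=
  IsIntegral ℤ lam ∧ 0 < lam ∧
    ∀ z : ℂ, Polynomial.aeval z (minpoly ℚ lam) = 0 → z ≠ (lam : ℂ) → ‖z‖ < lam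

/-- A primitive square matrix with non-negative integer entries and spectral radius `lam`. -/
def IsPrimitiveWithRadius {n : ℕ} (M : Matrix (Fin (n + 1)) (Fin (n + 1)) ℕ) (lam : ℝ) : Prop :=
  (∃ k > 0, ∀ i j, 0 < (M ^ k) i j) ∧
    spectralRadius ℂ (M.map (fun m : ℕ => (m : ℂ))) = ENNReal.ofReal lam

/-- The ambient space of the rectangles: one copy of the plane `ℂ` for each rectangle. The
rectangle `Q_i` lies in the copy `i`; the index `0` is the paper's index `1`. -/
abbrev Pt (n : ℕ) : Type := Fin (n + 1) × ℂ

/-- The four sides of a rectangle. -/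
inductive Side : Type
  | left
  | right
  | top
  | bottom

namespace Side

/-- The edge maps on the left and right sides are induced by the piece map (`true`), those on the
top and bottom sides by its inverse (`false`). -/
def forward : Side → Bool
  | left => true
  | right => true
  | top => false
  | bottom => false

/-- The outward unit normal. -/
noncomputable def normal : Side → ℂ
  | left => -1
  | right => 1
  | top => Complex.I
  | bottom => -Complex.I

end Side

/-- The point at distance `w` from `q` in the outward direction of the side `s`. -/
noncomputable def push {n : ℕ} (s : Side) (w : ℝ) (q : Pt n) : Pt n :=
  (q.1, q.2 + (w : ℂ) * s.normal)

/-- Lexicographic order on the labels `(i, j)` of the strips of one rectangle. -/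
def Before {n : ℕ} {m : Fin (n + 1) → ℕ} (a b : (i : Fin (n + 1)) × Fin (m i)) : Prop :=
  a.1 < b.1 ∨ (a.1 = b.1 ∧ (a.2 : ℕ) < (b.2 : ℕ))

/-- The data of a piece map for the matrix `M`: positive right and left Perron-Frobenius
eigenvectors `η` (heights) and `ω` (widths), and the bijections `σ i` of the horizontal strips
`H^(i)_{k,j}` (`1 ≤ j ≤ M i k`) of `Q_i` and `τ k` of the vertical strips `V^(k)_{i,j}`
(`1 ≤ j ≤ M i k`) of `Q_k`. The label of `H^(i)_{k,j}` is `⟨k, j⟩`, that of `V^(k)_{i,j}` is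
`⟨i, j⟩`. -/
structure PieceData {n : ℕ} (M : Matrix (Fin (n + 1)) (Fin (n + 1)) ℕ) (lam : ℝ) where
  η : Fin (n + 1) → ℝ
  ω : Fin (n + 1) → ℝ
  η_pos : ∀ i, 0 < η i
  ω_pos : ∀ i, 0 < ω i
  η_eigen : ∀ i, ∑ k, (M i k : ℝ) * η k = lam * η i
  ω_eigen : ∀ k, ∑ i, ω i * (M i k : ℝ) = lam * ω k
  σ : ∀ i, Equiv.Perm ((k : Fin (n + 1)) × Fin (M i k))
  τ : ∀ k, Equiv.Perm ((i : Fin (n + 1)) × Fin (M i k))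

namespace PieceData

variable {n : ℕ} {M : Matrix (Fin (n + 1)) (Fin (n + 1)) ℕ} {lam : ℝ} (D : PieceData M lam)

/-- The rectangle `Q_i`, of width `ω i` and height `η i`. -/
def rect (i : Fin (n + 1)) : Set (Pt n) :=
  {q | q.1 = i ∧ q.2.re ∈ Set.Icc 0 (D.ω i) ∧ q.2.im ∈ Set.Icc 0 (D.η i)}

/-- Width of the vertical strip with label `s` in `Q_k`: the strip `τ_k⁻¹ (V^(k)_{i,j})` has width
`ω i / lam`. -/
noncomputable def vWidth (k : Fin (n + 1)) (s : (i : Fin (n + 1)) × Fin (M i k)) : ℝ :=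
  lam⁻¹ * D.ω (D.τ k s).1

/-- Height of the horizontal strip with label `t` in `Q_i`: the strip `σ_i (H^(i)_{k,j})` has
height `η k / lam`. -/
noncomputable def hHeight (i : Fin (n + 1)) (t : (k : Fin (n + 1)) × Fin (M i k)) : ℝ :=
  lam⁻¹ * D.η ((D.σ i).symm t).1

open Classical in
/-- Abscissa of the left edge of a vertical strip (strips are ordered from left to right). -/
noncomputable def vLeft (k : Fin (n + 1)) (s : (i : Fin (n + 1)) × Fin (M i k)) : ℝ :=
  ∑ b with Before b s, D.vWidth k b

/-- Abscissa of the right edge of a vertical strip. -/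
noncomputable def vRight (k : Fin (n + 1)) (s : (i : Fin (n + 1)) × Fin (M i k)) : ℝ :=
  D.vLeft k s + D.vWidth k s

open Classical in
/-- Ordinate of the top edge of a horizontal strip (strips are ordered from top to bottom). -/
noncomputable def hTop (i : Fin (n + 1)) (t : (k : Fin (n + 1)) × Fin (M i k)) : ℝ :=
  D.η i - ∑ b with Before b t, D.hHeight i b

/-- Ordinate of the bottom edge of a horizontal strip. -/
noncomputable def hBot (i : Fin (n + 1)) (t : (k : Fin (n + 1)) × Fin (M i k)) : ℝ :=
  D.hTop i t - D.hHeight i t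

/-- The rectangle containing the image of the vertical strip `s` of `Q_k`. -/
def target (k : Fin (n + 1)) (s : (i : Fin (n + 1)) × Fin (M i k)) : Fin (n + 1) := (D.τ k s).1

/-- The label of the horizontal strip onto which the vertical strip `s` of `Q_k` is mapped:
`τ_k⁻¹ (V^(k)_{i,j})` goes to `σ_i (H^(i)_{k,j})`. -/
def image (k : Fin (n + 1)) (s : (i : Fin (n + 1)) × Fin (M i k)) :
    (l : Fin (n + 1)) × Fin (M (D.target k s) l) :=
  D.σ (D.target k s) ⟨k, (D.τ k s).2⟩

/-- The rectangle containing the preimage of the horizontal strip `t` of `Q_i`. -/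
def source (i : Fin (n + 1)) (t : (k : Fin (n + 1)) × Fin (M i k)) : Fin (n + 1) :=
  ((D.σ i).symm t).1

/-- The label of the vertical strip that is mapped onto the horizontal strip `t` of `Q_i`. -/
def preimage (i : Fin (n + 1)) (t : (k : Fin (n + 1)) × Fin (M i k)) :
    (l : Fin (n + 1)) × Fin (M l (D.source i t)) :=
  (D.τ (D.source i t)).symm ⟨i, ((D.σ i).symm t).2⟩

/-- The affine map (factor `lam` horizontally, `1 / lam` vertically, preserving left/right and
top/bottom) carrying the closed vertical strip `s` of `Q_k` onto a closed horizontal strip. -/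
noncomputable def branch (k : Fin (n + 1)) (s : (i : Fin (n + 1)) × Fin (M i k)) (z : ℂ) : Pt n :=
  (D.target k s,
    ⟨lam * (z.re - D.vLeft k s), D.hBot (D.target k s) (D.image k s) + lam⁻¹ * z.im⟩)

/-- The inverse affine map, from the closed horizontal strip `t` of `Q_i` onto a closed vertical
strip. -/
noncomputable def branchInv (i : Fin (n + 1)) (t : (k : Fin (n + 1)) × Fin (M i k)) (z : ℂ) :
    Pt n :=
  (D.source i t,
    ⟨D.vLeft (D.source i t) (D.preimage i t) + lam⁻¹ * z.re, lam * (z.im - D.hBot i t)⟩)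

/-- The open vertical strip with label `s` in `Q_k`. -/
def vStrip (k : Fin (n + 1)) (s : (i : Fin (n + 1)) × Fin (M i k)) : Set (Pt n) :=
  {q | q.1 = k ∧ q.2.re ∈ Set.Ioo (D.vLeft k s) (D.vRight k s) ∧ q.2.im ∈ Set.Ioo 0 (D.η k)}

/-- The image `f_0 (A)` of a set `A` under the piece map `f_0 : V → H` (that is, `f_0 (A ∩ V)`),
where `V` is the union of the open vertical strips and `f_0` is the affine branch on each of
them. -/
def pieceImage (A : Set (Pt n)) : Set (Pt n) :=
  {p | ∃ k s, ∃ q ∈ A ∩ D.vStrip k s, D.branch k s q.2 = p}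

/-- The unions `L`, `R` of the closed left and right edges of the vertical strips and `T`, `B` of
the closed top and bottom edges of the horizontal strips. -/
def edges : Side → Set (Pt n)
  | Side.left => {q | q.2.im ∈ Set.Icc 0 (D.η q.1) ∧ ∃ s, q.2.re = D.vLeft q.1 s}
  | Side.right => {q | q.2.im ∈ Set.Icc 0 (D.η q.1) ∧ ∃ s, q.2.re = D.vRight q.1 s}
  | Side.top => {q | q.2.re ∈ Set.Icc 0 (D.ω q.1) ∧ ∃ t, q.2.im = D.hTop q.1 t}
  | Side.bottom => {q | q.2.re ∈ Set.Icc 0 (D.ω q.1) ∧ ∃ t, q.2.im = D.hBot q.1 t}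

/-- The closed left, right, top or bottom edge of the rectangle `Q_k`. -/
def edge : Side → Fin (n + 1) → Set (Pt n)
  | Side.left, k => {q | q.1 = k ∧ q.2.re = 0 ∧ q.2.im ∈ Set.Icc 0 (D.η k)}
  | Side.right, k => {q | q.1 = k ∧ q.2.re = D.ω k ∧ q.2.im ∈ Set.Icc 0 (D.η k)}
  | Side.top, k => {q | q.1 = k ∧ q.2.im = D.η k ∧ q.2.re ∈ Set.Icc 0 (D.ω k)}
  | Side.bottom, k => {q | q.1 = k ∧ q.2.im = 0 ∧ q.2.re ∈ Set.Icc 0 (D.ω k)}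

/-- The end points of the edges of `Q_k`: `false` is the bottom (left) end of a vertical
(horizontal) edge, `true` the top (right) end. -/
def corner : Side → Bool → Fin (n + 1) → Pt n
  | Side.left, b, k => (k, ⟨0, if b then D.η k else 0⟩)
  | Side.right, b, k => (k, ⟨D.ω k, if b then D.η k else 0⟩)
  | Side.top, b, k => (k, ⟨if b then D.ω k else 0, D.η k⟩)
  | Side.bottom, b, k => (k, ⟨if b then D.ω k else 0, 0⟩)

open Classical in
/-- The edge maps `f_L`, `f_R` (one-sided continuous extensions of `f_0`) and `f_T⁻¹`, `f_B⁻¹`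
(one-sided continuous extensions of `f_0⁻¹`): a point of the left edge of a vertical strip is
moved by the affine branch of that strip, and so on. Only the values on `edges s` matter; there
the strip is unique. -/
noncomputable def edgeMap : Side → Pt n → Pt n
  | Side.left, q =>
      if h : ∃ s, q.2.re = D.vLeft q.1 s then D.branch q.1 h.choose q.2 else q
  | Side.right, q =>
      if h : ∃ s, q.2.re = D.vRight q.1 s then D.branch q.1 h.choose q.2 else q
  | Side.top, q =>
      if h : ∃ t, q.2.im = D.hTop q.1 t then D.branchInv q.1 h.choose q.2 else q
  | Side.bottom, q =>
      if h : ∃ t, q.2.im = D.hBot q.1 t then D.branchInv q.1 h.choose q.2 else q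

/-- The periodic points of an edge map. -/
def periodic (s : Side) : Set (Pt n) := {x ∈ D.edges s | x ∈ Function.periodicPts (D.edgeMap s)}

/-- The period of a periodic point of an edge map. -/
noncomputable def period (s : Side) (x : Pt n) : ℕ := Function.minimalPeriod (D.edgeMap s) x

/-- The top left corner of `Q_1` is a periodic point of `f_L`. -/
def CornerPeriodic : Prop := D.corner Side.left true 0 ∈ D.periodic Side.left

end PieceData

/-- A choice of an initial point in each periodic orbit of each edge map, such that a corner which
is periodic for two edge maps is initial for one if and only if it is for the other. -/
structure InitialPoints {n : ℕ} {M : Matrix (Fin (n + 1)) (Fin (n + 1)) ℕ} {lam : ℝ}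
    (D : PieceData M lam) where
  pts : Side → Set (Pt n)
  subset : ∀ s, pts s ⊆ D.periodic s
  existsUnique : ∀ s, ∀ x ∈ D.periodic s, ∃! y, y ∈ pts s ∧ ∃ j : ℕ, (D.edgeMap s)^[j] y = x
  compat : ∀ s t x, x ∈ D.periodic s → x ∈ D.periodic t → x ∈ pts s → x ∈ pts t

namespace InitialPoints

variable {n : ℕ} {M : Matrix (Fin (n + 1)) (Fin (n + 1)) ℕ} {lam : ℝ} {D : PieceData M lam}
  (I : InitialPoints D)

/-- Label the periodic orbit of the initial point `x_0` in the direction of `f_0`, that is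
`x_{j+1} = f_L (x_j)`, `f_R (x_j)` on vertical edges and `x_j = f_T⁻¹ (x_{j+1})`,
`f_B⁻¹ (x_{j+1})` on horizontal ones, for `0 ≤ j < p` with indices modulo the period `p`. The
stage of `x_j` is `j`. -/
noncomputable def stage (s : Side) (x : Pt n) : ℕ :=
  if s.forward then sInf {j | ∃ y ∈ I.pts s, (D.edgeMap s)^[j] y = x}
  else sInf {j | (D.edgeMap s)^[j] x ∈ I.pts s}

/-- The initial point of the orbit of the periodic point `x`. -/
noncomputable def root (s : Side) (x : Pt n) : Pt n :=
  if s.forward then (D.edgeMap s)^[D.period s x - I.stage s x] x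
  else (D.edgeMap s)^[I.stage s x] x

/-- The infinite strip at `x_j` is glued along the segment `f_L^(2p+j) (Left edge of Q_i)`, where
`Q_i` contains the initial point (same for `f_R`), respectively
`f_T^(-2p+j) (Top edge of Q_i)` (same for `f_B`). This is the exponent of the edge map. -/
noncomputable def depth (s : Side) (x : Pt n) : ℕ :=
  if s.forward then 2 * D.period s x + I.stage s x else 2 * D.period s x - I.stage s x

/-- The segment along which the infinite strip at the periodic point `x` is glued. -/
noncomputable def base (s : Side) (x : Pt n) : Set (Pt n) :=
  (D.edgeMap s)^[I.depth s x] '' D.edge s (I.root s x).1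

/-- The end points of the segment `base s x`. -/
noncomputable def baseEnd (s : Side) (b : Bool) (x : Pt n) : Pt n :=
  (D.edgeMap s)^[I.depth s x] (D.corner s b (I.root s x).1)

/-- The infinite strip `E_s(x)`, placed in the plane outside of the rectangle as
`base × [0, ∞)`: the strip coordinates `(z, w)` correspond to `push s w` of the point of `base s x`
with affine coordinate `z`. -/
noncomputable def strip (s : Side) (x : Pt n) : Set (Pt n) :=
  {q | ∃ e ∈ I.base s x, ∃ w : ℝ, 0 ≤ w ∧ q = push s w e}

/-- The extended rectangles `Σ_1`. -/
noncomputable def expanded : Set (Pt n) :=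
  (⋃ k, D.rect k) ∪ ⋃ s, ⋃ x ∈ D.periodic s, I.strip s x

/-- The boundary ray of the infinite strip at `x` that starts at the end `b` of its base. -/
noncomputable def ray (s : Side) (b : Bool) (x : Pt n) : Set (Pt n) :=
  {q | ∃ w : ℝ, 0 ≤ w ∧ q = push s w (I.baseEnd s b x)}

/-- The strip at `x` is glued at the end `b` of its edge, so that this boundary ray of the strip
starts at a corner of the rectangle. -/
def IsOuter (s : Side) (b : Bool) (x : Pt n) : Prop := I.baseEnd s b x = D.corner s b x.1

/-- The extended edge: the edge of `Q_k` without the part where a strip is glued, together with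
the boundary rays of that strip, except a ray which starts at a corner of `Q_k`. -/
noncomputable def rim (s : Side) (k : Fin (n + 1)) : Set (Pt n) :=
  {q ∈ D.edge s k | ∀ x ∈ D.periodic s, q ∉ I.base s x} ∪
    {q | ∃ x ∈ D.periodic s, x.1 = k ∧ ∃ b, ¬ I.IsOuter s b x ∧ q ∈ I.ray s b x}

/-- The sets `L_1`, `R_1`, `T_1`, `B_1`. -/
noncomputable def seam (s : Side) : Set (Pt n) :=
  (D.edges s \ ⋃ k, D.edge s k) ∪ ⋃ k, I.rim s k

/-- The lines formed by the boundary rays of strips that start at corners; these stay unglued. -/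
noncomputable def outerBoundary : Set (Pt n) :=
  {q | ∃ s, ∃ x ∈ D.periodic s, ∃ b, I.IsOuter s b x ∧ q ∈ I.ray s b x}

/-- The part of the boundary on which the switch maps are used, so that the edge map of `f_1` is
neither that of `f_0` nor a translation. For left and right sides this is the segment
`f_L^(p+j) (Left edge of Q_i)` at `x_j`. For top and bottom sides it is the segment
`f_T^(-p) (Top edge of Q_i)` at the initial point `x_0` and the boundary of the square
`[0,1] × [0,1]` of the strip at the other points. -/
noncomputable def switch (s : Side) : Set (Pt n) :=
  {q | ∃ x ∈ D.periodic s,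
    (s.forward = true ∧
      q ∈ (D.edgeMap s)^[D.period s x + I.stage s x] '' D.edge s (I.root s x).1) ∨
    (s.forward = false ∧ x ∈ I.pts s ∧ q ∈ (D.edgeMap s)^[D.period s x] '' D.edge s x.1) ∨
    (s.forward = false ∧ x ∉ I.pts s ∧
      ∃ b, ∃ w ∈ Set.Icc (0 : ℝ) 1, q = push s w (I.baseEnd s b x))}

open Classical in
/-- The shift in the strip at `x` under the edge map of `f_1`: once in each cycle, for the step of
`f_0` that arrives at the initial point. -/
noncomputable def shift (s : Side) (x : Pt n) : ℝ :=
  if s.forward then (if D.edgeMap s x ∈ I.pts s then 1 else 0) else (if x ∈ I.pts s then 1 else 0)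

end InitialPoints

/-- The four edge maps `f_{1,L}`, `f_{1,R}`, `f_{1,T}⁻¹`, `f_{1,B}⁻¹` of an extended piece map
`f_1`. They agree with the edge maps of `f_0` on the edges outside of the switch regions and with
the translations along the strips, and they interpolate homeomorphically on the boundary of the
switch regions. The interpolation is a free choice (it is given by the boundary values of the
switch maps); the surface depends on `f_1` through its edge maps only. -/
structure ExtendedEdgeMaps {n : ℕ} {M : Matrix (Fin (n + 1)) (Fin (n + 1)) ℕ} {lam : ℝ}
    {D : PieceData M lam} (I : InitialPoints D) where
  map : Side → Pt n → Pt n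
  mapsTo : ∀ s, Set.MapsTo (map s) (I.seam s) (I.seam s)
  continuousOn : ∀ s, ContinuousOn (map s) (I.seam s)
  injOn : ∀ s k, Set.InjOn (map s) (I.rim s k)
  eq_edgeMap : ∀ s, ∀ q ∈ I.seam s ∩ D.edges s, q ∉ I.switch s → map s q = D.edgeMap s q
  eq_shift : ∀ s, ∀ x ∈ D.periodic s, ∀ b, ¬ I.IsOuter s b x → ∀ w : ℝ, 0 ≤ w →
    push s w (I.baseEnd s b x) ∉ I.switch s →
    map s (push s w (I.baseEnd s b x)) =
      push s (w + I.shift s x) (I.baseEnd s b (D.edgeMap s x))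

namespace ExtendedEdgeMaps

variable {n : ℕ} {M : Matrix (Fin (n + 1)) (Fin (n + 1)) ℕ} {lam : ℝ} {D : PieceData M lam}
  {I : InitialPoints D} (E : ExtendedEdgeMaps I)

/-- The generating relation: the two images of one point of `L_1 ∩ R_1` under the same positive
iterate of the left and right edge maps, and the same for `T_1 ∩ B_1`. -/
def Glue (z w : Pt n) : Prop :=
  (∃ x ∈ I.seam Side.left ∩ I.seam Side.right, ∃ N : ℕ, 1 ≤ N ∧
      z = (E.map Side.left)^[N] x ∧ w = (E.map Side.right)^[N] x) ∨
    ∃ y ∈ I.seam Side.top ∩ I.seam Side.bottom, ∃ N : ℕ, 1 ≤ N ∧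
      z = (E.map Side.top)^[N] y ∧ w = (E.map Side.bottom)^[N] y

/-- The equivalence relation `∼`, so that `Σ_2 = Σ_1 / ∼`. -/
def Equiv₂ : Pt n → Pt n → Prop := Relation.EqvGen E.Glue

/-- The points of `Σ_1` that are replaced by their links: those with infinite equivalence class,
and the points of a chosen set `G`. -/
def singular (G : Set (Pt n)) : Set (Pt n) :=
  {q ∈ I.expanded | {p | E.Equiv₂ q p}.Infinite} ∪ G

end ExtendedEdgeMaps

/-- The direction from `s` to `p` in the plane containing them. -/
noncomputable def direction {n : ℕ} (s p : Pt n) : ℂ :=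
  if p.1 = s.1 then (p.2 - s.2) / (‖p.2 - s.2‖ : ℂ) else 0

/-- The blow-up of the planar region `K` at the points of `S`: each point of `K ∩ S` is replaced by
its link in `K`, the arc (or circle) of directions in which `K` leaves the point. It is realised as
the closure of the graph of the direction maps over `K \ S`. -/
def blowup {n : ℕ} (K S : Set (Pt n)) : Set (Pt n × (S → ℂ)) :=
  closure ((fun p : Pt n => (p, fun s : S => direction s.1 p)) '' (K \ S))

namespace ExtendedEdgeMaps

variable {n : ℕ} {M : Matrix (Fin (n + 1)) (Fin (n + 1)) ℕ} {lam : ℝ} {D : PieceData M lam}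
  {I : InitialPoints D} (E : ExtendedEdgeMaps I) (G : Set (Pt n))

/-- `Σ_1` with its singular points replaced by their links in `Σ_1`. -/
abbrev Blown : Type := blowup I.expanded (E.singular G)

/-- The gluing `∼` on the blow-up: it is `∼` off the links, and the end points of the arcs of
directions are glued as the edges ending there, that is, by passing to limits. The arcs over one
infinite class thereby become the link of the corresponding point of `Σ_2`. -/
def blownSetoid : Setoid (E.Blown G) :=
  Relation.EqvGen.setoid fun a b =>
    (a, b) ∈ closure {c : E.Blown G × E.Blown G |
      c.1.1.1 ∉ E.singular G ∧ c.2.1.1 ∉ E.singular G ∧ E.Equiv₂ c.1.1.1 c.2.1.1}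

/-- The surface with boundary `Σ_2'`: the complex `Σ_2 = Σ_1 / ∼` with its singular points replaced
by their links. -/
abbrev Bordered : Type := Quotient (E.blownSetoid G)

/-- The boundary of `Σ_2'`: the points of the links, and the points of the frontier of `Σ_1` that
are glued to no other point. -/
def border : Set (E.Bordered G) :=
  {y | ∃ a : E.Blown G, y = Quotient.mk (E.blownSetoid G) a ∧
    (a.1.1 ∈ E.singular G ∨
      (a.1.1 ∈ frontier I.expanded ∧ ∀ p, E.Equiv₂ a.1.1 p → p = a.1.1))}

/-- Two copies of `Σ_2'`, glued along the boundary by the identity map. -/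
def doubleSetoid : Setoid (E.Bordered G × Bool) where
  r a b := a.1 = b.1 ∧ (a.2 = b.2 ∨ a.1 ∈ E.border G)
  iseqv :=
    { refl := fun _ => ⟨rfl, Or.inl rfl⟩
      symm := by
        rintro a b ⟨h, h2⟩
        exact ⟨h.symm, h2.imp Eq.symm (fun h3 => h ▸ h3)⟩
      trans := by
        rintro a b c ⟨h, h2⟩ ⟨h3, h4⟩
        refine ⟨h.trans h3, ?_⟩
        rcases h2 with h2 | h2
        · rcases h4 with h4 | h4
          · exact Or.inl (h2.trans h4)
          · exact Or.inr (h.symm ▸ h4)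
        · exact Or.inr h2 }

/-- The surface `Σ` corresponding to `M` and the choices made: the double of `Σ_2'` along its
boundary. -/
abbrev Surface : Type := Quotient (E.doubleSetoid G)

end ExtendedEdgeMaps

/-! ### Perron–Frobenius theory for primitive matrices. -/

section PerronFrobenius

/-! Part (a) is Lind's theorem. Modulo the minimal polynomial of `lam`, the coefficient vector of `X
^ L * g` grows like `lam ^ L` times a fixed vector `e`, because every other conjugate is smaller in
absolute value. So it eventually falls into the cone spanned by all integer vectors in a box around
a large multiple of `e`. This writes `lam ^ (L + 1) * x b` as a positive integer combination of
finitely many positive numbers, and a tower over that relation is a primitive matrix with a positive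
left eigenvector for `lam` (`IsPerron.exists_decomposition`, `towerMatrix`).

For part (b), Perron–Frobenius gives the eigenvectors. A choice of successors returning to the first
rectangle, followed by permutations sending top left corners to top left corners, makes the corner
periodic. Initial points are chosen as a function of the orbit as a set, which makes the choices for
different edge maps compatible. Extended edge maps are affine along the strips, except at the step
where an orbit shifts, where a segment of the edge is pushed onto the boundary ray (`pushOut`).

All four edge maps are treated at once through `SideModel`: an edge map contracts finitely many
segments by `lam⁻¹` onto pieces of sides with disjoint interiors. Hence each side carries at most
one periodic point, and the extended side consists of at most two arms around its infinite strip.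

For part (c), an iterated image of the first rectangle contains a strip of full width in every
rectangle it reaches, so primitivity gives the first claim. For connectedness, each rectangle with
its strips has connected interior, and this persists in the blow-up. It remains to glue enough
rectangles. On the common edge of two adjacent vertical strips, all but countably many points are
generic: their images under the same iterate of the left and right edge maps are glued to each other
and to nothing else (`glue_generic`), so the gluing survives the blow-up. Walking across the strips
of a rectangle and inducting on the number of iterates, every rectangle met by an iterated image of
one rectangle lies in a single component (`rel_of_pow_pos`); primitivity then gives all of them.
Finally, periodicity of the corner supplies an unglued boundary ray, so the boundary is nonempty and
the two copies in the double are joined. -/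

theorem mulVec_pos_of_entries_pos {ι : Type*} [Fintype ι] {P : Matrix ι ι ℝ} (hP : ∀ i j, 0 < P i j) {x : ι → ℝ}
    (hx : ∀ i, 0 ≤ x i) (hx0 : x ≠ 0) (i : ι) : 0 < (P.mulVec x) i := by
  obtain ⟨j, hj⟩ := Function.ne_iff.mp hx0
  refine Finset.sum_pos' (fun k _ => mul_nonneg (hP i k).le (hx k)) ⟨j, Finset.mem_univ j, ?_⟩
  exact mul_pos (hP i j) (lt_of_le_of_ne (hx j) (Ne.symm hj))

variable {ι : Type*} [Fintype ι] [DecidableEq ι]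

/-- Collatz–Wielandt: take the largest `ρ` with `ρ x ≤ A x` for some `x` in the simplex. If equality
failed, applying the positive matrix `A ^ k` to the nonzero defect would make the inequality strict
in every coordinate, and `ρ` could be increased. Then `A ^ k x = ρ ^ k x` forces `x` to be positive.
-/
theorem exists_pos_eigenvector [Nonempty ι] {A : Matrix ι ι ℝ} (hA : ∀ i j, 0 ≤ A i j) {k : ℕ}
    (hk : ∀ i j, 0 < (A ^ k) i j) :
    ∃ (ρ : ℝ) (x : ι → ℝ), 0 ≤ ρ ∧ (∀ i, 0 < x i) ∧ A.mulVec x = ρ • x := by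
  classical
  -- The bound on `ρ` by the sum of all entries is automatic on the simplex (`hbound`); including it
  -- makes the set compact.
  set C : Set (ℝ × (ι → ℝ)) :=
    {q | q.1 ∈ Set.Icc 0 (∑ i, ∑ j, A i j) ∧ q.2 ∈ stdSimplex ℝ ι ∧
      ∀ i, q.1 * q.2 i ≤ A.mulVec q.2 i} with hC
  have hbound : ∀ x ∈ stdSimplex ℝ ι, ∀ ρ : ℝ, (∀ i, ρ * x i ≤ A.mulVec x i) →
      ρ ≤ ∑ i, ∑ j, A i j := by
    intro x hx ρ h
    calc ρ = ∑ i, ρ * x i := by rw [← Finset.mul_sum, hx.2, mul_one]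
      _ ≤ ∑ i, A.mulVec x i := Finset.sum_le_sum fun i _ => h i
      _ ≤ ∑ i, ∑ j, A i j := by
          refine Finset.sum_le_sum fun i _ => Finset.sum_le_sum fun j _ => ?_
          have : x j ≤ 1 := by
            rw [← hx.2]
            exact Finset.single_le_sum (fun k _ => hx.1 k) (Finset.mem_univ j)
          exact mul_le_of_le_one_right (hA i j) this
  have hcont : ∀ i, Continuous fun q : ℝ × (ι → ℝ) => A.mulVec q.2 i := fun i => by
    simp only [Matrix.mulVec, dotProduct]; fun_prop
  have hCc : IsCompact C := by
    refine ((isCompact_Icc (a := (0 : ℝ)) (b := ∑ i, ∑ j, A i j)).prod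
      (isCompact_stdSimplex ℝ ι)).of_isClosed_subset ?_ (fun q hq => ⟨hq.1, hq.2.1⟩)
    have hCeq : C = Prod.fst ⁻¹' Set.Icc 0 (∑ i, ∑ j, A i j) ∩ (Prod.snd ⁻¹' stdSimplex ℝ ι ∩
        ⋂ i, {q : ℝ × (ι → ℝ) | q.1 * q.2 i ≤ A.mulVec q.2 i}) := by
      ext q
      simp [hC]
    rw [hCeq]
    exact (isClosed_Icc.preimage continuous_fst).inter
      (((isClosed_stdSimplex ℝ ι).preimage continuous_snd).inter
        (isClosed_iInter fun i => isClosed_le (by fun_prop) (hcont i)))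
  have hCn : C.Nonempty := by
    obtain ⟨i⟩ := ‹Nonempty ι›
    refine ⟨(0, Pi.single i 1), ⟨le_rfl, ?_⟩, single_mem_stdSimplex ℝ i, fun j => ?_⟩
    · exact Finset.sum_nonneg fun i _ => Finset.sum_nonneg fun j _ => hA i j
    · rw [zero_mul]
      exact Finset.sum_nonneg fun l _ => mul_nonneg (hA j l)
        ((single_mem_stdSimplex ℝ i).1 l)
  obtain ⟨⟨ρ, x⟩, ⟨hρ, hx, hle⟩, hmax⟩ := hCc.exists_isMaxOn hCn continuous_fst.continuousOn
  simp only at hρ hx hle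
  have hx0 : x ≠ 0 := by
    rintro rfl
    have := hx.2
    simp at this
  have heq : A.mulVec x = ρ • x := by
    by_contra hne
    set d : ι → ℝ := A.mulVec x - ρ • x with hd
    have hd0 : d ≠ 0 := sub_ne_zero.mpr hne
    have hdn : ∀ i, 0 ≤ d i := fun i => by simpa [hd] using hle i
    set y := (A ^ k).mulVec x with hy
    have hypos : ∀ i, 0 < y i := mulVec_pos_of_entries_pos hk hx.1 hx0
    have hdy : A.mulVec y - ρ • y = (A ^ k).mulVec d := by
      rw [hd, Matrix.mulVec_sub, Matrix.mulVec_smul, hy, Matrix.mulVec_mulVec,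
        Matrix.mulVec_mulVec, ← pow_succ, ← pow_succ']
    have hdpos : ∀ i, 0 < A.mulVec y i - ρ * y i := fun i => by
      have := mulVec_pos_of_entries_pos hk hdn hd0 i
      rw [← hdy] at this
      simpa using this
    -- The smallest relative excess `ε` is positive, so the normalised `y` satisfies the inequality
    -- for `ρ + ε`, against maximality.
    obtain ⟨i₀, hi₀⟩ := Finite.exists_min fun i => (A.mulVec y i - ρ * y i) / y i
    set ε := (A.mulVec y i₀ - ρ * y i₀) / y i₀
    have hε : 0 < ε := div_pos (hdpos i₀) (hypos i₀)
    have hS : 0 < ∑ i, y i := Finset.sum_pos (fun i _ => hypos i) Finset.univ_nonempty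
    have hz : (∑ i, y i)⁻¹ • y ∈ stdSimplex ℝ ι := by
      refine ⟨fun i => mul_nonneg (inv_pos.mpr hS).le (hypos i).le, ?_⟩
      simp only [Pi.smul_apply, smul_eq_mul, ← Finset.mul_sum]
      exact inv_mul_cancel₀ hS.ne'
    have hzle : ∀ i, (ρ + ε) * ((∑ i, y i)⁻¹ • y) i ≤ A.mulVec ((∑ i, y i)⁻¹ • y) i := by
      intro i
      rw [Matrix.mulVec_smul]
      simp only [Pi.smul_apply, smul_eq_mul]
      have h1 : (ρ + ε) * y i ≤ A.mulVec y i := by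
        have := (le_div_iff₀ (hypos i)).mp (hi₀ i)
        linarith
      calc (ρ + ε) * ((∑ i, y i)⁻¹ * y i) = (∑ i, y i)⁻¹ * ((ρ + ε) * y i) := by ring
        _ ≤ _ := mul_le_mul_of_nonneg_left h1 (inv_pos.mpr hS).le
    have := hmax (show (ρ + ε, (∑ i, y i)⁻¹ • y) ∈ C from
      ⟨⟨by linarith [hρ.1], hbound _ hz _ hzle⟩, hz, hzle⟩)
    simp only [Set.mem_ofPred_eq] at this
    linarith
  refine ⟨ρ, x, hρ.1, fun i => ?_, heq⟩
  have hpow : ∀ m : ℕ, (A ^ m).mulVec x = ρ ^ m • x := by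
    intro m
    induction m with
    | zero => simp
    | succ m ih =>
      rw [pow_succ', ← Matrix.mulVec_mulVec, ih, Matrix.mulVec_smul, heq, smul_smul, ← pow_succ]
  have := mulVec_pos_of_entries_pos hk hx.1 hx0 i
  rw [hpow] at this
  exact pos_of_mul_pos_right this (pow_nonneg hρ.1 k)

/-- A non-negative matrix with a positive left eigenvector has the eigenvalue as its spectral
radius. -/
theorem spectralRadius_of_pos_left_eigenvector [Nonempty ι] {M : Matrix ι ι ℕ} {ρ : ℝ}
    {p : ι → ℝ} (hp : ∀ i, 0 < p i) (h : ∀ k, ∑ i, p i * (M i k : ℝ) = ρ * p k) :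
    spectralRadius ℂ (M.map (fun m : ℕ => (m : ℂ))) = ENNReal.ofReal ρ := by
  have hρ : 0 ≤ ρ := by
    obtain ⟨k⟩ := ‹Nonempty ι›
    have h1 : 0 ≤ ρ * p k := by
      rw [← h k]; exact Finset.sum_nonneg fun i _ => mul_nonneg (hp i).le (Nat.cast_nonneg _)
    exact nonneg_of_mul_nonneg_left h1 (hp k)
  have hmem : ∀ μ : ℂ, μ ∈ spectrum ℂ (M.map (fun m : ℕ => (m : ℂ))) ↔
      (algebraMap ℂ (Matrix ι ι ℂ) μ - M.map (fun m : ℕ => (m : ℂ))).det = 0 := by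
    intro μ
    rw [spectrum.mem_iff, Matrix.isUnit_iff_isUnit_det, isUnit_iff_ne_zero, not_not]
  refine le_antisymm ?_ ?_
  · refine iSup₂_le fun μ hμ => ?_
    obtain ⟨v, hv0, hv⟩ := Matrix.exists_mulVec_eq_zero_iff.mpr ((hmem μ).mp hμ)
    rw [Matrix.sub_mulVec, sub_eq_zero] at hv
    -- An eigenvector for `μ` gives `‖μ‖ |v| ≤ M |v|`; pairing with the positive left eigenvector
    -- `p` yields `‖μ‖ ≤ ρ`.
    have hle : ∀ i, ‖μ‖ * ‖v i‖ ≤ ∑ j, (M i j : ℝ) * ‖v j‖ := by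
      intro i
      have hi := congrFun hv i
      rw [Algebra.algebraMap_eq_smul_one, Matrix.smul_mulVec, Matrix.one_mulVec] at hi
      simp only [Pi.smul_apply, smul_eq_mul] at hi
      rw [← norm_mul, hi]
      refine (norm_sum_le _ _).trans (le_of_eq (Finset.sum_congr rfl fun j _ => ?_))
      simp
    have hpos : 0 < ∑ i, p i * ‖v i‖ := by
      obtain ⟨j, hj⟩ := Function.ne_iff.mp hv0
      exact Finset.sum_pos' (fun i _ => mul_nonneg (hp i).le (norm_nonneg _))
        ⟨j, Finset.mem_univ j, mul_pos (hp j) (norm_pos_iff.mpr hj)⟩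
    have hsum : ‖μ‖ * ∑ i, p i * ‖v i‖ ≤ ρ * ∑ i, p i * ‖v i‖ := by
      calc ‖μ‖ * ∑ i, p i * ‖v i‖ = ∑ i, p i * (‖μ‖ * ‖v i‖) := by
            rw [Finset.mul_sum]; exact Finset.sum_congr rfl fun i _ => by ring
        _ ≤ ∑ i, p i * ∑ j, (M i j : ℝ) * ‖v j‖ :=
            Finset.sum_le_sum fun i _ => mul_le_mul_of_nonneg_left (hle i) (hp i).le
        _ = ∑ j, (∑ i, p i * (M i j : ℝ)) * ‖v j‖ := by
            simp_rw [Finset.mul_sum, Finset.sum_mul]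
            rw [Finset.sum_comm]
            exact Finset.sum_congr rfl fun i _ => Finset.sum_congr rfl fun j _ => by ring
        _ = ρ * ∑ i, p i * ‖v i‖ := by
            rw [Finset.mul_sum]; exact Finset.sum_congr rfl fun i _ => by rw [h]; ring
    have hμρ : ‖μ‖ ≤ ρ := le_of_mul_le_mul_right hsum hpos
    rw [← enorm_eq_nnnorm, ← ofReal_norm]
    exact ENNReal.ofReal_le_ofReal hμρ
  · have hρmem : (ρ : ℂ) ∈ spectrum ℂ (M.map (fun m : ℕ => (m : ℂ))) := by
      rw [hmem, ← Matrix.exists_vecMul_eq_zero_iff]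
      refine ⟨fun i => (p i : ℂ), ?_, ?_⟩
      · obtain ⟨k⟩ := ‹Nonempty ι›
        exact Function.ne_iff.mpr ⟨k, by simpa using (hp k).ne'⟩
      · rw [Matrix.vecMul_sub, sub_eq_zero]
        funext k
        rw [Algebra.algebraMap_eq_smul_one, Matrix.vecMul_smul, Matrix.vecMul_one]
        simp only [Pi.smul_apply, smul_eq_mul, Matrix.vecMul, dotProduct, Matrix.map_apply]
        have := h k
        exact_mod_cast this.symm
    calc ENNReal.ofReal ρ = (‖(ρ : ℂ)‖₊ : ENNReal) := by
          rw [← enorm_eq_nnnorm, ← ofReal_norm]; simp [abs_of_nonneg hρ]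
      _ ≤ _ := le_iSup₂ (f := fun k (_ : k ∈ spectrum ℂ _) => (‖k‖₊ : ENNReal)) _ hρmem

end PerronFrobenius

/-- Right and left eigenvectors come from the matrix and its transpose. Evaluating `ω A η` in two
ways shows that their eigenvalues agree, and the left one is the spectral radius. -/
theorem IsPrimitiveWithRadius.exists_eigenvectors {n : ℕ}
    {M : Matrix (Fin (n + 1)) (Fin (n + 1)) ℕ} {lam : ℝ} (hM : IsPrimitiveWithRadius M lam)
    (h0 : 0 < lam) :
    ∃ η ω : Fin (n + 1) → ℝ, (∀ i, 0 < η i) ∧ (∀ i, 0 < ω i) ∧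
      (∀ i, ∑ k, (M i k : ℝ) * η k = lam * η i) ∧
      ∀ k, ∑ i, ω i * (M i k : ℝ) = lam * ω k := by
  obtain ⟨⟨k, hk0, hk⟩, hr⟩ := hM
  set A : Matrix (Fin (n + 1)) (Fin (n + 1)) ℝ := M.map (Nat.castRingHom ℝ) with hA
  have hAk : ∀ i j, 0 < (A ^ k) i j := fun i j => by
    have : A ^ k = (M ^ k).map (Nat.castRingHom ℝ) := (Matrix.map_pow M (Nat.castRingHom ℝ) k).symm
    rw [this]
    simpa using hk i j
  have hAn : ∀ i j, 0 ≤ A i j := fun i j => by simp [hA]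
  obtain ⟨ρ, η, -, hη, hηe⟩ := exists_pos_eigenvector hAn hAk
  obtain ⟨ρ', ω, hρ', hω, hωe⟩ := exists_pos_eigenvector (A := A.transpose) (k := k)
    (fun i j => hAn j i) (fun i j => by rw [← Matrix.transpose_pow]; exact hAk j i)
  have e1 : ∀ i, ∑ k, (M i k : ℝ) * η k = ρ * η i := fun i => by
    have := congrFun hηe i
    simpa [Matrix.mulVec, dotProduct, hA] using this
  have e2 : ∀ k, ∑ i, ω i * (M i k : ℝ) = ρ' * ω k := fun k => by
    have := congrFun hωe k
    simp only [Matrix.mulVec, dotProduct, hA, Matrix.transpose_apply, Matrix.map_apply,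
      Pi.smul_apply, smul_eq_mul] at this
    rw [← this]
    exact Finset.sum_congr rfl fun i _ => by simp [mul_comm]
  have hρ'lam : ρ' = lam := by
    have := spectralRadius_of_pos_left_eigenvector hω e2
    rw [hr] at this
    exact ((ENNReal.ofReal_eq_ofReal_iff h0.le hρ').mp this).symm
  have hρρ' : ρ = ρ' := by
    have hpos : 0 < ∑ i, ω i * η i := Finset.sum_pos (fun i _ => mul_pos (hω i) (hη i))
      Finset.univ_nonempty
    have : ρ * ∑ i, ω i * η i = ρ' * ∑ i, ω i * η i := by
      calc ρ * ∑ i, ω i * η i = ∑ i, ω i * (ρ * η i) := by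
            rw [Finset.mul_sum]; exact Finset.sum_congr rfl fun i _ => by ring
        _ = ∑ i, ω i * ∑ k, (M i k : ℝ) * η k := by simp_rw [e1]
        _ = ∑ k, (∑ i, ω i * (M i k : ℝ)) * η k := by
            simp_rw [Finset.mul_sum, Finset.sum_mul]
            rw [Finset.sum_comm]
            exact Finset.sum_congr rfl fun i _ => Finset.sum_congr rfl fun j _ => by ring
        _ = ρ' * ∑ i, ω i * η i := by
            rw [Finset.mul_sum]; exact Finset.sum_congr rfl fun i _ => by rw [e2]; ring
    exact mul_right_cancel₀ hpos.ne' this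
  subst hρ'lam hρρ'
  exact ⟨η, ω, hη, hω, e1, e2⟩

/-! ### Perron numbers: positive integer relations between positive elements. -/

section Lind

open Polynomial in
/-- Coefficients of `X ^ L * g` modulo the minimal polynomial of a Perron number grow like its
powers. -/
theorem IsPerron.exists_coeff_asymptotics {lam : ℝ} (h : IsPerron lam) :
    ∃ e : ℕ → ℝ, ∑ k ∈ Finset.range (minpoly ℤ lam).natDegree, e k * lam ^ k = 1 ∧
      ∀ (g : ℤ[X]) (k : ℕ), Filter.Tendsto
        (fun L : ℕ => (((X ^ L * g) %ₘ minpoly ℤ lam).coeff k : ℝ) / lam ^ L) Filter.atTop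
        (nhds (aeval lam g * e k)) := by
  obtain ⟨hint, hpos, hconj⟩ := h
  set f := minpoly ℤ lam with hf
  have hmonic : f.Monic := minpoly.monic hint
  have hintQ : IsIntegral ℚ lam := hint.tower_top
  have hfQ : minpoly ℚ lam = f.map (algebraMap ℤ ℚ) :=
    minpoly.isIntegrallyClosed_eq_field_fractions' ℚ hint
  set R : Finset ℂ := ((minpoly ℚ lam).rootSet ℂ).toFinset with hR
  have hne : minpoly ℚ lam ≠ 0 := minpoly.ne_zero hintQ
  have hRmem : ∀ z, z ∈ R ↔ aeval z (minpoly ℚ lam) = 0 := fun z => by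
    rw [hR, Set.mem_toFinset, mem_rootSet_of_ne hne]
  have hRf : ∀ z ∈ R, aeval z f = 0 := fun z hz => by
    have := (hRmem z).mp hz
    rwa [hfQ, aeval_map_algebraMap] at this
  have hRcard : R.card = f.natDegree := by
    rw [hR, Set.toFinset_card, card_rootSet_eq_natDegree
      (minpoly.irreducible hintQ).separable (IsAlgClosed.splits _), hfQ,
      hmonic.natDegree_map]
  have hlamR : (lam : ℂ) ∈ R := by
    rw [hRmem]
    have : aeval ((algebraMap ℝ ℂ) lam) (minpoly ℚ lam) = 0 := by
      rw [aeval_algebraMap_apply, minpoly.aeval, map_zero]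
    exact this
  have hinj : Set.InjOn (id : ℂ → ℂ) ↑R := Function.injective_id.injOn
  set c : ℂ → ℕ → ℂ := fun z k => (Lagrange.basis R id z).coeff k with hc
  -- The remainder modulo `f` has degree below the number of conjugates and agrees with `p` at each
  -- of them, so it is the Lagrange interpolant of these values.
  have hcoeff : ∀ (p : ℤ[X]) (k : ℕ), (((p %ₘ f).coeff k : ℤ) : ℂ) =
      ∑ z ∈ R, aeval z p * c z k := by
    intro p k
    set P : ℂ[X] := (p %ₘ f).map (algebraMap ℤ ℂ) with hP
    have hPdeg : P.degree < R.card := by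
      rw [hRcard]
      refine lt_of_le_of_lt degree_map_le ?_
      rw [← degree_eq_natDegree hmonic.ne_zero]
      exact degree_modByMonic_lt p hmonic
    have h1 := congrArg (fun q => coeff q k) (Lagrange.eq_interpolate hinj hPdeg)
    simp only [Lagrange.interpolate_apply, finsetSum_coeff, coeff_C_mul] at h1
    rw [hP, coeff_map] at h1
    refine h1.trans (Finset.sum_congr rfl fun z hz => ?_)
    rw [id, eval_map_algebraMap, aeval_modByMonic_eq_self_of_root (hRf z hz)]
  -- The vector `e` consists of the coefficients of the Lagrange basis polynomial at `lam`, which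
  -- takes the value 1 there. Real parts avoid showing that these coefficients are real.
  refine ⟨fun k => (c lam k).re, ?_, fun g k => ?_⟩
  · have h1 := Lagrange.eval_basis_self hinj hlamR
    have hd : 0 < R.card := Finset.card_pos.mpr ⟨_, hlamR⟩
    rw [eval_eq_sum_range' (n := f.natDegree)
      (by rw [Lagrange.natDegree_basis hinj hlamR, ← hRcard]; omega)] at h1
    have h2 := congrArg Complex.re h1
    rw [Complex.re_sum, Complex.one_re] at h2
    rw [← h2]
    refine Finset.sum_congr rfl fun k _ => ?_
    rw [id, ← Complex.ofReal_pow, Complex.re_mul_ofReal]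
  -- After division by `lam ^ L`, only the term of `lam` survives, since the other conjugates have
  -- smaller absolute value.
  · have hlim : Filter.Tendsto (fun L : ℕ => ∑ z ∈ R, (z / lam) ^ L * (aeval z g * c z k))
        Filter.atTop (nhds (∑ z ∈ R, if z = (lam : ℂ) then aeval z g * c z k else 0)) := by
      refine tendsto_finsetSum _ fun z hz => ?_
      split_ifs with hzl
      · have : z / (lam : ℂ) = 1 := by
          rw [hzl]; exact div_self (Complex.ofReal_ne_zero.mpr hpos.ne')
        simp [this]
      · have hlt : ‖z / (lam : ℂ)‖ < 1 := by
          rw [norm_div, Complex.norm_real, Real.norm_of_nonneg hpos.le, div_lt_one hpos]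
          exact hconj z ((hRmem z).mp hz) hzl
        simpa using (tendsto_pow_atTop_nhds_zero_of_norm_lt_one hlt).mul_const
          (aeval z g * c z k)
    rw [Finset.sum_ite_eq' R, if_pos hlamR] at hlim
    have hre := (Complex.continuous_re.tendsto _).comp hlim
    have hgl : aeval (lam : ℂ) g = ((aeval lam g : ℝ) : ℂ) :=
      aeval_algebraMap_apply ℂ lam g
    rw [hgl, Complex.re_ofReal_mul] at hre
    refine hre.congr fun L => ?_
    have h3 : ((((X ^ L * g) %ₘ f).coeff k : ℤ) : ℂ) / (lam : ℂ) ^ L =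
        ∑ z ∈ R, (z / lam) ^ L * (aeval z g * c z k) := by
      rw [hcoeff, Finset.sum_div]
      refine Finset.sum_congr rfl fun z _ => ?_
      rw [map_mul, map_pow, aeval_X, div_pow]
      ring
    rw [Function.comp_apply, ← h3]
    have h4 : ((((X ^ L * g) %ₘ f).coeff k : ℤ) : ℂ) / (lam : ℂ) ^ L =
        ((((((X ^ L * g) %ₘ f).coeff k : ℤ) : ℝ) / lam ^ L : ℝ) : ℂ) := by push_cast; rfl
    rw [h4, Complex.ofReal_re]

/-- An integer vector in the `m`-fold dilate of a box is a sum of `m` integer vectors of the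
box. -/
theorem exists_sum_of_box {κ : Type*} [Fintype κ] [DecidableEq κ] (m : ℕ) (r : κ → ℤ)
    (h : ∀ k, |r k| ≤ 2 * m) :
    ∃ c : ↥(Finset.Icc (fun _ : κ => (-2 : ℤ)) (fun _ => 2)) → ℕ,
      ∑ s, c s = m ∧ ∀ k, ∑ s, (c s : ℤ) * s.1 k = r k := by
  induction m generalizing r with
  | zero =>
    refine ⟨fun _ => 0, by simp, fun k => ?_⟩
    have := h k
    simp only [Nat.cast_zero, mul_zero, abs_nonpos_iff] at this
    simp [this]
  | succ m ih =>
    -- Peel off the coordinatewise truncation to `[-2, 2]`; each remaining coordinate is then at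
    -- most `2 * m` in absolute value.
    set s₀ : κ → ℤ := fun k => max (-2) (min 2 (r k)) with hs₀
    have hmem : s₀ ∈ Finset.Icc (fun _ : κ => (-2 : ℤ)) (fun _ => 2) := by
      rw [Finset.mem_Icc]
      constructor
      · intro k; exact le_max_left _ _
      · intro k; simp only [hs₀]; omega
    obtain ⟨c, hc, hcr⟩ := ih (fun k => r k - s₀ k) (fun k => by
      have := abs_le.mp (h k)
      rw [abs_le]
      push_cast at this
      simp only [hs₀]
      omega)
    refine ⟨fun s => c s + if s = ⟨s₀, hmem⟩ then 1 else 0, ?_, fun k => ?_⟩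
    · rw [Finset.sum_add_distrib, hc]; simp
    · have := hcr k
      simp only [Nat.cast_add, add_mul, Finset.sum_add_distrib, this]
      simp

open Polynomial in
/-- Positive elements whose images under a power of a Perron number decompose with positive
multiplicities. -/
theorem IsPerron.exists_decomposition {lam : ℝ} (h : IsPerron lam) (h1 : 1 < lam) :
    ∃ (β : Type) (_ : Fintype β) (_ : DecidableEq β) (x : β → ℝ) (L : ℕ) (z₀ : β)
      (c : β → β → ℕ), (∀ b, 0 < x b) ∧
      ∀ b, lam ^ (L + 1) * x b = ∑ s, (1 + c b s : ℕ) * x s + lam ^ L * x z₀ := by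
  obtain ⟨e, he, hlim⟩ := h.exists_coeff_asymptotics
  have hpos := h.2.1
  have hmonic : (minpoly ℤ lam).Monic := minpoly.monic h.1
  set f := minpoly ℤ lam with hf
  set d := f.natDegree with hd
  have hfl : aeval lam f = 0 := minpoly.aeval ℤ lam
  have heval : ∀ p : ℤ[X], aeval lam p = ∑ k : Fin d, ((p %ₘ f).coeff k : ℝ) * lam ^ (k : ℕ) := by
    intro p
    rw [← aeval_modByMonic_eq_self_of_root hfl, Fin.sum_univ_eq_sum_range
      (fun k => ((p %ₘ f).coeff k : ℝ) * lam ^ k)]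
    have hdp : 0 < d := minpoly.natDegree_pos h.1
    rw [aeval_eq_sum_range' (n := d)]
    · simp
    · exact natDegree_modByMonic_lt p hmonic (fun h1 => by simp [hd, h1] at hdp)
  -- The vectors `u + s`, with `u` the rounding of `N e`, differ from `N e` by at most 1/2 + 2 < 3
  -- in each coordinate, and `N e` evaluates to `N` at `lam`. This choice of `N` makes all `x s`
  -- positive.
  obtain ⟨N, hN⟩ := exists_nat_gt (3 * ∑ k ∈ Finset.range d, lam ^ k)
  have hS : 0 ≤ ∑ k ∈ Finset.range d, lam ^ k := Finset.sum_nonneg fun k _ => by positivity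
  have hN0 : (0 : ℝ) < N := by linarith
  set u : Fin d → ℤ := fun k => round (N * e k) with hu
  let β := ↥(Finset.Icc (fun _ : Fin d => (-2 : ℤ)) (fun _ => 2))
  have hβ : ∀ (s : β) k, |(s.1 k : ℝ)| ≤ 2 := fun s k => by
    have := Finset.mem_Icc.mp s.2
    have h2 : |s.1 k| ≤ 2 := abs_le.mpr ⟨this.1 k, this.2 k⟩
    exact_mod_cast h2
  set G : β → ℤ[X] := fun s => ∑ k : Fin d, C (u k + s.1 k) * X ^ (k : ℕ) with hG
  set x : β → ℝ := fun s => ∑ k : Fin d, ((u k : ℝ) + s.1 k) * lam ^ (k : ℕ) with hx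
  have hGx : ∀ s, aeval lam (G s) = x s := fun s => by simp [hG, hx]
  have hxpos : ∀ s, 0 < x s := by
    intro s
    have h2 : ∀ k : Fin d, (N * e k - 3) * lam ^ (k : ℕ) ≤ ((u k : ℝ) + s.1 k) * lam ^ (k : ℕ) := by
      intro k
      refine mul_le_mul_of_nonneg_right ?_ (by positivity)
      have a1 := abs_le.mp (abs_sub_round (N * e k : ℝ))
      have a2 := abs_le.mp (hβ s k)
      simp only [hu]
      linarith [a1.2, a2.1]
    have h3 : x s ≥ ∑ k : Fin d, (N * e k - 3) * lam ^ (k : ℕ) := Finset.sum_le_sum fun k _ => h2 k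
    have h4 : ∑ k : Fin d, (N * e k - 3) * lam ^ (k : ℕ) =
        N - 3 * ∑ k ∈ Finset.range d, lam ^ k := by
      rw [Fin.sum_univ_eq_sum_range (fun k => (N * e k - 3) * lam ^ k)]
      simp_rw [sub_mul, Finset.sum_sub_distrib, mul_assoc]
      rw [← Finset.mul_sum, he, ← Finset.mul_sum, mul_one]
    linarith
  -- The vectors `u + s` generate a cone around the direction `e`, in which the coefficient vectors
  -- of `X ^ L * g - w` eventually lie, with natural number coefficients.
  have key : ∀ (g w : ℤ[X]), 0 < aeval lam g → ∀ᶠ L : ℕ in Filter.atTop,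
      ∃ c : β → ℕ, aeval lam (X ^ L * g - w) = ∑ s, (c s : ℝ) * x s := by
    intro g w hg
    set t : ℝ := aeval lam g with ht
    have hr : ∀ k : Fin d, Filter.Tendsto (fun L : ℕ =>
        (((X ^ L * g - w) %ₘ f).coeff k : ℝ) / lam ^ L) Filter.atTop (nhds (t * e k)) := by
      intro k
      have h2 : Filter.Tendsto (fun L : ℕ => ((w %ₘ f).coeff k : ℝ) / lam ^ L) Filter.atTop
          (nhds 0) := tendsto_const_nhds.div_atTop (tendsto_pow_atTop_atTop_of_one_lt h1)
      have h3 := (hlim g k).sub h2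
      rw [sub_zero] at h3
      refine h3.congr fun L => ?_
      rw [sub_modByMonic, coeff_sub, Int.cast_sub, sub_div]
    have hε : 0 < t / (4 * N) := by positivity
    have ev1 : ∀ᶠ L : ℕ in Filter.atTop, ∀ k : Fin d,
        |(((X ^ L * g - w) %ₘ f).coeff k : ℝ) / lam ^ L - t * e k| < t / (4 * N) := by
      rw [Filter.eventually_all]
      intro k
      exact (Metric.tendsto_nhds.mp (hr k)) _ hε
    have hm : Filter.Tendsto (fun L : ℕ => lam ^ L * t / N) Filter.atTop Filter.atTop :=
      ((tendsto_pow_atTop_atTop_of_one_lt h1).atTop_mul_const hg).atTop_div_const hN0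
    obtain ⟨K, hK⟩ : ∃ K : ℝ, ∀ k : Fin d, N * |e k| ≤ K := by
      refine ⟨∑ k : Fin d, N * |e k|, fun k => ?_⟩
      exact Finset.single_le_sum (f := fun k : Fin d => (N : ℝ) * |e k|)
        (fun k _ => by positivity) (Finset.mem_univ k)
    have ev2 := hm.eventually_ge_atTop (2 + K)
    filter_upwards [ev1, ev2] with L hL1 hL2
    -- The number of summands: `m u` approximates the coefficient vector `r`. The three errors
    -- (asymptotics, floor, rounding) are at most `(m + 1) / 4`, `K` and `m / 2`, together at most
    -- `2 m` because `m > 1 + K`.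
    set m := ⌊lam ^ L * t / N⌋₊ with hmdef
    have hLpos : 0 < lam ^ L := by positivity
    have hm1 : (m : ℝ) ≤ lam ^ L * t / N := Nat.floor_le (by positivity)
    have hm2 : lam ^ L * t / N < m + 1 := Nat.lt_floor_add_one _
    have hm1' : (m : ℝ) * N ≤ lam ^ L * t := (le_div_iff₀ hN0).mp hm1
    have hm2' : lam ^ L * t < (m + 1) * N := (div_lt_iff₀ hN0).mp hm2
    set r : Fin d → ℤ := fun k => ((X ^ L * g - w) %ₘ f).coeff k with hrdef
    have hbound : ∀ k, |r k - m * u k| ≤ 2 * m := by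
      intro k
      have b1 : |(r k : ℝ) - lam ^ L * (t * e k)| ≤ (m + 1) / 4 := by
        have := hL1 k
        have e1 : (r k : ℝ) - lam ^ L * (t * e k) = lam ^ L * (r k / lam ^ L - t * e k) := by
          field_simp
        rw [e1, abs_mul, abs_of_pos hLpos]
        calc lam ^ L * |(r k : ℝ) / lam ^ L - t * e k| ≤ lam ^ L * (t / (4 * N)) :=
              mul_le_mul_of_nonneg_left this.le hLpos.le
          _ = (lam ^ L * t / N) / 4 := by field_simp
          _ ≤ (m + 1) / 4 := by linarith
      have b2 : |(lam ^ L * t - m * N) * e k| ≤ K := by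
        rw [abs_mul, abs_of_nonneg (by linarith)]
        refine le_trans ?_ (hK k)
        exact mul_le_mul_of_nonneg_right (by linarith) (abs_nonneg _)
      have b3 : |(m : ℝ) * (N * e k - u k)| ≤ m / 2 := by
        rw [abs_mul, abs_of_nonneg (Nat.cast_nonneg m)]
        have := mul_le_mul_of_nonneg_left (abs_sub_round (N * e k : ℝ)) (Nat.cast_nonneg (α := ℝ) m)
        simp only [hu]
        linarith
      have e2 : (r k : ℝ) - m * u k = (r k - lam ^ L * (t * e k)) +
          (lam ^ L * t - m * N) * e k + m * (N * e k - u k) := by ring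
      have b4 : |(r k : ℝ) - m * u k| ≤ 2 * m := by
        rw [e2]
        refine (abs_add_three _ _ _).trans ?_
        linarith
      exact_mod_cast b4
    obtain ⟨c, hc, hcr⟩ := exists_sum_of_box m (fun k => r k - m * u k) hbound
    refine ⟨c, ?_⟩
    rw [heval]
    have hrk : ∀ k, (r k : ℝ) = ∑ s, (c s : ℝ) * ((u k : ℝ) + s.1 k) := by
      intro k
      have q1 : (∑ s, (c s : ℝ)) = m := by exact_mod_cast hc
      have q2 : ∑ s, (c s : ℝ) * (s.1 k : ℝ) = r k - m * u k := by exact_mod_cast hcr k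
      simp_rw [mul_add, Finset.sum_add_distrib, q2, ← Finset.sum_mul, q1]
      ring
    calc ∑ k : Fin d, (r k : ℝ) * lam ^ (k : ℕ)
        = ∑ k : Fin d, ∑ s, (c s : ℝ) * (((u k : ℝ) + s.1 k) * lam ^ (k : ℕ)) := by
          refine Finset.sum_congr rfl fun k _ => ?_
          rw [hrk, Finset.sum_mul]
          exact Finset.sum_congr rfl fun s _ => by ring
      _ = ∑ s, (c s : ℝ) * x s := by
          rw [Finset.sum_comm]
          exact Finset.sum_congr rfl fun s _ => by rw [hx, Finset.mul_sum]
  have : Nonempty β := ⟨⟨fun _ => 0, by rw [Finset.mem_Icc]; exact ⟨fun _ => by simp, fun _ => by simp⟩⟩⟩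
  obtain ⟨z₀, hz₀⟩ := Finite.exists_min x
  -- Subtracting all `G s` in advance makes every multiplicity positive, and subtracting `X ^ L * G
  -- z₀` reserves the term that becomes a loop of the tower. Since `x z₀` is minimal and `lam > 1`,
  -- the value `lam * x b - x z₀` stays positive.
  have hev : ∀ᶠ L : ℕ in Filter.atTop, ∀ b : β, ∃ c : β → ℕ,
      aeval lam (X ^ L * (X * G b - G z₀) - ∑ s, G s) = ∑ s, (c s : ℝ) * x s := by
    rw [Filter.eventually_all]
    intro b
    refine key _ _ ?_
    rw [map_sub, map_mul, aeval_X, hGx, hGx]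
    have := hz₀ b
    have := hxpos b
    nlinarith
  obtain ⟨L, hL⟩ := hev.exists
  choose c hc using hL
  refine ⟨β, inferInstance, inferInstance, x, L, z₀, c, hxpos, fun b => ?_⟩
  have h2 := hc b
  simp only [map_sub, map_mul, map_pow, aeval_X, hGx, map_sum] at h2
  simp only [Nat.cast_add, Nat.cast_one, add_mul, one_mul, Finset.sum_add_distrib]
  rw [← h2]
  ring

end Lind

/-! ### Lind's theorem: the tower matrix. -/

section PrimitiveRealization

theorem Matrix.pow_add_apply_pos {ι : Type*} [Fintype ι] [DecidableEq ι] {M : Matrix ι ι ℕ}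
    {a b : ℕ} {i j k : ι} (h1 : 0 < (M ^ a) i j) (h2 : 0 < (M ^ b) j k) :
    0 < (M ^ (a + b)) i k := by
  rw [pow_add, Matrix.mul_apply]
  exact Finset.sum_pos' (fun _ _ => Nat.zero_le _) ⟨j, Finset.mem_univ j, Nat.mul_pos h1 h2⟩

/-- The tower of height `L + 1` over `β`: each level moves up, and the top level of every column
branches to the bottom of all columns and to the top of the column of `z₀`. -/
def towerMatrix {β : Type*} [DecidableEq β] (L : ℕ) (z₀ : β) (c : β → β → ℕ) :
    Matrix (β × Fin (L + 1)) (β × Fin (L + 1)) ℕ := fun p q =>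
  if q.2 = Fin.last L then
    (if p.2 = 0 then 1 + c q.1 p.1 else 0) + if p = (z₀, Fin.last L) then 1 else 0
  else if p.1 = q.1 ∧ (p.2 : ℕ) = q.2 + 1 then 1 else 0

/-- From any column index climb to the top, pass to the top over `z₀`, wait there on the loop, drop
to the bottom of any column and climb. The waiting time `l + (L - l')` pads every path to the same
length `2 * L + 2`. -/
theorem towerMatrix_pow_pos {β : Type*} [Fintype β] [DecidableEq β] (L : ℕ) (z₀ : β)
    (c : β → β → ℕ) (p q : β × Fin (L + 1)) :
    0 < (towerMatrix L z₀ c ^ (2 * L + 2)) p q := by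
  set M := towerMatrix L z₀ c with hM
  have hup : ∀ (b : β) (t l : ℕ) (h : l + t < L + 1),
      0 < (M ^ t) (b, ⟨l + t, h⟩) (b, ⟨l, by omega⟩) := by
    intro b t
    induction t with
    | zero => intro l h; simp
    | succ t ih =>
      intro l h
      have e : t + 1 = 1 + t := add_comm t 1
      refine (congrArg (fun m => 0 < (M ^ m) (b, ⟨l + (t + 1), h⟩) (b, ⟨l, by omega⟩)) e).mpr ?_
      refine Matrix.pow_add_apply_pos (j := (b, ⟨l + t, by omega⟩)) ?_ (ih l (by omega))
      have hne : (⟨l + t, by omega⟩ : Fin (L + 1)) ≠ Fin.last L := by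
        rw [Ne, Fin.ext_iff]; simp only [Fin.val_last]; omega
      rw [pow_one, hM, towerMatrix, if_neg hne, if_pos ⟨rfl, (add_assoc l t 1).symm⟩]
      exact Nat.one_pos
  have htop : ∀ b s, 0 < (M ^ 1) (s, 0) (b, Fin.last L) := by
    intro b s; simp only [pow_one, hM, towerMatrix, if_true]; omega
  have ho : ∀ b, 0 < (M ^ 1) (z₀, Fin.last L) (b, Fin.last L) := by
    intro b; simp only [pow_one, hM, towerMatrix, if_true]; omega
  have hloop : ∀ m : ℕ, 0 < (M ^ m) (z₀, Fin.last L) (z₀, Fin.last L) := by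
    intro m
    induction m with
    | zero => simp
    | succ m ih => exact Matrix.pow_add_apply_pos ih (ho z₀)
  obtain ⟨s, l', hl'⟩ := p
  obtain ⟨b, l, hl⟩ := q
  have h1 : 0 < (M ^ (L - l)) (b, Fin.last L) (b, ⟨l, hl⟩) := by
    have := hup b (L - l) l (by omega)
    have e : (⟨l + (L - l), by omega⟩ : Fin (L + 1)) = Fin.last L := by
      ext; simp only [Fin.val_last]; omega
    rwa [e] at this
  have h2 : 0 < (M ^ l') (s, ⟨l', hl'⟩) (s, 0) := by
    have := hup s l' 0 (by omega)
    simpa using this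
  have := Matrix.pow_add_apply_pos h2 (Matrix.pow_add_apply_pos (htop z₀ s)
    (Matrix.pow_add_apply_pos (hloop (l + (L - l'))) (Matrix.pow_add_apply_pos (ho b) h1)))
  have e : l' + (1 + ((l + (L - l')) + (1 + (L - l)))) = 2 * L + 2 := by omega
  rwa [e] at this

/-- The weight `lam ^ l * x b` grows by `lam` on each level by construction; at the top level the
eigenvalue equation is exactly the relation `h`. -/
theorem towerMatrix_left_eigenvector {β : Type*} [Fintype β] [DecidableEq β] {L : ℕ} {z₀ : β}
    {c : β → β → ℕ} {lam : ℝ} {x : β → ℝ}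
    (h : ∀ b, lam ^ (L + 1) * x b = ∑ s, (1 + c b s : ℕ) * x s + lam ^ L * x z₀)
    (q : β × Fin (L + 1)) :
    ∑ p : β × Fin (L + 1), (lam ^ (p.2 : ℕ) * x p.1) * (towerMatrix L z₀ c p q : ℝ) =
      lam * (lam ^ (q.2 : ℕ) * x q.1) := by
  by_cases hq : q.2 = Fin.last L
  · simp only [towerMatrix, hq, if_true, Nat.cast_add, mul_add, Finset.sum_add_distrib]
    have e1 : ∑ p : β × Fin (L + 1), (lam ^ (p.2 : ℕ) * x p.1) *
        ((if p.2 = 0 then 1 + c q.1 p.1 else 0 : ℕ) : ℝ) = ∑ s, (1 + c q.1 s : ℕ) * x s := by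
      rw [Fintype.sum_prod_type]
      refine Finset.sum_congr rfl fun s _ => ?_
      rw [Finset.sum_eq_single (0 : Fin (L + 1))]
      · simp [mul_comm]
      · intro b _ hb; simp [hb]
      · simp
    have e2 : ∑ p : β × Fin (L + 1), (lam ^ (p.2 : ℕ) * x p.1) *
        ((if p = (z₀, Fin.last L) then 1 else 0 : ℕ) : ℝ) = lam ^ L * x z₀ := by
      rw [Finset.sum_eq_single (z₀, Fin.last L)]
      · simp
      · intro b _ hb; simp [hb]
      · simp
    rw [e1, e2, ← h, Fin.val_last]
    ring
  · have hlt : (q.2 : ℕ) + 1 < L + 1 := by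
      have h1 := q.2.isLt
      have h2 : (q.2 : ℕ) ≠ L := fun h3 => hq (Fin.ext (by simpa using h3))
      omega
    rw [Finset.sum_eq_single (q.1, ⟨q.2 + 1, hlt⟩)]
    · simp [towerMatrix, hq]; ring
    · intro b _ hb
      have : ¬ (b.1 = q.1 ∧ (b.2 : ℕ) = q.2 + 1) := fun h3 =>
        hb (Prod.ext h3.1 (Fin.ext h3.2))
      simp [towerMatrix, hq, this]
    · simp

/-- Lind's theorem: every Perron number greater than one is the spectral radius of a primitive
matrix. -/
theorem IsPerron.exists_isPrimitiveWithRadius {lam : ℝ} (h : IsPerron lam) (h1 : 1 < lam) :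
    ∃ (n : ℕ) (M : Matrix (Fin (n + 1)) (Fin (n + 1)) ℕ), IsPrimitiveWithRadius M lam := by
  obtain ⟨β, _, _, x, L, z₀, c, hx, hc⟩ := h.exists_decomposition h1
  obtain ⟨n, hn⟩ : ∃ n, Fintype.card (β × Fin (L + 1)) = n + 1 :=
    Nat.exists_eq_succ_of_ne_zero (Fintype.card_pos_iff.mpr ⟨(z₀, 0)⟩).ne'
  let e : Fin (n + 1) ≃ β × Fin (L + 1) := (Fintype.equivFinOfCardEq hn).symm
  set T := towerMatrix L z₀ c with hT
  refine ⟨n, T.submatrix e e, ⟨2 * L + 2, by omega, fun i j => ?_⟩, ?_⟩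
  · have hpow : ∀ m : ℕ, (T.submatrix e e) ^ m = (T ^ m).submatrix e e := by
      intro m
      induction m with
      | zero => simp
      | succ m ih => rw [pow_succ, ih, Matrix.submatrix_mul_equiv, pow_succ]
    rw [hpow]
    exact towerMatrix_pow_pos L z₀ c _ _
  · refine spectralRadius_of_pos_left_eigenvector
      (p := fun i => lam ^ ((e i).2 : ℕ) * x (e i).1)
      (fun i => mul_pos (pow_pos h.2.1 _) (hx _)) fun k => ?_
    rw [← towerMatrix_left_eigenvector hc (e k)]
    exact e.sum_comp (fun p => (lam ^ (p.2 : ℕ) * x p.1) * (T p (e k) : ℝ))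

end PrimitiveRealization

/-! ### The order of the strips and the partial sums of their widths. -/

section Strips

variable {n : ℕ} {m : Fin (n + 1) → ℕ}

theorem Before.irrefl (a : (i : Fin (n + 1)) × Fin (m i)) : ¬ Before a a := by
  rintro (h | h)
  · exact lt_irrefl _ h
  · exact lt_irrefl _ h.2

theorem Before.trans {a b c : (i : Fin (n + 1)) × Fin (m i)} (h : Before a b) (h' : Before b c) :
    Before a c := by
  unfold Before at *
  rcases h with h | h <;> rcases h' with h' | h'
  · exact Or.inl (h.trans h')
  · exact Or.inl (h'.1 ▸ h)
  · exact Or.inl (h.1.symm ▸ h')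
  · exact Or.inr ⟨h.1.trans h'.1, h.2.trans h'.2⟩

theorem Before.total {a b : (i : Fin (n + 1)) × Fin (m i)} (h : a ≠ b) :
    Before a b ∨ Before b a := by
  obtain ⟨i, x⟩ := a
  obtain ⟨j, y⟩ := b
  unfold Before
  rcases lt_trichotomy i j with hij | rfl | hij
  · exact Or.inl (Or.inl hij)
  · have hne : (x : ℕ) ≠ y := fun hxy => h (by rw [Fin.ext hxy])
    rcases lt_or_gt_of_ne hne with hxy | hxy
    · exact Or.inl (Or.inr ⟨rfl, hxy⟩)
    · exact Or.inr (Or.inr ⟨rfl, hxy⟩)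
  · exact Or.inr (Or.inl hij)

variable (w : (i : Fin (n + 1)) × Fin (m i) → ℝ)

open Classical in
theorem sum_before_add_le (hw : ∀ a, 0 < w a) {a b : (i : Fin (n + 1)) × Fin (m i)}
    (h : Before a b) : ∑ c with Before c a, w c + w a ≤ ∑ c with Before c b, w c := by
  have ha : a ∉ Finset.univ.filter fun c => Before c a := by
    simpa using Before.irrefl a
  rw [add_comm, ← Finset.sum_insert ha]
  refine Finset.sum_le_sum_of_subset_of_nonneg (fun c hc => ?_) fun c _ _ => (hw c).le
  simp only [Finset.mem_insert, Finset.mem_filter, Finset.mem_univ, true_and] at hc ⊢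
  rcases hc with rfl | hc
  · exact h
  · exact hc.trans h

open Classical in
theorem sum_before_add_le_total (hw : ∀ a, 0 < w a) (a : (i : Fin (n + 1)) × Fin (m i)) :
    ∑ c with Before c a, w c + w a ≤ ∑ c, w c := by
  have ha : a ∉ Finset.univ.filter fun c => Before c a := by
    simpa using Before.irrefl a
  rw [add_comm, ← Finset.sum_insert ha]
  exact Finset.sum_le_sum_of_subset_of_nonneg (Finset.subset_univ _) fun c _ _ => (hw c).le

theorem exists_maximal_before (S : Finset ((i : Fin (n + 1)) × Fin (m i))) (hS : S.Nonempty) :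
    ∃ a ∈ S, ∀ b ∈ S, b = a ∨ Before b a := by
  classical
  induction hS using Finset.Nonempty.cons_induction with
  | singleton a => exact ⟨a, by simp, by simp⟩
  | cons a s ha hs ih =>
    obtain ⟨c, hc, hmax⟩ := ih
    have hne : c ≠ a := fun h => ha (h ▸ hc)
    rcases Before.total hne with h | h
    · refine ⟨a, Finset.mem_cons_self a s, fun b hb => ?_⟩
      rcases Finset.mem_cons.mp hb with rfl | hb
      · exact Or.inl rfl
      · rcases hmax b hb with rfl | hb
        · exact Or.inr h
        · exact Or.inr (hb.trans h)
    · refine ⟨c, Finset.mem_cons.mpr (Or.inr hc), fun b hb => ?_⟩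
      rcases Finset.mem_cons.mp hb with rfl | hb
      · exact Or.inr h
      · exact hmax b hb

open Classical in
/-- A strip is the first one or its left end is the right end of the preceding strip. -/
theorem sum_before_eq_zero_or_exists (a : (i : Fin (n + 1)) × Fin (m i)) :
    ∑ c with Before c a, w c = 0 ∨
      ∃ b, Before b a ∧ ∑ c with Before c b, w c + w b = ∑ c with Before c a, w c := by
  rcases (Finset.univ.filter fun c => Before c a).eq_empty_or_nonempty with h | h
  · left; rw [h, Finset.sum_empty]
  · right
    obtain ⟨b, hb, hmax⟩ := exists_maximal_before _ h
    simp only [Finset.mem_filter, Finset.mem_univ, true_and] at hb hmax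
    refine ⟨b, hb, ?_⟩
    have hnb : b ∉ Finset.univ.filter fun c => Before c b := by
      simpa using Before.irrefl b
    rw [add_comm, ← Finset.sum_insert hnb]
    refine Finset.sum_congr ?_ fun _ _ => rfl
    ext c
    simp only [Finset.mem_insert, Finset.mem_filter, Finset.mem_univ, true_and]
    exact ⟨fun h => h.elim (fun h => h ▸ hb) fun h => h.trans hb, hmax c⟩

theorem wellFounded_before : WellFounded (Before (n := n) (m := m)) :=
  haveI : IsTrans _ (Before (n := n) (m := m)) := ⟨fun _ _ _ => Before.trans⟩
  haveI : Std.Irrefl (Before (n := n) (m := m)) := ⟨Before.irrefl⟩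
  Finite.wellFounded_of_trans_of_irrefl _

open Classical in
theorem exists_sum_before_eq_zero [Nonempty ((i : Fin (n + 1)) × Fin (m i))] :
    ∃ a : (i : Fin (n + 1)) × Fin (m i), ∑ c with Before c a, w c = 0 := by
  obtain ⟨a, -, ha⟩ := wellFounded_before.has_min (Set.univ : Set ((i : Fin (n + 1)) × Fin (m i)))
    Set.univ_nonempty
  refine ⟨a, ?_⟩
  rcases sum_before_eq_zero_or_exists w a with h | ⟨b, hb, -⟩
  · exact h
  · exact absurd hb (ha b (Set.mem_univ b))

open Classical in
theorem exists_sum_before_add_eq_total [Nonempty ((i : Fin (n + 1)) × Fin (m i))] :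
    ∃ a : (i : Fin (n + 1)) × Fin (m i), ∑ c with Before c a, w c + w a = ∑ c, w c := by
  obtain ⟨a, -, hmax⟩ := exists_maximal_before (m := m) Finset.univ Finset.univ_nonempty
  refine ⟨a, ?_⟩
  have ha : a ∉ Finset.univ.filter fun c => Before c a := by
    simpa using Before.irrefl a
  rw [add_comm, ← Finset.sum_insert ha]
  refine Finset.sum_congr ?_ fun _ _ => rfl
  ext c
  simpa using hmax c (Finset.mem_univ c)

end Strips

/-! ### The strips tile the rectangles, and the piece map permutes them. -/

namespace PieceData

variable {n : ℕ} {M : Matrix (Fin (n + 1)) (Fin (n + 1)) ℕ} {lam : ℝ} (D : PieceData M lam)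

theorem vWidth_pos (h : 0 < lam) (k s) : 0 < D.vWidth k s :=
  mul_pos (inv_pos.mpr h) (D.ω_pos _)

theorem hHeight_pos (h : 0 < lam) (i t) : 0 < D.hHeight i t :=
  mul_pos (inv_pos.mpr h) (D.η_pos _)

/-- The label `i` occurs `M i k` times among the strips of `Q_k`, so this is the left eigenvector
equation divided by `lam`; permuting the strips does not change the sum. -/
theorem sum_vWidth (h : 0 < lam) (k) : ∑ s, D.vWidth k s = D.ω k := by
  unfold vWidth
  have e := Equiv.sum_comp (D.τ k) fun s => D.ω s.1
  rw [← Finset.mul_sum]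
  refine (congrArg (lam⁻¹ * ·) e).trans ?_
  simp only [Fintype.sum_sigma]
  simp only [Finset.sum_const, Finset.card_univ, Fintype.card_fin, nsmul_eq_mul]
  simp_rw [mul_comm ((M _ k : ℕ) : ℝ)]
  rw [D.ω_eigen, inv_mul_cancel_left₀ h.ne']

theorem sum_hHeight (h : 0 < lam) (i) : ∑ t, D.hHeight i t = D.η i := by
  unfold hHeight
  have e := Equiv.sum_comp (D.σ i).symm fun s => D.η s.1
  rw [← Finset.mul_sum]
  refine (congrArg (lam⁻¹ * ·) e).trans ?_
  simp only [Fintype.sum_sigma]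
  simp only [Finset.sum_const, Finset.card_univ, Fintype.card_fin, nsmul_eq_mul]
  rw [D.η_eigen, inv_mul_cancel_left₀ h.ne']

theorem nonempty_vStrips (D : PieceData M lam) (h : 0 < lam) (k) : Nonempty ((i : Fin (n + 1)) × Fin (M i k)) := by
  by_contra hne
  rw [not_nonempty_iff] at hne
  have := D.sum_vWidth h k
  rw [Fintype.sum_empty] at this
  exact (D.ω_pos k).ne this

theorem nonempty_hStrips (D : PieceData M lam) (h : 0 < lam) (i) : Nonempty ((k : Fin (n + 1)) × Fin (M i k)) := by
  by_contra hne
  rw [not_nonempty_iff] at hne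
  have := D.sum_hHeight h i
  rw [Fintype.sum_empty] at this
  exact (D.η_pos i).ne this

theorem vLeft_nonneg (h : 0 < lam) (k s) : 0 ≤ D.vLeft k s :=
  Finset.sum_nonneg fun b _ => (D.vWidth_pos h k b).le

theorem vRight_le (h : 0 < lam) (k s) : D.vRight k s ≤ D.ω k := by
  rw [← D.sum_vWidth h k]
  exact sum_before_add_le_total _ (D.vWidth_pos h k) s

theorem vLeft_lt_vRight (h : 0 < lam) (k s) : D.vLeft k s < D.vRight k s :=
  lt_add_of_pos_right _ (D.vWidth_pos h k s)

theorem vRight_le_vLeft (h : 0 < lam) {k s t} (hst : Before s t) :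
    D.vRight k s ≤ D.vLeft k t := by
  unfold vRight vLeft
  exact sum_before_add_le _ (D.vWidth_pos h k) hst

theorem hTop_le (h : 0 < lam) (i t) : D.hTop i t ≤ D.η i :=
  sub_le_self _ (Finset.sum_nonneg fun b _ => (D.hHeight_pos h i b).le)

theorem hBot_nonneg (h : 0 < lam) (i t) : 0 ≤ D.hBot i t := by
  have := sum_before_add_le_total _ (D.hHeight_pos h i) t
  rw [D.sum_hHeight h i] at this
  unfold hBot hTop
  linarith

theorem hBot_lt_hTop (h : 0 < lam) (i t) : D.hBot i t < D.hTop i t :=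
  sub_lt_self _ (D.hHeight_pos h i t)

theorem hTop_le_hBot (h : 0 < lam) {i s t} (hst : Before s t) : D.hTop i t ≤ D.hBot i s := by
  have := sum_before_add_le _ (D.hHeight_pos h i) hst
  unfold hBot hTop
  linarith

theorem vLeft_injective (h : 0 < lam) (k) : Function.Injective (D.vLeft k) := by
  intro s t hst
  by_contra hne
  rcases Before.total hne with hb | hb
  · linarith [D.vRight_le_vLeft h hb, D.vLeft_lt_vRight h k s]
  · linarith [D.vRight_le_vLeft h hb, D.vLeft_lt_vRight h k t]

theorem vRight_injective (h : 0 < lam) (k) : Function.Injective (D.vRight k) := by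
  intro s t hst
  by_contra hne
  rcases Before.total hne with hb | hb
  · linarith [D.vRight_le_vLeft h hb, D.vLeft_lt_vRight h k t]
  · linarith [D.vRight_le_vLeft h hb, D.vLeft_lt_vRight h k s]

theorem hTop_injective (h : 0 < lam) (i) : Function.Injective (D.hTop i) := by
  intro s t hst
  by_contra hne
  rcases Before.total hne with hb | hb
  · linarith [D.hTop_le_hBot h hb, D.hBot_lt_hTop h i s]
  · linarith [D.hTop_le_hBot h hb, D.hBot_lt_hTop h i t]

theorem hBot_injective (h : 0 < lam) (i) : Function.Injective (D.hBot i) := by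
  intro s t hst
  by_contra hne
  rcases Before.total hne with hb | hb
  · linarith [D.hTop_le_hBot h hb, D.hBot_lt_hTop h i t]
  · linarith [D.hTop_le_hBot h hb, D.hBot_lt_hTop h i s]

theorem exists_vLeft_eq_zero (h : 0 < lam) (k) : ∃ s, D.vLeft k s = 0 :=
  have := D.nonempty_vStrips h k
  exists_sum_before_eq_zero _

theorem exists_vRight_eq (h : 0 < lam) (k) : ∃ s, D.vRight k s = D.ω k := by
  have := D.nonempty_vStrips h k
  obtain ⟨s, hs⟩ := exists_sum_before_add_eq_total (D.vWidth k)
  exact ⟨s, by rw [← D.sum_vWidth h k]; exact hs⟩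

theorem exists_hTop_eq (h : 0 < lam) (i) : ∃ t, D.hTop i t = D.η i := by
  have := D.nonempty_hStrips h i
  obtain ⟨t, ht⟩ := exists_sum_before_eq_zero (D.hHeight i)
  exact ⟨t, by unfold hTop; linarith⟩

theorem exists_hBot_eq_zero (h : 0 < lam) (i) : ∃ t, D.hBot i t = 0 := by
  have := D.nonempty_hStrips h i
  obtain ⟨t, ht⟩ := exists_sum_before_add_eq_total (D.hHeight i)
  rw [D.sum_hHeight h i] at ht
  exact ⟨t, by unfold hBot hTop; linarith⟩

/-- The bijection between vertical and horizontal strips defining the piece map. -/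
def imageSigma (a : (k : Fin (n + 1)) × ((i : Fin (n + 1)) × Fin (M i k))) :
    (i : Fin (n + 1)) × ((k : Fin (n + 1)) × Fin (M i k)) :=
  ⟨D.target a.1 a.2, D.image a.1 a.2⟩

/-- The inverse of the bijection between vertical and horizontal strips. -/
def preimageSigma (b : (i : Fin (n + 1)) × ((k : Fin (n + 1)) × Fin (M i k))) :
    (k : Fin (n + 1)) × ((i : Fin (n + 1)) × Fin (M i k)) :=
  ⟨D.source b.1 b.2, D.preimage b.1 b.2⟩

theorem preimageSigma_imageSigma (a) : D.preimageSigma (D.imageSigma a) = a := by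
  obtain ⟨k, s⟩ := a
  -- The statement is made for an arbitrary label `r`, so that the permutation cancels before any
  -- type depends on the result.
  have h1 : ∀ (i : Fin (n + 1)) (r : (k : Fin (n + 1)) × Fin (M i k)),
      D.preimageSigma ⟨i, D.σ i r⟩ = ⟨r.1, (D.τ r.1).symm ⟨i, r.2⟩⟩ := by
    intro i r
    change (⟨((D.σ i).symm (D.σ i r)).1, (D.τ ((D.σ i).symm (D.σ i r)).1).symm
      ⟨i, ((D.σ i).symm (D.σ i r)).2⟩⟩ : (k : Fin (n + 1)) × ((i : Fin (n + 1)) × Fin (M i k))) = _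
    rw [Equiv.symm_apply_apply]
  have h2 := h1 (D.target k s) ⟨k, (D.τ k s).2⟩
  change D.preimageSigma ⟨D.target k s, D.σ (D.target k s) ⟨k, (D.τ k s).2⟩⟩ = _
  rw [h2]
  congr 1
  exact (D.τ k).symm_apply_apply s

theorem imageSigma_preimageSigma (b) : D.imageSigma (D.preimageSigma b) = b := by
  obtain ⟨i, t⟩ := b
  have h1 : ∀ (k : Fin (n + 1)) (r : (i : Fin (n + 1)) × Fin (M i k)),
      D.imageSigma ⟨k, (D.τ k).symm r⟩ = ⟨r.1, D.σ r.1 ⟨k, r.2⟩⟩ := by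
    intro k r
    change (⟨(D.τ k ((D.τ k).symm r)).1, D.σ (D.τ k ((D.τ k).symm r)).1
      ⟨k, (D.τ k ((D.τ k).symm r)).2⟩⟩ : (i : Fin (n + 1)) × ((k : Fin (n + 1)) × Fin (M i k))) = _
    rw [Equiv.apply_symm_apply]
  have h2 := h1 (D.source i t) ⟨i, ((D.σ i).symm t).2⟩
  change D.imageSigma ⟨D.source i t, (D.τ (D.source i t)).symm ⟨i, ((D.σ i).symm t).2⟩⟩ = _
  rw [h2]
  congr 1
  exact (D.σ i).apply_symm_apply t

theorem hHeight_image (k s) : D.hHeight (D.target k s) (D.image k s) = lam⁻¹ * D.η k := by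
  unfold hHeight image
  rw [Equiv.symm_apply_apply]

theorem vWidth_preimage (i t) : D.vWidth (D.source i t) (D.preimage i t) = lam⁻¹ * D.ω i := by
  unfold vWidth preimage
  rw [Equiv.apply_symm_apply]

theorem branchInv_branch (h : 0 < lam) (k s) (z : ℂ) :
    D.branchInv (D.target k s) (D.image k s) (D.branch k s z).2 = (k, z) := by
  have h1 := D.preimageSigma_imageSigma ⟨k, s⟩
  -- Generalising the round trip to a variable `a` allows substitution in spite of the dependent
  -- strip labels.
  have h2 : ∀ a : (k : Fin (n + 1)) × ((i : Fin (n + 1)) × Fin (M i k)), a = ⟨k, s⟩ →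
      ((a.1, ⟨D.vLeft a.1 a.2 + lam⁻¹ * (lam * (z.re - D.vLeft k s)),
        lam * (D.hBot (D.target k s) (D.image k s) + lam⁻¹ * z.im -
          D.hBot (D.target k s) (D.image k s))⟩) : Pt n) = (k, z) := by
    rintro a rfl
    refine Prod.ext rfl (Complex.ext ?_ ?_)
    · simp only; rw [inv_mul_cancel_left₀ h.ne']; ring
    · simp only; rw [add_sub_cancel_left, mul_inv_cancel_left₀ h.ne']
  exact h2 _ h1

end PieceData

/-! ### Coordinates adapted to a side, and a common model of the four edge maps. -/

/-- The coordinate along the sides parallel to `s`. -/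
def Side.co {n : ℕ} : Side → Pt n → ℝ
  | Side.left, q => q.2.im
  | Side.right, q => q.2.im
  | Side.top, q => q.2.re
  | Side.bottom, q => q.2.re

theorem Side.continuous_co {n : ℕ} (s : Side) : Continuous (s.co : Pt n → ℝ) := by
  cases s
  · exact Complex.continuous_im.comp continuous_snd
  · exact Complex.continuous_im.comp continuous_snd
  · exact Complex.continuous_re.comp continuous_snd
  · exact Complex.continuous_re.comp continuous_snd

namespace PieceData

variable {n : ℕ} {M : Matrix (Fin (n + 1)) (Fin (n + 1)) ℕ} {lam : ℝ} (D : PieceData M lam)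

/-- The outward coordinate transverse to the side `s`, vanishing on that side. -/
def ht : Side → Pt n → ℝ
  | Side.left, q => -q.2.re
  | Side.right, q => q.2.re - D.ω q.1
  | Side.top, q => q.2.im - D.η q.1
  | Side.bottom, q => -q.2.im

/-- The length of the side `s` of `Q_k`. -/
def len : Side → Fin (n + 1) → ℝ
  | Side.left => D.η
  | Side.right => D.η
  | Side.top => D.ω
  | Side.bottom => D.ω

/-- The point with coordinate `u` along the side `s` of `Q_k` and outward coordinate `w`. -/
def pt : Side → Fin (n + 1) → ℝ → ℝ → Pt n
  | Side.left, k, u, w => (k, ⟨-w, u⟩)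
  | Side.right, k, u, w => (k, ⟨D.ω k + w, u⟩)
  | Side.top, k, u, w => (k, ⟨u, D.η k + w⟩)
  | Side.bottom, k, u, w => (k, ⟨u, -w⟩)

/-- The coordinate of an end point of a side. -/
def cor (s : Side) (b : Bool) (k : Fin (n + 1)) : ℝ := if b then D.len s k else 0

theorem len_pos (s k) : 0 < D.len s k := by
  cases s
  · exact D.η_pos k
  · exact D.η_pos k
  · exact D.ω_pos k
  · exact D.ω_pos k

@[simp] theorem pt_fst (s k u w) : (D.pt s k u w).1 = k := by cases s <;> rfl

@[simp] theorem co_pt (s : Side) (k u w) : s.co (D.pt s k u w) = u := by cases s <;> rfl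

@[simp] theorem ht_pt (s k u w) : D.ht s (D.pt s k u w) = w := by
  cases s <;> simp [ht, pt]

theorem pt_co_ht (s : Side) (q : Pt n) : D.pt s q.1 (s.co q) (D.ht s q) = q := by
  obtain ⟨k, z⟩ := q
  cases s <;> refine Prod.ext rfl (Complex.ext ?_ ?_) <;> simp [ht, pt, Side.co]

theorem eq_pt {s : Side} {k u w} {q : Pt n} (h1 : q.1 = k) (h2 : s.co q = u) (h3 : D.ht s q = w) :
    q = D.pt s k u w := by
  subst h1 h2 h3; exact (D.pt_co_ht s q).symm

theorem push_pt (s k u v w) : push s w (D.pt s k u v) = D.pt s k u (v + w) := by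
  cases s <;> refine Prod.ext rfl (Complex.ext ?_ ?_) <;>
    simp [push, pt, Side.normal, add_comm, add_assoc, add_left_comm]

theorem continuous_ht (s) : Continuous (D.ht s) := by
  have h1 : ∀ f : Fin (n + 1) → ℝ, Continuous fun q : Pt n => f q.1 := fun f =>
    continuous_of_discreteTopology.comp continuous_fst
  cases s
  · exact (Complex.continuous_re.comp continuous_snd).neg
  · exact (Complex.continuous_re.comp continuous_snd).sub (h1 D.ω)
  · exact (Complex.continuous_im.comp continuous_snd).sub (h1 D.η)
  · exact (Complex.continuous_im.comp continuous_snd).neg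

theorem continuous_pt (s k) : Continuous fun v : ℝ × ℝ => D.pt s k v.1 v.2 := by
  have h1 : Continuous fun v : ℝ × ℝ => (⟨v.1, v.2⟩ : ℂ) := by
    have : (fun v : ℝ × ℝ => (⟨v.1, v.2⟩ : ℂ)) = fun v => (v.1 : ℂ) + v.2 * Complex.I := by
      funext v; exact Complex.mk_eq_add_mul_I _ _
    rw [this]; fun_prop
  cases s
  · exact continuous_const.prodMk
      (h1.comp (continuous_snd.neg.prodMk continuous_fst : Continuous fun v : ℝ × ℝ => (-v.2, v.1)))
  · exact continuous_const.prodMk (h1.comp ((continuous_const.add continuous_snd).prodMk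
      continuous_fst : Continuous fun v : ℝ × ℝ => (D.ω k + v.2, v.1)))
  · exact continuous_const.prodMk (h1.comp (continuous_fst.prodMk
      (continuous_const.add continuous_snd) : Continuous fun v : ℝ × ℝ => (v.1, D.η k + v.2)))
  · exact continuous_const.prodMk
      (h1.comp (continuous_fst.prodMk continuous_snd.neg : Continuous fun v : ℝ × ℝ => (v.1, -v.2)))

theorem mem_edge {s : Side} {k} {q : Pt n} :
    q ∈ D.edge s k ↔ q.1 = k ∧ D.ht s q = 0 ∧ s.co q ∈ Set.Icc 0 (D.len s k) := by
  cases s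
  · change (q.1 = k ∧ q.2.re = 0 ∧ q.2.im ∈ Set.Icc 0 (D.η k)) ↔
      q.1 = k ∧ -q.2.re = 0 ∧ q.2.im ∈ Set.Icc 0 (D.η k)
    rw [neg_eq_zero]
  · change (q.1 = k ∧ q.2.re = D.ω k ∧ q.2.im ∈ Set.Icc 0 (D.η k)) ↔
      q.1 = k ∧ q.2.re - D.ω q.1 = 0 ∧ q.2.im ∈ Set.Icc 0 (D.η k)
    constructor <;> rintro ⟨rfl, h, h'⟩ <;> refine ⟨rfl, ?_, h'⟩ <;> linarith
  · change (q.1 = k ∧ q.2.im = D.η k ∧ q.2.re ∈ Set.Icc 0 (D.ω k)) ↔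
      q.1 = k ∧ q.2.im - D.η q.1 = 0 ∧ q.2.re ∈ Set.Icc 0 (D.ω k)
    constructor <;> rintro ⟨rfl, h, h'⟩ <;> refine ⟨rfl, ?_, h'⟩ <;> linarith
  · change (q.1 = k ∧ q.2.im = 0 ∧ q.2.re ∈ Set.Icc 0 (D.ω k)) ↔
      q.1 = k ∧ -q.2.im = 0 ∧ q.2.re ∈ Set.Icc 0 (D.ω k)
    rw [neg_eq_zero]

theorem corner_eq (s b k) : D.corner s b k = D.pt s k (D.cor s b k) 0 := by
  cases s <;> cases b <;> simp [corner, pt, cor, len]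

/-- Distinct strips have distinct left edges, so the strip chosen in the definition is the given
one; likewise for the other three sides. -/
theorem edgeMap_left (h : 0 < lam) {q : Pt n} {s} (hs : q.2.re = D.vLeft q.1 s) :
    D.edgeMap Side.left q = D.branch q.1 s q.2 := by
  have hex : ∃ s, q.2.re = D.vLeft q.1 s := ⟨s, hs⟩
  have : hex.choose = s := D.vLeft_injective h q.1 (hex.choose_spec.symm.trans hs)
  simp only [edgeMap]
  rw [dif_pos hex, this]

theorem edgeMap_right (h : 0 < lam) {q : Pt n} {s} (hs : q.2.re = D.vRight q.1 s) :
    D.edgeMap Side.right q = D.branch q.1 s q.2 := by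
  have hex : ∃ s, q.2.re = D.vRight q.1 s := ⟨s, hs⟩
  have : hex.choose = s := D.vRight_injective h q.1 (hex.choose_spec.symm.trans hs)
  simp only [edgeMap]
  rw [dif_pos hex, this]

theorem edgeMap_top (h : 0 < lam) {q : Pt n} {t} (ht : q.2.im = D.hTop q.1 t) :
    D.edgeMap Side.top q = D.branchInv q.1 t q.2 := by
  have hex : ∃ t, q.2.im = D.hTop q.1 t := ⟨t, ht⟩
  have : hex.choose = t := D.hTop_injective h q.1 (hex.choose_spec.symm.trans ht)
  simp only [edgeMap]
  rw [dif_pos hex, this]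

theorem edgeMap_bottom (h : 0 < lam) {q : Pt n} {t} (ht : q.2.im = D.hBot q.1 t) :
    D.edgeMap Side.bottom q = D.branchInv q.1 t q.2 := by
  have hex : ∃ t, q.2.im = D.hBot q.1 t := ⟨t, ht⟩
  have : hex.choose = t := D.hBot_injective h q.1 (hex.choose_spec.symm.trans ht)
  simp only [edgeMap]
  rw [dif_pos hex, this]

/-- The action of an edge map on the edges of strips, in coordinates along and transverse to the
side: the edge `a`, at depth `dep a` in the rectangle `src a`, is scaled by `lam⁻¹` onto the segment
of the side of `tgt a` starting at `off a`. -/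
structure SideModel (s : Side) where
  ι : Type
  finite : Finite ι
  src : ι → Fin (n + 1)
  tgt : ι → Fin (n + 1)
  off : ι → ℝ
  dep : ι → ℝ
  head : Fin (n + 1) → ι
  src_head : ∀ k, src (head k) = k
  dep_head : ∀ k, dep (head k) = 0
  dep_nonneg : ∀ a, 0 ≤ dep a
  dep_inj : ∀ a b, src a = src b → dep a = dep b → a = b
  off_nonneg : ∀ a, 0 ≤ off a
  off_le : ∀ a, off a + lam⁻¹ * D.len s (src a) ≤ D.len s (tgt a)
  disjoint : ∀ a b, a ≠ b → tgt a = tgt b →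
    off a + lam⁻¹ * D.len s (src a) ≤ off b ∨ off b + lam⁻¹ * D.len s (src b) ≤ off a
  mem_edges : ∀ q, q ∈ D.edges s ↔
    ∃ a, ∃ u ∈ Set.Icc 0 (D.len s (src a)), q = D.pt s (src a) u (-dep a)
  edgeMap_pt : ∀ a u, D.edgeMap s (D.pt s (src a) u (-dep a)) =
    D.pt s (tgt a) (off a + lam⁻¹ * u) 0

theorem hBot_add_image (k s) : D.hBot (D.target k s) (D.image k s) + lam⁻¹ * D.η k =
    D.hTop (D.target k s) (D.image k s) := by
  rw [← D.hHeight_image k s]; unfold hBot; ring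

theorem vLeft_add_preimage (i t) : D.vLeft (D.source i t) (D.preimage i t) + lam⁻¹ * D.ω i =
    D.vRight (D.source i t) (D.preimage i t) := by
  rw [← D.vWidth_preimage i t]; rfl

theorem lam_mul_vWidth (h : 0 < lam) (k s) : lam * D.vWidth k s = D.ω (D.target k s) :=
  mul_inv_cancel_left₀ h.ne' _

theorem lam_mul_hHeight (h : 0 < lam) (i t) : lam * D.hHeight i t = D.η (D.source i t) :=
  mul_inv_cancel_left₀ h.ne' _

/-- Different vertical strips have different image labels, and different horizontal strips of one
rectangle lie one above the other. The labels are compared in the sigma type, because the targets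
agree only propositionally. -/
theorem image_disjoint (h : 0 < lam) {a b : (k : Fin (n + 1)) × ((i : Fin (n + 1)) × Fin (M i k))}
    (hab : a ≠ b) (ht : D.target a.1 a.2 = D.target b.1 b.2) :
    D.hTop _ (D.image a.1 a.2) ≤ D.hBot _ (D.image b.1 b.2) ∨
      D.hTop _ (D.image b.1 b.2) ≤ D.hBot _ (D.image a.1 a.2) := by
  have hne : D.imageSigma a ≠ D.imageSigma b := fun he =>
    hab (by rw [← D.preimageSigma_imageSigma a, he, D.preimageSigma_imageSigma])
  have gen : ∀ x y : (i : Fin (n + 1)) × ((k : Fin (n + 1)) × Fin (M i k)), x ≠ y → x.1 = y.1 →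
      D.hTop x.1 x.2 ≤ D.hBot y.1 y.2 ∨ D.hTop y.1 y.2 ≤ D.hBot x.1 x.2 := by
    rintro ⟨i, s⟩ ⟨j, t⟩ hxy rfl
    have hst : s ≠ t := fun he => hxy (by rw [he])
    rcases Before.total hst with hb | hb
    · exact Or.inr (D.hTop_le_hBot h hb)
    · exact Or.inl (D.hTop_le_hBot h hb)
  exact gen (D.imageSigma a) (D.imageSigma b) hne ht

theorem preimage_disjoint (h : 0 < lam)
    {a b : (i : Fin (n + 1)) × ((k : Fin (n + 1)) × Fin (M i k))}
    (hab : a ≠ b) (ht : D.source a.1 a.2 = D.source b.1 b.2) :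
    D.vRight _ (D.preimage a.1 a.2) ≤ D.vLeft _ (D.preimage b.1 b.2) ∨
      D.vRight _ (D.preimage b.1 b.2) ≤ D.vLeft _ (D.preimage a.1 a.2) := by
  have hne : D.preimageSigma a ≠ D.preimageSigma b := fun he =>
    hab (by rw [← D.imageSigma_preimageSigma a, he, D.imageSigma_preimageSigma])
  have gen : ∀ x y : (k : Fin (n + 1)) × ((i : Fin (n + 1)) × Fin (M i k)), x ≠ y → x.1 = y.1 →
      D.vRight x.1 x.2 ≤ D.vLeft y.1 y.2 ∨ D.vRight y.1 y.2 ≤ D.vLeft x.1 x.2 := by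
    rintro ⟨i, s⟩ ⟨j, t⟩ hxy rfl
    have hst : s ≠ t := fun he => hxy (by rw [he])
    rcases Before.total hst with hb | hb
    · exact Or.inl (D.vRight_le_vLeft h hb)
    · exact Or.inr (D.vRight_le_vLeft h hb)
  exact gen (D.preimageSigma a) (D.preimageSigma b) hne ht

/-- The model of the left edge map. -/
noncomputable def leftModel (h : 0 < lam) : D.SideModel Side.left where
  ι := (k : Fin (n + 1)) × ((i : Fin (n + 1)) × Fin (M i k))
  finite := by
    have : ∀ i, Finite ((k : Fin (n + 1)) × Fin (M i k)) := fun i => inferInstance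
    infer_instance
  src a := a.1
  tgt a := D.target a.1 a.2
  off a := D.hBot _ (D.image a.1 a.2)
  dep a := D.vLeft a.1 a.2
  head k := ⟨k, (D.exists_vLeft_eq_zero h k).choose⟩
  src_head _ := rfl
  dep_head k := (D.exists_vLeft_eq_zero h k).choose_spec
  dep_nonneg a := D.vLeft_nonneg h _ _
  dep_inj := by
    rintro ⟨k, s⟩ ⟨l, t⟩ hkl hd
    obtain rfl : k = l := hkl
    exact congrArg (Sigma.mk k) (D.vLeft_injective h k hd)
  off_nonneg a := D.hBot_nonneg h _ _
  off_le a := (D.hBot_add_image a.1 a.2).trans_le (D.hTop_le h _ _)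
  disjoint a b hab ht := by
    simp only [len]
    rw [D.hBot_add_image, D.hBot_add_image]
    exact D.image_disjoint h hab ht
  mem_edges q := by
    change (q.2.im ∈ Set.Icc 0 (D.η q.1) ∧ ∃ s, q.2.re = D.vLeft q.1 s) ↔ _
    constructor
    · rintro ⟨h1, s, hs⟩
      exact ⟨⟨q.1, s⟩, q.2.im, h1, D.eq_pt rfl rfl (by simp [ht, hs])⟩
    · rintro ⟨⟨k, s⟩, u, hu, rfl⟩
      exact ⟨by simpa [pt, len] using hu, s, by simp [pt]⟩
  edgeMap_pt a u := by
    rw [D.edgeMap_left h (s := a.2) (by simp [pt])]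
    refine Prod.ext rfl (Complex.ext ?_ ?_) <;> simp [branch, pt]

/-- The model of the right edge map. -/
noncomputable def rightModel (h : 0 < lam) : D.SideModel Side.right where
  ι := (k : Fin (n + 1)) × ((i : Fin (n + 1)) × Fin (M i k))
  finite := by
    have : ∀ i, Finite ((k : Fin (n + 1)) × Fin (M i k)) := fun i => inferInstance
    infer_instance
  src a := a.1
  tgt a := D.target a.1 a.2
  off a := D.hBot _ (D.image a.1 a.2)
  dep a := D.ω a.1 - D.vRight a.1 a.2
  head k := ⟨k, (D.exists_vRight_eq h k).choose⟩
  src_head _ := rfl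
  dep_head k := by rw [(D.exists_vRight_eq h k).choose_spec, sub_self]
  dep_nonneg a := sub_nonneg.mpr (D.vRight_le h _ _)
  dep_inj := by
    rintro ⟨k, s⟩ ⟨l, t⟩ hkl hd
    obtain rfl : k = l := hkl
    exact congrArg (Sigma.mk k) (D.vRight_injective h k (sub_right_injective hd))
  off_nonneg a := D.hBot_nonneg h _ _
  off_le a := (D.hBot_add_image a.1 a.2).trans_le (D.hTop_le h _ _)
  disjoint a b hab ht := by
    simp only [len]
    rw [D.hBot_add_image, D.hBot_add_image]
    exact D.image_disjoint h hab ht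
  mem_edges q := by
    change (q.2.im ∈ Set.Icc 0 (D.η q.1) ∧ ∃ s, q.2.re = D.vRight q.1 s) ↔ _
    constructor
    · rintro ⟨h1, s, hs⟩
      exact ⟨⟨q.1, s⟩, q.2.im, h1, D.eq_pt rfl rfl (by simp [ht, hs])⟩
    · rintro ⟨⟨k, s⟩, u, hu, rfl⟩
      exact ⟨by simpa [pt, len] using hu, s, by simp [pt]⟩
  edgeMap_pt a u := by
    rw [D.edgeMap_right h (s := a.2) (by simp [pt])]
    have e := D.lam_mul_vWidth h a.1 a.2
    refine Prod.ext rfl (Complex.ext ?_ ?_) <;> simp [branch, pt, vRight, e]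

/-- The model of the top edge map. -/
noncomputable def topModel (h : 0 < lam) : D.SideModel Side.top where
  ι := (i : Fin (n + 1)) × ((k : Fin (n + 1)) × Fin (M i k))
  finite := by
    have : ∀ i, Finite ((k : Fin (n + 1)) × Fin (M i k)) := fun i => inferInstance
    infer_instance
  src a := a.1
  tgt a := D.source a.1 a.2
  off a := D.vLeft _ (D.preimage a.1 a.2)
  dep a := D.η a.1 - D.hTop a.1 a.2
  head k := ⟨k, (D.exists_hTop_eq h k).choose⟩
  src_head _ := rfl
  dep_head k := by rw [(D.exists_hTop_eq h k).choose_spec, sub_self]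
  dep_nonneg a := sub_nonneg.mpr (D.hTop_le h _ _)
  dep_inj := by
    rintro ⟨k, s⟩ ⟨l, t⟩ hkl hd
    obtain rfl : k = l := hkl
    exact congrArg (Sigma.mk k) (D.hTop_injective h k (sub_right_injective hd))
  off_nonneg a := D.vLeft_nonneg h _ _
  off_le a := (D.vLeft_add_preimage a.1 a.2).trans_le (D.vRight_le h _ _)
  disjoint a b hab ht := by
    simp only [len]
    rw [D.vLeft_add_preimage, D.vLeft_add_preimage]
    exact D.preimage_disjoint h hab ht
  mem_edges q := by
    change (q.2.re ∈ Set.Icc 0 (D.ω q.1) ∧ ∃ s, q.2.im = D.hTop q.1 s) ↔ _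
    constructor
    · rintro ⟨h1, s, hs⟩
      exact ⟨⟨q.1, s⟩, q.2.re, h1, D.eq_pt rfl rfl (by simp [ht, hs])⟩
    · rintro ⟨⟨k, s⟩, u, hu, rfl⟩
      exact ⟨by simpa [pt, len] using hu, s, by simp [pt]⟩
  edgeMap_pt a u := by
    rw [D.edgeMap_top h (t := a.2) (by simp [pt])]
    have e := D.lam_mul_hHeight h a.1 a.2
    refine Prod.ext rfl (Complex.ext ?_ ?_) <;> simp [branchInv, pt, hBot, e]

/-- The model of the bottom edge map. -/
noncomputable def bottomModel (h : 0 < lam) : D.SideModel Side.bottom where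
  ι := (i : Fin (n + 1)) × ((k : Fin (n + 1)) × Fin (M i k))
  finite := by
    have : ∀ i, Finite ((k : Fin (n + 1)) × Fin (M i k)) := fun i => inferInstance
    infer_instance
  src a := a.1
  tgt a := D.source a.1 a.2
  off a := D.vLeft _ (D.preimage a.1 a.2)
  dep a := D.hBot a.1 a.2
  head k := ⟨k, (D.exists_hBot_eq_zero h k).choose⟩
  src_head _ := rfl
  dep_head k := (D.exists_hBot_eq_zero h k).choose_spec
  dep_nonneg a := D.hBot_nonneg h _ _
  dep_inj := by
    rintro ⟨k, s⟩ ⟨l, t⟩ hkl hd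
    obtain rfl : k = l := hkl
    exact congrArg (Sigma.mk k) (D.hBot_injective h k hd)
  off_nonneg a := D.vLeft_nonneg h _ _
  off_le a := (D.vLeft_add_preimage a.1 a.2).trans_le (D.vRight_le h _ _)
  disjoint a b hab ht := by
    simp only [len]
    rw [D.vLeft_add_preimage, D.vLeft_add_preimage]
    exact D.preimage_disjoint h hab ht
  mem_edges q := by
    change (q.2.re ∈ Set.Icc 0 (D.ω q.1) ∧ ∃ s, q.2.im = D.hBot q.1 s) ↔ _
    constructor
    · rintro ⟨h1, s, hs⟩
      exact ⟨⟨q.1, s⟩, q.2.re, h1, D.eq_pt rfl rfl (by simp [ht, hs])⟩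
    · rintro ⟨⟨k, s⟩, u, hu, rfl⟩
      exact ⟨by simpa [pt, len] using hu, s, by simp [pt]⟩
  edgeMap_pt a u := by
    rw [D.edgeMap_bottom h (t := a.2) (by simp [pt])]
    refine Prod.ext rfl (Complex.ext ?_ ?_) <;> simp [branchInv, pt]

theorem nonempty_sideModel (h : 0 < lam) (s : Side) : Nonempty (D.SideModel s) := by
  cases s
  · exact ⟨D.leftModel h⟩
  · exact ⟨D.rightModel h⟩
  · exact ⟨D.topModel h⟩
  · exact ⟨D.bottomModel h⟩

end PieceData

/-! ### Dynamics of an edge map on the sides: contraction and periodic points. -/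

namespace PieceData

variable {n : ℕ} {M : Matrix (Fin (n + 1)) (Fin (n + 1)) ℕ} {lam : ℝ} {D : PieceData M lam}

namespace SideModel

variable {s : Side} (S : D.SideModel s)

/-- The rectangle onto whose side the side `s` of `Q_k` is mapped. -/
def next (k : Fin (n + 1)) : Fin (n + 1) := S.tgt (S.head k)

/-- The offset of the image of the side `s` of `Q_k`. -/
def shiftOff (k : Fin (n + 1)) : ℝ := S.off (S.head k)

theorem edgeMap_side (k u) :
    D.edgeMap s (D.pt s k u 0) = D.pt s (S.next k) (S.shiftOff k + lam⁻¹ * u) 0 := by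
  have := S.edgeMap_pt (S.head k) u
  rwa [S.src_head, S.dep_head, neg_zero] at this

theorem pt_mem_edges (S : D.SideModel s) {k u} (hu : u ∈ Set.Icc 0 (D.len s k)) : D.pt s k u 0 ∈ D.edges s := by
  rw [S.mem_edges]
  exact ⟨S.head k, u, by rwa [S.src_head], by rw [S.src_head, S.dep_head, neg_zero]⟩

theorem side_mem_edges (S : D.SideModel s) {q : Pt n} (h0 : D.ht s q = 0) (hu : s.co q ∈ Set.Icc 0 (D.len s q.1)) :
    q ∈ D.edges s := by
  rw [D.eq_pt rfl rfl h0]; exact S.pt_mem_edges hu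

theorem off_add_mem (h : 0 < lam) (a) {u} (hu : u ∈ Set.Icc 0 (D.len s (S.src a))) :
    S.off a + lam⁻¹ * u ∈ Set.Icc 0 (D.len s (S.tgt a)) := by
  have h1 := S.off_nonneg a
  have h2 := S.off_le a
  have h3 : 0 ≤ lam⁻¹ * u := mul_nonneg (inv_nonneg.mpr h.le) hu.1
  have h4 : lam⁻¹ * u ≤ lam⁻¹ * D.len s (S.src a) :=
    mul_le_mul_of_nonneg_left hu.2 (inv_nonneg.mpr h.le)
  exact ⟨by linarith, by linarith⟩

theorem edgeMap_mem (S : D.SideModel s) (h : 0 < lam) {q : Pt n} (hq : q ∈ D.edges s) :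
    D.ht s (D.edgeMap s q) = 0 ∧
      s.co (D.edgeMap s q) ∈ Set.Icc 0 (D.len s (D.edgeMap s q).1) := by
  obtain ⟨a, u, hu, rfl⟩ := (S.mem_edges q).mp hq
  rw [S.edgeMap_pt]
  simp only [ht_pt, co_pt, pt_fst, true_and]
  exact S.off_add_mem h a hu

theorem ht_nonpos_of_mem_edges (S : D.SideModel s) {q : Pt n} (hq : q ∈ D.edges s) : D.ht s q ≤ 0 := by
  obtain ⟨a, u, hu, rfl⟩ := (S.mem_edges q).mp hq
  simpa using S.dep_nonneg a

theorem co_mem_of_mem_edges (S : D.SideModel s) {q : Pt n} (hq : q ∈ D.edges s) :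
    s.co q ∈ Set.Icc 0 (D.len s q.1) := by
  obtain ⟨a, u, hu, rfl⟩ := (S.mem_edges q).mp hq
  simpa using hu

theorem iterate_side {q : Pt n} (h0 : D.ht s q = 0) (m : ℕ) :
    ((D.edgeMap s)^[m] q).1 = S.next^[m] q.1 ∧ D.ht s ((D.edgeMap s)^[m] q) = 0 := by
  induction m with
  | zero => exact ⟨rfl, h0⟩
  | succ m ih =>
    rw [Function.iterate_succ_apply', Function.iterate_succ_apply', D.eq_pt rfl rfl ih.2,
      S.edgeMap_side]
    simp [ih.1]

/-- Two points on the same side follow the same itinerary of rectangles, so the offsets cancel and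
each step contributes a factor `lam⁻¹`. -/
theorem iterate_co_sub (S : D.SideModel s) {q q' : Pt n} (h0 : D.ht s q = 0) (h0' : D.ht s q' = 0) (hq : q.1 = q'.1)
    (m : ℕ) : s.co ((D.edgeMap s)^[m] q) - s.co ((D.edgeMap s)^[m] q') =
      (lam⁻¹) ^ m * (s.co q - s.co q') := by
  induction m with
  | zero => simp
  | succ m ih =>
    have h1 := S.iterate_side h0 m
    have h2 := S.iterate_side h0' m
    rw [Function.iterate_succ_apply', Function.iterate_succ_apply', D.eq_pt rfl rfl h1.2,
      D.eq_pt rfl rfl h2.2, S.edgeMap_side, S.edgeMap_side, co_pt, co_pt, h1.1, h2.1, hq, pow_succ']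
    rw [mul_assoc, ← ih]
    ring

theorem iterate_co_mem (S : D.SideModel s) (h : 0 < lam) {q : Pt n} (h0 : D.ht s q = 0)
    (hu : s.co q ∈ Set.Icc 0 (D.len s q.1)) (m : ℕ) :
    s.co ((D.edgeMap s)^[m] q) ∈ Set.Icc 0 (D.len s ((D.edgeMap s)^[m] q).1) := by
  induction m with
  | zero => exact hu
  | succ m ih =>
    rw [Function.iterate_succ_apply']
    exact (S.edgeMap_mem h (S.side_mem_edges (S.iterate_side h0 m).2 ih)).2

theorem iterate_mem_edges (S : D.SideModel s) (h : 0 < lam) {q : Pt n} (hq : q ∈ D.edges s) (m : ℕ) :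
    (D.edgeMap s)^[m] q ∈ D.edges s := by
  cases m with
  | zero => exact hq
  | succ m =>
    have h1 := S.edgeMap_mem h hq
    rw [Function.iterate_succ_apply]
    exact S.side_mem_edges (S.iterate_side h1.1 m).2 (S.iterate_co_mem h h1.1 h1.2 m)

/-- A periodic point is itself a value of the edge map, and all values lie on sides of rectangles.
-/
theorem periodic_side (S : D.SideModel s) (h : 0 < lam) {x : Pt n} (hx : x ∈ D.periodic s) :
    D.ht s x = 0 ∧ s.co x ∈ Set.Icc 0 (D.len s x.1) := by
  obtain ⟨hxe, p, hp, hxp⟩ := hx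
  obtain ⟨m, rfl⟩ := Nat.exists_eq_succ_of_ne_zero hp.ne'
  have h1 := S.edgeMap_mem h (S.iterate_mem_edges h hxe m)
  rw [← Function.iterate_succ_apply' (D.edgeMap s) m x] at h1
  have hxp' : (D.edgeMap s)^[m.succ] x = x := hxp
  rwa [hxp'] at h1

theorem iterate_mem_periodic (S : D.SideModel s) (h : 0 < lam) {x : Pt n} (hx : x ∈ D.periodic s) (m : ℕ) :
    (D.edgeMap s)^[m] x ∈ D.periodic s := by
  refine ⟨S.iterate_mem_edges h hx.1 m, ?_⟩
  obtain ⟨p, hp, hxp⟩ := hx.2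
  exact ⟨p, hp, hxp.apply_iterate m⟩

theorem edgeMap_mem_periodic (S : D.SideModel s) (h : 0 < lam) {x : Pt n} (hx : x ∈ D.periodic s) :
    D.edgeMap s x ∈ D.periodic s := S.iterate_mem_periodic h hx 1

theorem period_pos {x : Pt n} (hx : x ∈ D.periodic s) : 0 < D.period s x :=
  Function.minimalPeriod_pos_of_mem_periodicPts hx.2

theorem iterate_period (x : Pt n) : (D.edgeMap s)^[D.period s x] x = x :=
  Function.isPeriodicPt_minimalPeriod _ x

theorem period_iterate {x : Pt n} (hx : x ∈ D.periodic s) (m : ℕ) :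
    D.period s ((D.edgeMap s)^[m] x) = D.period s x :=
  Function.minimalPeriod_apply_iterate hx.2 m

/-- There is at most one periodic point on a given side of a rectangle. -/
theorem periodic_unique (S : D.SideModel s) (h1 : 1 < lam) {x y : Pt n} (hx : x ∈ D.periodic s)
    (hy : y ∈ D.periodic s) (hxy : x.1 = y.1) : x = y := by
  have h : 0 < lam := one_pos.trans h1
  have hx1 := S.periodic_side h hx
  have hy1 := S.periodic_side h hy
  set p := D.period s x * D.period s y with hp
  have hp0 : 0 < p := Nat.mul_pos (period_pos hx) (period_pos hy)
  have ex : (D.edgeMap s)^[p] x = x :=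
    (Function.isPeriodicPt_minimalPeriod (D.edgeMap s) x).mul_const _
  have ey : (D.edgeMap s)^[p] y = y :=
    (Function.isPeriodicPt_minimalPeriod (D.edgeMap s) y).const_mul _
  have hd := S.iterate_co_sub hx1.1 hy1.1 hxy p
  rw [ex, ey] at hd
  -- A common period fixes both points, while it contracts their distance by a factor less than one.
  have hlt : (lam⁻¹) ^ p < 1 := pow_lt_one₀ (inv_nonneg.mpr h.le) (inv_lt_one_of_one_lt₀ h1) hp0.ne'
  have hco : s.co x = s.co y := by
    have : (1 - (lam⁻¹) ^ p) * (s.co x - s.co y) = 0 := by linarith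
    rcases mul_eq_zero.mp this with h3 | h3
    · linarith
    · linarith
  rw [D.eq_pt hxy hco hx1.1]
  exact (D.eq_pt rfl rfl hy1.1).symm

end SideModel

/-- The sign of the outward direction at an end of a side. -/
def sg (b : Bool) : ℝ := if b then 1 else -1

/-- The distance from a point of a side to an end of that side. -/
def gap (D : PieceData M lam) (s : Side) (b : Bool) (x : Pt n) : ℝ :=
  sg b * (D.cor s b x.1 - s.co x)

theorem gap_true (s) (x : Pt n) : D.gap s true x = D.len s x.1 - s.co x := by
  simp [gap, sg, cor]

theorem gap_false (s) (x : Pt n) : D.gap s false x = s.co x := by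
  simp [gap, sg, cor]

theorem sg_mul_sg (b) : sg b * sg b = 1 := by cases b <;> simp [sg]

theorem cor_mem (s b k) : D.cor s b k ∈ Set.Icc 0 (D.len s k) := by
  have := (D.len_pos s k).le
  cases b <;> simp [cor, this]

theorem gap_nonneg {s b} {x : Pt n} (hu : s.co x ∈ Set.Icc 0 (D.len s x.1)) : 0 ≤ D.gap s b x := by
  cases b
  · rw [gap_false]; exact hu.1
  · rw [gap_true]; linarith [hu.2]

namespace SideModel

variable {s : Side} (S : D.SideModel s)

/-- The left hand side is the distance from `x` to the image of the end of the side containing `r`,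
and that image still lies on the side containing `x`. -/
theorem pow_mul_gap_le (S : D.SideModel s) (h : 0 < lam) {r x : Pt n} (hr : r ∈ D.periodic s) {m : ℕ}
    (hm : (D.edgeMap s)^[m] r = x) (b : Bool) : (lam⁻¹) ^ m * D.gap s b r ≤ D.gap s b x := by
  have hr1 := S.periodic_side h hr
  have h1 := S.iterate_co_sub (q := D.pt s r.1 (D.cor s b r.1) 0) (by simp) hr1.1 (by simp) m
  have h2 := S.iterate_co_mem h (q := D.pt s r.1 (D.cor s b r.1) 0) (by simp)
    (by simpa using D.cor_mem s b r.1) m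
  have h3 := (S.iterate_side (q := D.pt s r.1 (D.cor s b r.1) 0) (by simp) m).1
  have h4 := (S.iterate_side hr1.1 m).1
  rw [pt_fst] at h3
  rw [h3, ← h4] at h2
  rw [hm] at h1 h2
  rw [co_pt] at h1
  have h5 : (lam⁻¹) ^ m * D.gap s b r = sg b * ((lam⁻¹) ^ m * (D.cor s b r.1 - s.co r)) := by
    unfold gap; ring
  rw [h5, ← h1]
  have h6 := h2.1
  have h7 := h2.2
  cases b
  · rw [gap_false]; simp only [sg]; norm_num; linarith
  · rw [gap_true]; simp only [sg]; norm_num; linarith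

theorem exists_iterate_eq {r x : Pt n} (hr : r ∈ D.periodic s) {m : ℕ}
    (hm : (D.edgeMap s)^[m] r = x) : ∃ j, (D.edgeMap s)^[j] x = r := by
  -- The iterates complete to `period * m`, a multiple of the period, without reducing `m` modulo
  -- the period.
  refine ⟨D.period s r * m - m, ?_⟩
  have hle : m ≤ D.period s r * m := Nat.le_mul_of_pos_left m (period_pos hr)
  rw [← hm, ← Function.iterate_add_apply, Nat.sub_add_cancel hle]
  exact (Function.isPeriodicPt_minimalPeriod (D.edgeMap s) r).mul_const _

/-- A positive gap stays positive along the orbit, and one can return to the starting point. Hence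
an orbit meets a given kind of corner always or never. -/
theorem gap_pos_iff (S : D.SideModel s) (h : 0 < lam) {r x : Pt n} (hr : r ∈ D.periodic s) {m : ℕ}
    (hm : (D.edgeMap s)^[m] r = x) (b : Bool) : 0 < D.gap s b r ↔ 0 < D.gap s b x := by
  have hx : x ∈ D.periodic s := hm ▸ S.iterate_mem_periodic h hr m
  obtain ⟨j, hj⟩ := exists_iterate_eq hr hm
  have hl : ∀ i : ℕ, 0 < (lam⁻¹) ^ i := fun i => pow_pos (inv_pos.mpr h) i
  constructor
  · intro h0
    exact (mul_pos (hl m) h0).trans_le (S.pow_mul_gap_le h hr hm b)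
  · intro h0
    exact (mul_pos (hl j) h0).trans_le (S.pow_mul_gap_le h hx hj b)

/-- Removing one period from the iterates leads to the same point, and the non-strict bound for
fewer iterates is strictly larger. -/
theorem pow_mul_gap_lt (S : D.SideModel s) (h1 : 1 < lam) {r x : Pt n} (hr : r ∈ D.periodic s) {m : ℕ}
    (hm : (D.edgeMap s)^[m] r = x) (hmp : D.period s r ≤ m) {b : Bool} (hb : 0 < D.gap s b r) :
    (lam⁻¹) ^ m * D.gap s b r < D.gap s b x := by
  have h : 0 < lam := one_pos.trans h1
  obtain ⟨i, rfl⟩ := Nat.exists_eq_add_of_le hmp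
  have hm' : (D.edgeMap s)^[i] r = x := by
    rw [← hm, add_comm, Function.iterate_add_apply, iterate_period]
  refine lt_of_lt_of_le ?_ (S.pow_mul_gap_le h hr hm' b)
  refine mul_lt_mul_of_pos_right ?_ hb
  exact pow_lt_pow_right_of_lt_one₀ (inv_pos.mpr h) (inv_lt_one_of_one_lt₀ h1)
    (by have := period_pos hr; omega)

end SideModel

end PieceData

/-! ### Stages and depths along a periodic orbit. -/

namespace InitialPoints

open PieceData SideModel

variable {n : ℕ} {M : Matrix (Fin (n + 1)) (Fin (n + 1)) ℕ} {lam : ℝ} {D : PieceData M lam}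
  (I : InitialPoints D)

theorem eq_of_iterate {s : Side} {y y' x : Pt n} (hy : y ∈ I.pts s) (hy' : y' ∈ I.pts s)
    {i j : ℕ} (hx : x ∈ D.periodic s) (hi : (D.edgeMap s)^[i] y = x)
    (hj : (D.edgeMap s)^[j] y' = x) : y = y' :=
  (I.existsUnique s x hx).unique ⟨hy, i, hi⟩ ⟨hy', j, hj⟩

theorem stage_spec_forward {s : Side} (hs : s.forward = true) {x : Pt n} (hx : x ∈ D.periodic s) :
    I.stage s x < D.period s x ∧ ∃ y ∈ I.pts s, (D.edgeMap s)^[I.stage s x] y = x := by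
  have hst : I.stage s x = sInf {j | ∃ y ∈ I.pts s, (D.edgeMap s)^[j] y = x} := by
    rw [stage, if_pos hs]
  obtain ⟨y, ⟨hy, j, hj⟩, -⟩ := I.existsUnique s x hx
  have hyp := I.subset s hy
  have hper : D.period s x = D.period s y := by rw [← hj]; exact period_iterate hyp j
  have hmem : j % D.period s y ∈ {j | ∃ y ∈ I.pts s, (D.edgeMap s)^[j] y = x} :=
    ⟨y, hy, ((Function.isPeriodicPt_minimalPeriod (D.edgeMap s) y).iterate_mod_apply j).trans hj⟩
  rw [hst]
  refine ⟨lt_of_le_of_lt (Nat.sInf_le hmem) ?_, Nat.sInf_mem ⟨_, hmem⟩⟩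
  rw [hper]
  exact Nat.mod_lt _ (period_pos hyp)

theorem stage_spec_backward {s : Side} (hs : s.forward = false) {x : Pt n}
    (hx : x ∈ D.periodic s) :
    I.stage s x < D.period s x ∧ (D.edgeMap s)^[I.stage s x] x ∈ I.pts s := by
  have hst : I.stage s x = sInf {j | (D.edgeMap s)^[j] x ∈ I.pts s} := by
    rw [stage, if_neg (by simp [hs])]
  obtain ⟨y, ⟨hy, j, hj⟩, -⟩ := I.existsUnique s x hx
  obtain ⟨i, hi⟩ := exists_iterate_eq (I.subset s hy) hj
  have hmem : i % D.period s x ∈ {j | (D.edgeMap s)^[j] x ∈ I.pts s} := by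
    have e := (Function.isPeriodicPt_minimalPeriod (D.edgeMap s) x).iterate_mod_apply i
    rw [hi] at e
    change (D.edgeMap s)^[i % Function.minimalPeriod (D.edgeMap s) x] x ∈ I.pts s
    exact e.symm ▸ hy
  rw [hst]
  exact ⟨lt_of_le_of_lt (Nat.sInf_le hmem) (Nat.mod_lt _ (period_pos hx)), Nat.sInf_mem ⟨_, hmem⟩⟩

theorem iterate_injOn {s : Side} {x : Pt n} {i j : ℕ} (hi : i < D.period s x)
    (hj : j < D.period s x) (hij : (D.edgeMap s)^[i] x = (D.edgeMap s)^[j] x) : i = j :=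
  Function.iterate_injOn_Iio_minimalPeriod hi hj hij

theorem stage_eq_forward {s : Side} (hs : s.forward = true) {x : Pt n} (hx : x ∈ D.periodic s)
    {y : Pt n} {j : ℕ} (hj : j < D.period s x) (hy : y ∈ I.pts s)
    (hyx : (D.edgeMap s)^[j] y = x) : I.stage s x = j := by
  obtain ⟨h1, y', hy', h2⟩ := I.stage_spec_forward hs hx
  obtain rfl := I.eq_of_iterate hy' hy hx h2 hyx
  have hper : D.period s x = D.period s y' := by rw [← h2]; exact period_iterate (I.subset s hy') _
  rw [hper] at h1 hj
  exact iterate_injOn h1 hj (h2.trans hyx.symm)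

theorem stage_eq_backward {s : Side} (hs : s.forward = false) {x : Pt n} (hx : x ∈ D.periodic s)
    {j : ℕ} (hj : j < D.period s x) (hy : (D.edgeMap s)^[j] x ∈ I.pts s) : I.stage s x = j := by
  obtain ⟨h1, h2⟩ := I.stage_spec_backward hs hx
  obtain ⟨a, ha⟩ := exists_iterate_eq hx (m := j) rfl
  obtain ⟨b, hb⟩ := exists_iterate_eq hx (m := I.stage s x) rfl
  exact iterate_injOn h1 hj (I.eq_of_iterate h2 hy hx hb ha)

/-- In both directions `depth` is a number of iterates from the initial point to `x`, with at least
one full extra period. This extra period keeps the bases of the infinite strips strictly inside the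
images of the sides. -/
theorem depth_spec {s : Side} {x : Pt n} (hx : x ∈ D.periodic s) :
    I.root s x ∈ I.pts s ∧ (D.edgeMap s)^[I.depth s x] (I.root s x) = x ∧
      D.period s (I.root s x) = D.period s x ∧ D.period s x + 1 ≤ I.depth s x := by
  have hp0 := period_pos hx
  rcases hs : s.forward with _ | _
  · obtain ⟨h1, h2⟩ := I.stage_spec_backward hs hx
    have hr : I.root s x = (D.edgeMap s)^[I.stage s x] x := by rw [root, if_neg (by simp [hs])]
    have hd : I.depth s x = 2 * D.period s x - I.stage s x := by rw [depth, if_neg (by simp [hs])]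
    rw [hr, hd]
    refine ⟨h2, ?_, period_iterate hx _, by omega⟩
    rw [← Function.iterate_add_apply, Nat.sub_add_cancel (by omega)]
    exact (Function.isPeriodicPt_minimalPeriod (D.edgeMap s) x).const_mul 2
  · obtain ⟨h1, y, hy, h2⟩ := I.stage_spec_forward hs hx
    have hyp := I.subset s hy
    have hper : D.period s x = D.period s y := by
      conv_lhs => rw [← h2]
      exact period_iterate hyp _
    have hr : I.root s x = y := by
      rw [root, if_pos hs]
      refine (congrArg _ h2.symm).trans ?_
      rw [← Function.iterate_add_apply, Nat.sub_add_cancel h1.le, hper]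
      exact iterate_period y
    have hd : I.depth s x = 2 * D.period s x + I.stage s x := by rw [depth, if_pos hs]
    rw [hr, hd]
    refine ⟨hy, ?_, hper.symm, by omega⟩
    rw [add_comm, Function.iterate_add_apply]
    have : (D.edgeMap s)^[2 * D.period s x] y = y := by
      rw [hper]; exact (Function.isPeriodicPt_minimalPeriod (D.edgeMap s) y).const_mul 2
    rw [this, h2]

theorem root_edgeMap (h : 0 < lam) {s : Side} (S : D.SideModel s) {x : Pt n}
    (hx : x ∈ D.periodic s) : I.root s (D.edgeMap s x) = I.root s x := by
  have hFx := S.edgeMap_mem_periodic h hx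
  obtain ⟨h1, h2, -, -⟩ := I.depth_spec hx
  obtain ⟨h3, h4, -, -⟩ := I.depth_spec hFx
  refine I.eq_of_iterate h3 h1 hFx h4 (j := I.depth s x + 1) ?_
  rw [Function.iterate_succ_apply', h2]

/-- Depth counts iterates from the initial point, so it grows by one per step. Only at the step that
crosses the initial point in the direction of `f_0` is a period subtracted, which is where the
strips are shifted. -/
theorem depth_edgeMap (h : 0 < lam) {s : Side} (S : D.SideModel s) {x : Pt n}
    (hx : x ∈ D.periodic s) :
    (I.shift s x = 1 ∧ I.depth s (D.edgeMap s x) + D.period s x = I.depth s x + 1) ∨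
      (I.shift s x = 0 ∧ I.depth s (D.edgeMap s x) = I.depth s x + 1) := by
  have hp0 := period_pos hx
  have hFx := S.edgeMap_mem_periodic h hx
  have hperF : D.period s (D.edgeMap s x) = D.period s x := period_iterate hx 1
  have hback : (D.edgeMap s)^[D.period s x - 1] (D.edgeMap s x) = x := by
    rw [← Function.iterate_succ_apply, Nat.succ_eq_add_one, Nat.sub_add_cancel hp0]
    exact iterate_period x
  rcases hs : s.forward with _ | _
  · have hd : ∀ x, I.depth s x = 2 * D.period s x - I.stage s x := fun x => by
      rw [depth, if_neg (by simp [hs])]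
    by_cases hm : x ∈ I.pts s
    · left
      have e1 : I.stage s x = 0 := I.stage_eq_backward hs hx hp0 (by simpa using hm)
      have e2 : I.stage s (D.edgeMap s x) = D.period s x - 1 :=
        I.stage_eq_backward hs hFx (by omega) (by rw [hback]; exact hm)
      refine ⟨by simp [shift, hs, hm], ?_⟩
      rw [hd, hd, hperF, e1, e2]; omega
    · right
      obtain ⟨h1, h2⟩ := I.stage_spec_backward hs hx
      have hne : I.stage s x ≠ 0 := fun h0 => hm (by rw [h0] at h2; exact h2)
      have e2 : I.stage s (D.edgeMap s x) = I.stage s x - 1 := by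
        refine I.stage_eq_backward hs hFx (by omega) ?_
        rw [← Function.iterate_succ_apply, Nat.succ_eq_add_one, Nat.sub_add_cancel (by omega)]
        exact h2
      refine ⟨by simp [shift, hs, hm], ?_⟩
      rw [hd, hd, hperF, e2]; omega
  · have hd : ∀ x, I.depth s x = 2 * D.period s x + I.stage s x := fun x => by
      rw [depth, if_pos hs]
    by_cases hm : D.edgeMap s x ∈ I.pts s
    · left
      have e1 : I.stage s (D.edgeMap s x) = 0 :=
        I.stage_eq_forward hs hFx (by omega) hm rfl
      have e2 : I.stage s x = D.period s x - 1 :=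
        I.stage_eq_forward hs hx (by omega) hm hback
      refine ⟨by simp [shift, hs, hm], ?_⟩
      rw [hd, hd, hperF, e1, e2]; omega
    · right
      obtain ⟨h1, y, hy, h2⟩ := I.stage_spec_forward hs hx
      have h3 : (D.edgeMap s)^[I.stage s x + 1] y = D.edgeMap s x := by
        rw [Function.iterate_succ_apply', h2]
      have hlt : I.stage s x + 1 < D.period s x := by
        refine lt_of_le_of_ne h1 fun he => hm ?_
        have hper : D.period s x = D.period s y := by
          conv_lhs => rw [← h2]
          exact period_iterate (I.subset s hy) _
        rw [he, hper, iterate_period] at h3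
        exact h3 ▸ hy
      have e2 : I.stage s (D.edgeMap s x) = I.stage s x + 1 :=
        I.stage_eq_forward hs hFx (by omega) hy h3
      refine ⟨by simp [shift, hs, hm], ?_⟩
      rw [hd, hd, hperF, e2]; omega

end InitialPoints

/-! ### Bases of the infinite strips and the extended sides. -/

namespace InitialPoints

open PieceData SideModel

variable {n : ℕ} {M : Matrix (Fin (n + 1)) (Fin (n + 1)) ℕ} {lam : ℝ} {D : PieceData M lam}
  (I : InitialPoints D)

/-- The distance from the periodic point `x` to an end of the base of its infinite strip. -/
noncomputable def reach (s : Side) (b : Bool) (x : Pt n) : ℝ :=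
  (lam⁻¹) ^ I.depth s x * D.gap s b (I.root s x)

/-- The coordinate of an end of the base of the infinite strip at `x`. -/
noncomputable def endCo (s : Side) (b : Bool) (x : Pt n) : ℝ := s.co x + sg b * I.reach s b x

section

variable {s : Side} (S : D.SideModel s) {x : Pt n}

theorem _root_.PieceData.SideModel.iterate_corner (S : D.SideModel s) {r : Pt n}
    (h0 : D.ht s r = 0) {m : ℕ} (hm : (D.edgeMap s)^[m] r = x) (b : Bool) :
    (D.edgeMap s)^[m] (D.corner s b r.1) =
      D.pt s x.1 (s.co x + sg b * ((lam⁻¹) ^ m * D.gap s b r)) 0 := by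
  rw [D.corner_eq]
  have h1 := S.iterate_side (q := D.pt s r.1 (D.cor s b r.1) 0) (by simp) m
  have h2 := S.iterate_co_sub (q := D.pt s r.1 (D.cor s b r.1) 0) (by simp) h0 (by simp) m
  have h3 := (S.iterate_side h0 m).1
  rw [hm] at h2 h3
  refine D.eq_pt (by rw [h1.1, h3, pt_fst]) ?_ h1.2
  rw [co_pt] at h2
  have h4 : sg b * ((lam⁻¹) ^ m * D.gap s b r) = (lam⁻¹) ^ m * (D.cor s b r.1 - s.co r) := by
    unfold gap
    linear_combination ((lam⁻¹) ^ m * (D.cor s b r.1 - s.co r)) * sg_mul_sg b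
  rw [h4]
  linarith

/-- An iterate is affine on a side with slope `lam⁻¹ ^ m`, so the image of the side is the interval
around `x` whose half lengths are the scaled gaps of `r`. -/
theorem _root_.PieceData.SideModel.mem_iterate_image_edge (S : D.SideModel s) (h : 0 < lam)
    {r : Pt n} (h0 : D.ht s r = 0) {m : ℕ}
    (hm : (D.edgeMap s)^[m] r = x) {q : Pt n} :
    q ∈ (D.edgeMap s)^[m] '' D.edge s r.1 ↔ q.1 = x.1 ∧ D.ht s q = 0 ∧
      s.co q ∈ Set.Icc (s.co x - (lam⁻¹) ^ m * D.gap s false r)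
        (s.co x + (lam⁻¹) ^ m * D.gap s true r) := by
  have hl : 0 < (lam⁻¹) ^ m := pow_pos (inv_pos.mpr h) m
  have h3 := (S.iterate_side h0 m).1
  rw [hm] at h3
  rw [gap_true, gap_false]
  constructor
  · rintro ⟨y, hy, rfl⟩
    obtain ⟨hy1, hy2, hy3⟩ := D.mem_edge.mp hy
    have h1 := S.iterate_side hy2 m
    have h2 := S.iterate_co_sub hy2 h0 hy1 m
    rw [hm] at h2
    refine ⟨by rw [h1.1, hy1, h3], h1.2, ?_, ?_⟩
    · nlinarith [hy3.1]
    · nlinarith [hy3.2]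
  · rintro ⟨hq1, hq2, hq3⟩
    set u : ℝ := s.co r + ((lam⁻¹) ^ m)⁻¹ * (s.co q - s.co x) with hu
    have hum : (lam⁻¹) ^ m * (u - s.co r) = s.co q - s.co x := by
      rw [hu, add_sub_cancel_left, mul_inv_cancel_left₀ hl.ne']
    refine ⟨D.pt s r.1 u 0, D.mem_edge.mpr ⟨by simp, by simp, ?_, ?_⟩, ?_⟩
    · rw [co_pt]
      by_contra hneg
      nlinarith [hq3.1]
    · rw [co_pt]
      by_contra hneg
      nlinarith [hq3.2]
    · have h1 := S.iterate_side (q := D.pt s r.1 u 0) (by simp) m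
      have h2 := S.iterate_co_sub (q := D.pt s r.1 u 0) (by simp) h0 (by simp) m
      rw [hm, co_pt, hum] at h2
      rw [D.eq_pt (k := q.1) (u := s.co q) (h1.1.trans (by rw [pt_fst, ← h3, hq1])) (by linarith) h1.2]
      exact (D.eq_pt rfl rfl hq2).symm

theorem baseEnd_eq (S : D.SideModel s) (h : 0 < lam) (hx : x ∈ D.periodic s) (b : Bool) :
    I.baseEnd s b x = D.pt s x.1 (I.endCo s b x) 0 := by
  obtain ⟨h1, h2, -, -⟩ := I.depth_spec hx
  exact S.iterate_corner (S.periodic_side h (I.subset s h1)).1 h2 b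

theorem mem_base (S : D.SideModel s) (h : 0 < lam) (hx : x ∈ D.periodic s) {q : Pt n} :
    q ∈ I.base s x ↔ q.1 = x.1 ∧ D.ht s q = 0 ∧
      s.co q ∈ Set.Icc (I.endCo s false x) (I.endCo s true x) := by
  obtain ⟨h1, h2, -, -⟩ := I.depth_spec hx
  rw [base, S.mem_iterate_image_edge h (S.periodic_side h (I.subset s h1)).1 h2]
  simp [endCo, reach, sg, sub_eq_add_neg]

theorem root_gap_pos_iff (S : D.SideModel s) (h : 0 < lam) (hx : x ∈ D.periodic s) (b : Bool) :
    0 < D.gap s b (I.root s x) ↔ 0 < D.gap s b x := by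
  obtain ⟨h1, h2, -, -⟩ := I.depth_spec hx
  exact S.gap_pos_iff h (I.subset s h1) h2 b

theorem reach_lt (S : D.SideModel s) (h1 : 1 < lam) (hx : x ∈ D.periodic s) {b : Bool}
    (hb : 0 < D.gap s b x) : I.reach s b x < D.gap s b x := by
  obtain ⟨h2, h3, h4, h5⟩ := I.depth_spec hx
  exact S.pow_mul_gap_lt h1 (I.subset s h2) h3 (by omega)
    ((I.root_gap_pos_iff S (one_pos.trans h1) hx b).mpr hb)

theorem reach_pos (S : D.SideModel s) (h : 0 < lam) (hx : x ∈ D.periodic s) {b : Bool}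
    (hb : 0 < D.gap s b x) : 0 < I.reach s b x :=
  mul_pos (pow_pos (inv_pos.mpr h) _) ((I.root_gap_pos_iff S h hx b).mpr hb)

theorem periodic_gap_nonneg (S : D.SideModel s) (h : 0 < lam) (hx : x ∈ D.periodic s) (b : Bool) :
    0 ≤ D.gap s b x := gap_nonneg (S.periodic_side h hx).2

theorem reach_nonneg (S : D.SideModel s) (h : 0 < lam) (hx : x ∈ D.periodic s) (b : Bool) :
    0 ≤ I.reach s b x :=
  mul_nonneg (pow_pos (inv_pos.mpr h) _).le
    (periodic_gap_nonneg S h (I.subset s (I.depth_spec hx).1) b)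

theorem reach_eq_zero (S : D.SideModel s) (h : 0 < lam) (hx : x ∈ D.periodic s) {b : Bool}
    (hb : ¬ 0 < D.gap s b x) : I.reach s b x = 0 := by
  rw [← I.root_gap_pos_iff S h hx b] at hb
  have := periodic_gap_nonneg S h (I.subset s (I.depth_spec hx).1) b
  rw [reach, le_antisymm (not_lt.mp hb) this, mul_zero]

theorem reach_le (S : D.SideModel s) (h1 : 1 < lam) (hx : x ∈ D.periodic s) (b : Bool) :
    I.reach s b x ≤ D.gap s b x := by
  by_cases hb : 0 < D.gap s b x
  · exact (I.reach_lt S h1 hx hb).le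
  · rw [I.reach_eq_zero S (one_pos.trans h1) hx hb]
    exact periodic_gap_nonneg S (one_pos.trans h1) hx b

theorem cor_eq (s : Side) (b : Bool) (x : Pt n) :
    D.cor s b x.1 = s.co x + sg b * D.gap s b x := by
  unfold gap
  linear_combination (-(D.cor s b x.1 - s.co x)) * sg_mul_sg b

/-- The base stops strictly before the end of the side unless the periodic point is itself that end;
then base end, periodic point and corner coincide. -/
theorem isOuter_iff (S : D.SideModel s) (h1 : 1 < lam) (hx : x ∈ D.periodic s) (b : Bool) :
    I.IsOuter s b x ↔ ¬ 0 < D.gap s b x := by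
  have h : 0 < lam := one_pos.trans h1
  rw [IsOuter, I.baseEnd_eq S h hx, D.corner_eq]
  constructor
  · intro he hb
    have h2 := congrArg s.co he
    rw [co_pt, co_pt, cor_eq (D := D) s b x, endCo] at h2
    have h3 := I.reach_lt S h1 hx hb
    have h4 : sg b * (sg b * I.reach s b x) = sg b * (sg b * D.gap s b x) := by
      rw [add_left_cancel h2]
    rw [← mul_assoc, ← mul_assoc, sg_mul_sg, one_mul, one_mul] at h4
    linarith
  · intro hb
    rw [cor_eq (D := D) s b x, endCo, I.reach_eq_zero S h hx hb,
      le_antisymm (not_lt.mp hb) (periodic_gap_nonneg S h hx b)]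

/-- The point `q` of the extended side lies on the side `b` of the infinite strip at `x`, at
distance `sg b * (co q - co x)` from `x`. -/
def OnArm (s : Side) (x : Pt n) (b : Bool) (q : Pt n) : Prop :=
  q.1 = x.1 ∧ 0 < D.gap s b x ∧
    ((D.ht s q = 0 ∧ I.reach s b x < sg b * (s.co q - s.co x) ∧
        sg b * (s.co q - s.co x) ≤ D.gap s b x) ∨
      (sg b * (s.co q - s.co x) = I.reach s b x ∧ 0 ≤ D.ht s q))

theorem OnArm.reach_le {b : Bool} {q : Pt n} (hq : I.OnArm s x b q) :
    I.reach s b x ≤ sg b * (s.co q - s.co x) := by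
  rcases hq.2.2 with h | h
  · exact h.2.1.le
  · exact h.1.ge

theorem OnArm.ht_nonneg {b : Bool} {q : Pt n} (hq : I.OnArm s x b q) : 0 ≤ D.ht s q := by
  rcases hq.2.2 with h | h
  · exact h.1.ge
  · exact h.2

theorem OnArm.pos {b : Bool} {q : Pt n} (S : D.SideModel s) (h : 0 < lam) (hx : x ∈ D.periodic s)
    (hq : I.OnArm s x b q) : 0 < sg b * (s.co q - s.co x) :=
  (I.reach_pos S h hx hq.2.1).trans_le (hq.reach_le I)

theorem mem_ray (S : D.SideModel s) (h : 0 < lam) (hx : x ∈ D.periodic s) {b : Bool} {q : Pt n} :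
    q ∈ I.ray s b x ↔ q.1 = x.1 ∧ s.co q = I.endCo s b x ∧ 0 ≤ D.ht s q := by
  constructor
  · rintro ⟨w, hw, rfl⟩
    rw [I.baseEnd_eq S h hx, D.push_pt]
    simpa using hw
  · rintro ⟨h1, h2, h3⟩
    refine ⟨D.ht s q, h3, ?_⟩
    rw [I.baseEnd_eq S h hx, D.push_pt, zero_add]
    exact D.eq_pt h1 h2 rfl

theorem sg_mul_endCo (s : Side) (b : Bool) (x : Pt n) :
    sg b * (I.endCo s b x - s.co x) = I.reach s b x := by
  rw [endCo, add_sub_cancel_left, ← mul_assoc, sg_mul_sg, one_mul]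

/-- As the side carries only one periodic point, only one base is removed. What remains together
with the retained rays splits into the two arms around `x`, an arm being absent when `x` is the
corner at its end. -/
theorem mem_rim_periodic (S : D.SideModel s) (h1 : 1 < lam) (hx : x ∈ D.periodic s) {q : Pt n} :
    q ∈ I.rim s x.1 ↔ ∃ b, I.OnArm s x b q := by
  have h : 0 < lam := one_pos.trans h1
  constructor
  · rintro (⟨hq, hnb⟩ | ⟨y, hy, hyx, b, hb, hq⟩)
    · obtain ⟨hq1, hq2, hq3⟩ := D.mem_edge.mp hq
      have h3 := hnb x hx
      rw [I.mem_base S h hx] at h3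
      have h4 : s.co q < I.endCo s false x ∨ I.endCo s true x < s.co q := by
        by_contra! hc
        exact h3 ⟨hq1, hq2, hc.1, hc.2⟩
      have r1 := I.reach_nonneg S h hx false
      have r2 := I.reach_nonneg S h hx true
      rcases h4 with h4 | h4
      · refine ⟨false, hq1, ?_, Or.inl ⟨hq2, ?_⟩⟩ <;> simp only [gap_false, sg, endCo] at h4 ⊢ <;>
          norm_num at h4 ⊢
        · linarith [hq3.1]
        · exact ⟨by linarith, hq3.1⟩
      · refine ⟨true, hq1, ?_, Or.inl ⟨hq2, ?_⟩⟩ <;> simp only [gap_true, sg, endCo] at h4 ⊢ <;>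
          norm_num at h4 ⊢
        · linarith [hq3.2]
        · exact ⟨by linarith, hq3.2⟩
    · obtain rfl := S.periodic_unique h1 hy hx hyx
      rw [I.isOuter_iff S h1 hy, not_not] at hb
      obtain ⟨h2, h3, h4⟩ := (I.mem_ray S h hy).mp hq
      exact ⟨b, h2, hb, Or.inr ⟨by rw [h3, sg_mul_endCo], h4⟩⟩
  · rintro ⟨b, hq1, hb, ⟨h2, h3, h4⟩ | ⟨h2, h3⟩⟩
    · left
      have r1 := I.reach_nonneg S h hx false
      have r2 := I.reach_nonneg S h hx true
      have hxs := (S.periodic_side h hx).2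
      refine ⟨D.mem_edge.mpr ⟨hq1, h2, ?_⟩, fun y hy hqy => ?_⟩
      · cases b <;> simp only [gap_false, gap_true, sg] at h3 h4 <;> norm_num at h3 h4
        · exact ⟨by linarith, by linarith [hxs.2]⟩
        · exact ⟨by linarith [hxs.1], by linarith⟩
      · obtain ⟨h5, -, h6⟩ := (I.mem_base S h hy).mp hqy
        obtain rfl := S.periodic_unique h1 hy hx (h5.symm.trans hq1)
        have h7 := h6.1
        have h8 := h6.2
        simp only [endCo] at h7 h8
        cases b <;> simp only [sg] at h3 h7 h8 <;> norm_num at h3 h7 h8 <;> linarith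
    · right
      refine ⟨x, hx, rfl, b, by rw [I.isOuter_iff S h1 hx, not_not]; exact hb, ?_⟩
      rw [I.mem_ray S h hx]
      refine ⟨hq1, ?_, h3⟩
      rw [endCo, ← h2, ← mul_assoc, sg_mul_sg]
      ring

theorem mem_rim_of_not_periodic (S : D.SideModel s) (h : 0 < lam) {k : Fin (n + 1)}
    (hk : ∀ x ∈ D.periodic s, x.1 ≠ k) {q : Pt n} :
    q ∈ I.rim s k ↔ q.1 = k ∧ D.ht s q = 0 ∧ s.co q ∈ Set.Icc 0 (D.len s k) := by
  constructor
  · rintro (⟨hq, -⟩ | ⟨y, hy, hyx, -⟩)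
    · exact D.mem_edge.mp hq
    · exact absurd hyx (hk y hy)
  · intro hq
    refine Or.inl ⟨D.mem_edge.mpr hq, fun x hx hqx => ?_⟩
    exact hk x hx (((I.mem_base S h hx).mp hqx).1.symm.trans hq.1)

theorem rim_fst_ht (S : D.SideModel s) (h1 : 1 < lam) {k : Fin (n + 1)} {q : Pt n}
    (hq : q ∈ I.rim s k) : q.1 = k ∧ 0 ≤ D.ht s q := by
  by_cases hk : ∃ x ∈ D.periodic s, x.1 = k
  · obtain ⟨x, hx, rfl⟩ := hk
    obtain ⟨b, hb⟩ := (I.mem_rim_periodic S h1 hx).mp hq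
    exact ⟨hb.1, hb.ht_nonneg I⟩
  · push Not at hk
    have := (I.mem_rim_of_not_periodic S (one_pos.trans h1) hk).mp hq
    exact ⟨this.1, this.2.1.ge⟩

/-- The sign of `ht` separates the edges inside a rectangle from its extended sides. -/
theorem mem_seam (S : D.SideModel s) (h1 : 1 < lam) {q : Pt n} :
    q ∈ I.seam s ↔ (q ∈ D.edges s ∧ D.ht s q < 0) ∨ q ∈ I.rim s q.1 := by
  constructor
  · rintro (⟨hq, hn⟩ | hq)
    · left
      refine ⟨hq, lt_of_le_of_ne (S.ht_nonpos_of_mem_edges hq) fun h0 => hn ?_⟩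
      exact Set.mem_iUnion.mpr ⟨q.1, D.mem_edge.mpr ⟨rfl, h0, S.co_mem_of_mem_edges hq⟩⟩
    · right
      obtain ⟨k, hk⟩ := Set.mem_iUnion.mp hq
      rwa [(I.rim_fst_ht S h1 hk).1]
  · rintro (⟨hq, hn⟩ | hq)
    · left
      refine ⟨hq, fun hc => ?_⟩
      obtain ⟨k, hk⟩ := Set.mem_iUnion.mp hc
      exact hn.ne (D.mem_edge.mp hk).2.1
    · exact Or.inr (Set.mem_iUnion.mpr ⟨q.1, hq⟩)

/-- At a shift step the number of iterates is smaller by one period than `depth s x`, and otherwise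
equal to it; both lead from the root to `x`. -/
theorem iterate_depth_pred (S : D.SideModel s) (h : 0 < lam) (hx : x ∈ D.periodic s) :
    (D.edgeMap s)^[I.depth s (D.edgeMap s x) - 1] (I.root s x) = x := by
  obtain ⟨h2, h3, h4, h5⟩ := I.depth_spec hx
  rcases I.depth_edgeMap h S hx with ⟨-, h6⟩ | ⟨-, h6⟩
  · have h7 : I.depth s x = (I.depth s (D.edgeMap s x) - 1) + D.period s (I.root s x) := by omega
    rw [h7, Function.iterate_add_apply, iterate_period] at h3
    exact h3
  · rw [h6]; exact h3

theorem reach_edgeMap (S : D.SideModel s) (h : 0 < lam) (hx : x ∈ D.periodic s) (b : Bool) :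
    I.reach s b (D.edgeMap s x) =
      lam⁻¹ * ((lam⁻¹) ^ (I.depth s (D.edgeMap s x) - 1) * D.gap s b (I.root s x)) := by
  have h5 := (I.depth_spec (S.edgeMap_mem_periodic h hx)).2.2.2
  rw [reach, I.root_edgeMap h S hx, ← mul_assoc, ← pow_succ', Nat.sub_add_cancel (by omega)]

/-- The base at the next point lies strictly inside the image of the side of `x`, because at least
one full period of contraction precedes the last step. -/
theorem reach_edgeMap_lt (S : D.SideModel s) (h1 : 1 < lam) (hx : x ∈ D.periodic s) {b : Bool}
    (hb : 0 < D.gap s b x) : I.reach s b (D.edgeMap s x) < lam⁻¹ * D.gap s b x := by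
  have h : 0 < lam := one_pos.trans h1
  obtain ⟨h2, h3, h4, h5⟩ := I.depth_spec hx
  rw [I.reach_edgeMap S h hx]
  refine mul_lt_mul_of_pos_left ?_ (inv_pos.mpr h)
  refine S.pow_mul_gap_lt h1 (I.subset s h2) (I.iterate_depth_pred S h hx) ?_
    ((I.root_gap_pos_iff S h hx b).mpr hb)
  have h6 := (I.depth_spec (S.edgeMap_mem_periodic h hx)).2.2.2
  have h7 : D.period s (D.edgeMap s x) = D.period s x := period_iterate hx 1
  omega

theorem _root_.PieceData.SideModel.edgeMap_periodic_eq (S : D.SideModel s) (h : 0 < lam)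
    (hx : x ∈ D.periodic s) : (D.edgeMap s x).1 = S.next x.1 ∧
      s.co (D.edgeMap s x) = S.shiftOff x.1 + lam⁻¹ * s.co x := by
  have h0 := (S.periodic_side h hx).1
  rw [D.eq_pt rfl rfl h0, S.edgeMap_side]
  simp

theorem gap_edgeMap_pos_iff (S : D.SideModel s) (h : 0 < lam) (hx : x ∈ D.periodic s) (b : Bool) :
    0 < D.gap s b (D.edgeMap s x) ↔ 0 < D.gap s b x :=
  (S.gap_pos_iff h hx (m := 1) rfl b).symm

/-- The image of a strip edge other than the side that is glued along the orbit avoids the bases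
of the infinite strips. -/
theorem off_notMem_base (S : D.SideModel s) (h1 : 1 < lam) (hx : x ∈ D.periodic s) {a : S.ι}
    (ha : S.tgt a = (D.edgeMap s x).1) (hne : a ≠ S.head x.1) {u : ℝ}
    (hu : u ∈ Set.Icc 0 (D.len s (S.src a))) :
    S.off a + lam⁻¹ * u ∉ Set.Icc (I.endCo s false (D.edgeMap s x))
      (I.endCo s true (D.edgeMap s x)) := by
  have h : 0 < lam := one_pos.trans h1
  have hl : 0 < lam⁻¹ := inv_pos.mpr h
  obtain ⟨e1, e2⟩ := S.edgeMap_periodic_eq h hx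
  have hg : ∀ b, ¬ 0 < D.gap s b x → D.gap s b x = 0 := fun b hb =>
    le_antisymm (not_lt.mp hb) (periodic_gap_nonneg S h hx b)
  have hFg : ∀ b, ¬ 0 < D.gap s b x → D.gap s b (D.edgeMap s x) = 0 := fun b hb =>
    le_antisymm (not_lt.mp (fun h2 => hb ((gap_edgeMap_pos_iff S h hx b).mp h2)))
      (periodic_gap_nonneg S h (S.edgeMap_mem_periodic h hx) b)
  have hu1 : lam⁻¹ * u ≤ lam⁻¹ * D.len s (S.src a) := mul_le_mul_of_nonneg_left hu.2 hl.le
  have hu0 : 0 ≤ lam⁻¹ * u := mul_nonneg hl.le hu.1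
  have hlen : 0 < lam⁻¹ * D.len s (S.src a) := mul_pos hl (D.len_pos s _)
  have hoff := S.off_nonneg a
  have hoff' := S.off_le a
  rintro ⟨i1, i2⟩
  have hd := S.disjoint a (S.head x.1) hne (ha.trans e1)
  rw [S.src_head] at hd
  change _ ≤ S.shiftOff x.1 ∨ S.shiftOff x.1 + _ ≤ _ at hd
  rw [endCo, e2] at i1 i2
  simp only [sg] at i1 i2
  norm_num at i1 i2
  -- The other image lies on one side of the image of the edge through `x`. If `x` has a positive
  -- gap there, the base ends strictly before the image of the edge does. If the gap is zero, the
  -- image of the edge already reaches the corner, leaving no room for a segment of positive length.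
  rcases hd with hd | hd
  · by_cases hb : 0 < D.gap s false x
    · have := I.reach_edgeMap_lt S h1 hx hb
      rw [gap_false] at this
      linarith
    · have g1 := hg false hb
      have g2 := hFg false hb
      rw [gap_false] at g1 g2
      rw [e2, g1] at g2
      linarith
  · by_cases hb : 0 < D.gap s true x
    · have := I.reach_edgeMap_lt S h1 hx hb
      rw [gap_true] at this
      linarith
    · have g1 := hg true hb
      have g2 := hFg true hb
      rw [gap_true] at g1 g2
      rw [e2, ← ha] at g2
      have : s.co x = D.len s x.1 := by linarith
      rw [this] at g2
      linarith

/-- Any base on the target side belongs to some periodic point `y`; `off_notMem_base` is applied at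
the periodic point preceding `y`. -/
theorem edgeMap_mem_rim (S : D.SideModel s) (h1 : 1 < lam) {a : S.ι}
    (hne : ∀ x ∈ D.periodic s, a ≠ S.head x.1) {u : ℝ} (hu : u ∈ Set.Icc 0 (D.len s (S.src a))) :
    D.pt s (S.tgt a) (S.off a + lam⁻¹ * u) 0 ∈ I.rim s (S.tgt a) := by
  have h : 0 < lam := one_pos.trans h1
  refine Or.inl ⟨D.mem_edge.mpr ⟨by simp, by simp, by simpa using S.off_add_mem h a hu⟩,
    fun y hy hq => ?_⟩
  obtain ⟨h2, -, h3⟩ := (I.mem_base S h hy).mp hq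
  have hp := period_pos hy
  have hFx : D.edgeMap s ((D.edgeMap s)^[D.period s y - 1] y) = y := by
    rw [← Function.iterate_succ_apply' (D.edgeMap s), Nat.succ_eq_add_one, Nat.sub_add_cancel hp]
    exact iterate_period y
  have hx := S.iterate_mem_periodic h hy (D.period s y - 1)
  have h4 := I.off_notMem_base S h1 hx (a := a) (by rw [hFx, ← h2, pt_fst]) (hne _ hx) hu
  rw [hFx] at h4
  rw [co_pt] at h3
  exact h4 h3

end

end InitialPoints

/-! ### Construction of extended edge maps. -/

namespace InitialPoints

open PieceData SideModel

variable {n : ℕ} {M : Matrix (Fin (n + 1)) (Fin (n + 1)) ℕ} {lam : ℝ} {D : PieceData M lam}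
  (I : InitialPoints D) {s : Side} (S : D.SideModel s) {x : Pt n}

/-- The extended edge map at the step of a periodic orbit where the infinite strips are shifted, on
the side `b` of the strip: the part of the edge between the switch segment and the base of the
strip is pushed onto the boundary ray. -/
noncomputable def pushOut (s : Side) (x : Pt n) (b : Bool) (q : Pt n) : Pt n :=
  D.pt s (D.edgeMap s x).1
    (s.co (D.edgeMap s x) + sg b * max (I.reach s b (D.edgeMap s x))
      (lam⁻¹ * (sg b * (s.co q - s.co x))))
    -- The added height falls linearly from 1 at the end of the base at `x`, which gives the unit
    -- shift on the ray, to 0 at the end of the switch segment, at distance `lam * I.reach s b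
    -- (D.edgeMap s x)`.
    (D.ht s q + max 0 ((lam * I.reach s b (D.edgeMap s x) - sg b * (s.co q - s.co x)) /
      (lam * I.reach s b (D.edgeMap s x) - I.reach s b x)))

/-- The affine extension of an edge map along the strips. -/
noncomputable def slide (q : Pt n) : Pt n :=
  D.pt s (S.next q.1) (S.shiftOff q.1 + lam⁻¹ * s.co q) (D.ht s q)

open Classical in
/-- An extended edge map. -/
noncomputable def extMap (q : Pt n) : Pt n :=
  if D.ht s q < 0 then D.edgeMap s q
  else if h : ∃ x ∈ D.periodic s, x.1 = q.1 ∧ I.shift s x = 1 then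
    I.pushOut s h.choose (decide (0 < s.co q - s.co h.choose)) q
  else slide S q

theorem extMap_of_neg {q : Pt n} (hq : D.ht s q < 0) : I.extMap S q = D.edgeMap s q := if_pos hq

theorem sg_mul_pos_iff (b : Bool) (t : ℝ) (h : 0 < sg b * t) : decide (0 < t) = b := by
  cases b <;> simp only [sg] at h <;> norm_num at h
  · simpa using h.le
  · simpa using h

theorem extMap_of_shift (h1 : 1 < lam) (hx : x ∈ D.periodic s) (hs : I.shift s x = 1) {b : Bool}
    {q : Pt n} (hq1 : q.1 = x.1) (hq0 : 0 ≤ D.ht s q) (hq : 0 < sg b * (s.co q - s.co x)) :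
    I.extMap S q = I.pushOut s x b q := by
  have hex : ∃ x ∈ D.periodic s, x.1 = q.1 ∧ I.shift s x = 1 := ⟨x, hx, hq1.symm, hs⟩
  have he : hex.choose = x :=
    S.periodic_unique h1 hex.choose_spec.1 hx (hex.choose_spec.2.1.trans hq1)
  rw [extMap, if_neg hq0.not_gt, dif_pos hex, he, sg_mul_pos_iff b _ hq]

theorem extMap_of_not_shift {q : Pt n} (hq0 : 0 ≤ D.ht s q)
    (hn : ∀ x ∈ D.periodic s, x.1 = q.1 → I.shift s x ≠ 1) : I.extMap S q = slide S q := by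
  have hex : ¬ ∃ x ∈ D.periodic s, x.1 = q.1 ∧ I.shift s x = 1 := fun ⟨x, hx, h2, h3⟩ =>
    hn x hx h2 h3
  rw [extMap, if_neg hq0.not_gt, dif_neg hex]

theorem shift_ne_one (S : D.SideModel s) (h1 : 1 < lam) (hx : x ∈ D.periodic s)
    (hs : I.shift s x = 0) {k : Fin (n + 1)} (hk : k = x.1) :
    ∀ y ∈ D.periodic s, y.1 = k → I.shift s y ≠ 1 := by
  intro y hy hyx
  rw [S.periodic_unique h1 hy hx (hyx.trans hk), hs]
  exact zero_ne_one

/-- At a shift step the depth drops relative to the plain count by a full period, so the new base,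
pulled back by the edge map, strictly contains the old one. This leaves the segment that `pushOut`
moves onto the ray. -/
theorem reach_lt_lam_mul (S : D.SideModel s) (h1 : 1 < lam) (hx : x ∈ D.periodic s)
    (hs : I.shift s x = 1) {b : Bool} (hb : 0 < D.gap s b x) :
    I.reach s b x < lam * I.reach s b (D.edgeMap s x) := by
  have h : 0 < lam := one_pos.trans h1
  have hd : I.depth s (D.edgeMap s x) + D.period s x = I.depth s x + 1 := by
    rcases I.depth_edgeMap h S hx with ⟨-, h2⟩ | ⟨h2, -⟩
    · exact h2
    · rw [hs] at h2; exact absurd h2 one_ne_zero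
  have hp := period_pos hx
  have h6 := (I.depth_spec (S.edgeMap_mem_periodic h hx)).2.2.2
  rw [I.reach_edgeMap S h hx, mul_inv_cancel_left₀ h.ne', reach]
  refine mul_lt_mul_of_pos_right ?_ ((I.root_gap_pos_iff S h hx b).mpr hb)
  exact pow_lt_pow_right_of_lt_one₀ (inv_pos.mpr h) (inv_lt_one_of_one_lt₀ h1) (by omega)

/-- Away from the shift the edge map carries one base exactly onto the next, so the affine extension
respects the strips. -/
theorem reach_edgeMap_of_not_shift (S : D.SideModel s) (h : 0 < lam) (hx : x ∈ D.periodic s)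
    (hs : I.shift s x = 0) (b : Bool) :
    I.reach s b (D.edgeMap s x) = lam⁻¹ * I.reach s b x := by
  have hd : I.depth s (D.edgeMap s x) = I.depth s x + 1 := by
    rcases I.depth_edgeMap h S hx with ⟨h2, -⟩ | ⟨-, h2⟩
    · rw [hs] at h2; exact absurd h2 zero_ne_one
    · exact h2
  rw [I.reach_edgeMap S h hx, hd, Nat.add_sub_cancel, reach]

theorem gap_le_gap_edgeMap (S : D.SideModel s) (h : 0 < lam) (hx : x ∈ D.periodic s) (b : Bool) :
    lam⁻¹ * D.gap s b x ≤ D.gap s b (D.edgeMap s x) := by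
  have := S.pow_mul_gap_le h hx (m := 1) rfl b
  rwa [pow_one] at this

theorem OnArm.slide (S : D.SideModel s) (h : 0 < lam) (hx : x ∈ D.periodic s)
    (hs : I.shift s x = 0) {b : Bool} {q : Pt n} (hq : I.OnArm s x b q) :
    I.OnArm s (D.edgeMap s x) b (slide S q) := by
  obtain ⟨hq1, hb, hq2⟩ := hq
  have hl : 0 < lam⁻¹ := inv_pos.mpr h
  obtain ⟨e1, e2⟩ := S.edgeMap_periodic_eq h hx
  have e3 : sg b * (s.co (InitialPoints.slide S q) - s.co (D.edgeMap s x)) =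
      lam⁻¹ * (sg b * (s.co q - s.co x)) := by
    rw [InitialPoints.slide, co_pt, e2, hq1]; ring
  have e4 : D.ht s (InitialPoints.slide S q) = D.ht s q := by rw [InitialPoints.slide, ht_pt]
  have h5 := gap_le_gap_edgeMap S h hx b
  rw [OnArm, e3, e4, I.reach_edgeMap_of_not_shift S h hx hs]
  refine ⟨by rw [InitialPoints.slide, pt_fst, e1, hq1],
    (gap_edgeMap_pos_iff S h hx b).mpr hb, ?_⟩
  rcases hq2 with ⟨h2, h3, h4⟩ | ⟨h2, h3⟩
  · exact Or.inl ⟨h2, mul_lt_mul_of_pos_left h3 hl,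
      (mul_le_mul_of_nonneg_left h4 hl.le).trans h5⟩
  · exact Or.inr ⟨by rw [h2], h3⟩

theorem co_pushOut (b : Bool) (q : Pt n) :
    sg b * (s.co (I.pushOut s x b q) - s.co (D.edgeMap s x)) =
      max (I.reach s b (D.edgeMap s x)) (lam⁻¹ * (sg b * (s.co q - s.co x))) := by
  rw [pushOut, co_pt, add_sub_cancel_left, ← mul_assoc, sg_mul_sg, one_mul]

theorem ht_pushOut (b : Bool) (q : Pt n) : D.ht s (I.pushOut s x b q) =
    D.ht s q + max 0 ((lam * I.reach s b (D.edgeMap s x) - sg b * (s.co q - s.co x)) /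
      (lam * I.reach s b (D.edgeMap s x) - I.reach s b x)) := by
  rw [pushOut, ht_pt]

/-- Beyond the switch segment the image stays on the edge; within it, the position is clamped to the
end of the new base and the image lies on the ray. -/
theorem OnArm.pushOut (S : D.SideModel s) (h1 : 1 < lam) (hx : x ∈ D.periodic s)
    (hs : I.shift s x = 1) {b : Bool} {q : Pt n} (hq : I.OnArm s x b q) :
    I.OnArm s (D.edgeMap s x) b (I.pushOut s x b q) := by
  have h : 0 < lam := one_pos.trans h1
  have hl : 0 < lam⁻¹ := inv_pos.mpr h
  have hr := I.reach_lt_lam_mul S h1 hx hs hq.2.1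
  have hht := hq.ht_nonneg I
  obtain ⟨hq1, hb, hq2⟩ := hq
  have h5 := gap_le_gap_edgeMap S h hx b
  rw [OnArm, I.co_pushOut, I.ht_pushOut]
  set z := sg b * (s.co q - s.co x)
  set r := I.reach s b (D.edgeMap s x)
  refine ⟨by rw [InitialPoints.pushOut, pt_fst], (gap_edgeMap_pos_iff S h hx b).mpr hb, ?_⟩
  by_cases hz : lam * r < z
  · left
    have hz' : r < lam⁻¹ * z := by
      rw [lt_inv_mul_iff₀ h]; exact hz
    rcases hq2 with ⟨h2, h3, h4⟩ | ⟨h2, h3⟩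
    · refine ⟨?_, lt_max_of_lt_right hz', ?_⟩
      · rw [h2, max_eq_left, add_zero]
        exact div_nonpos_of_nonpos_of_nonneg (by linarith) (by linarith)
      · rw [max_eq_right hz'.le]
        exact (mul_le_mul_of_nonneg_left h4 hl.le).trans h5
    · linarith
  · right
    have hz' : lam⁻¹ * z ≤ r := by
      rw [inv_mul_le_iff₀ h]; exact not_lt.mp hz
    exact ⟨max_eq_left hz', add_nonneg hht (le_max_left _ _)⟩

/-- Beyond the switch segment the position along the side determines the point. Within it the height
does: points of the edge are raised by less than 1, points of the ray to at least 1. -/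
theorem OnArm.pushOut_inj (S : D.SideModel s) (h1 : 1 < lam) (hx : x ∈ D.periodic s)
    (hs : I.shift s x = 1) {b : Bool} {q q' : Pt n} (hq : I.OnArm s x b q)
    (hq' : I.OnArm s x b q') (he : I.pushOut s x b q = I.pushOut s x b q') : q = q' := by
  have h : 0 < lam := one_pos.trans h1
  have hl : 0 < lam⁻¹ := inv_pos.mpr h
  have hr := I.reach_lt_lam_mul S h1 hx hs hq.2.1
  have c1 := congrArg (fun q => sg b * (s.co q - s.co (D.edgeMap s x))) he
  have c2 := congrArg (D.ht s) he
  simp only [I.co_pushOut, I.ht_pushOut] at c1 c2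
  obtain ⟨hq1, hb, hq2⟩ := hq
  obtain ⟨hq1', -, hq2'⟩ := hq'
  have key : sg b * (s.co q - s.co x) = sg b * (s.co q' - s.co x) ∧ D.ht s q = D.ht s q' := by
    set z := sg b * (s.co q - s.co x)
    set z' := sg b * (s.co q' - s.co x)
    set r := I.reach s b (D.edgeMap s x)
    set r₀ := I.reach s b x
    have hd : 0 < lam * r - r₀ := by linarith
    have hfar : ∀ {v w : ℝ}, lam * r < v → max r (lam⁻¹ * v) = max r (lam⁻¹ * w) → v = w := by
      intro v w hv hvw
      have hv' : r < lam⁻¹ * v := by rw [lt_inv_mul_iff₀ h]; exact hv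
      rw [max_eq_right hv'.le] at hvw
      rcases le_total r (lam⁻¹ * w) with hw | hw
      · rw [max_eq_right hw] at hvw
        exact mul_left_cancel₀ hl.ne' hvw
      · rw [max_eq_left hw] at hvw; linarith
    by_cases hz : lam * r < z
    · have hzz := hfar hz c1
      refine ⟨hzz, ?_⟩
      rw [hzz] at c2
      linarith
    by_cases hz' : lam * r < z'
    · have hzz := hfar hz' c1.symm
      rw [hzz] at hz'
      exact absurd hz' hz
    rw [max_eq_right (div_nonneg (by linarith) hd.le),
      max_eq_right (div_nonneg (by linarith) hd.le)] at c2
    have hone : ∀ v : ℝ, r₀ < v → (lam * r - v) / (lam * r - r₀) < 1 := fun v hv => by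
      rw [div_lt_one hd]; linarith
    have hself : (lam * r - r₀) / (lam * r - r₀) = 1 := div_self hd.ne'
    rcases hq2 with ⟨h2, h3, h4⟩ | ⟨h2, h3⟩ <;> rcases hq2' with ⟨h2', h3', h4'⟩ | ⟨h2', h3'⟩
    · rw [h2, h2', zero_add, zero_add, div_left_inj' hd.ne'] at c2
      exact ⟨by linarith, by rw [h2, h2']⟩
    · have := hone z h3
      rw [h2, h2', hself] at c2
      linarith
    · have := hone z' h3'
      rw [h2, h2', hself] at c2
      linarith
    · rw [h2, h2'] at c2 ⊢
      exact ⟨rfl, by linarith⟩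
  have hco : s.co q = s.co q' := by
    have := congrArg (sg b * ·) key.1
    simp only [← mul_assoc, sg_mul_sg, one_mul] at this
    linarith
  rw [D.eq_pt (hq1.trans hq1'.symm) hco key.2]
  exact (D.pt_co_ht s q')

theorem slide_side {q : Pt n} (h0 : D.ht s q = 0) : slide S q = D.edgeMap s q := by
  conv_rhs => rw [D.eq_pt rfl rfl h0, S.edgeMap_side]
  rw [slide, h0]

theorem slide_inj (h : 0 < lam) {q q' : Pt n} (hqq : q.1 = q'.1) (he : slide S q = slide S q') :
    q = q' := by
  have c1 := congrArg s.co he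
  have c2 := congrArg (D.ht s) he
  simp only [slide, co_pt, ht_pt, hqq] at c1 c2
  have hl : lam⁻¹ ≠ 0 := (inv_pos.mpr h).ne'
  rw [D.eq_pt hqq (mul_left_cancel₀ hl (add_left_cancel c1)) c2]
  exact D.pt_co_ht s q'

/-- The extended edge map carries the extended side of `Q_k` into that of the next rectangle. -/
theorem extMap_mem_rim (h1 : 1 < lam) {k : Fin (n + 1)} {q : Pt n} (hq : q ∈ I.rim s k) :
    I.extMap S q ∈ I.rim s (S.next k) := by
  have h : 0 < lam := one_pos.trans h1
  by_cases hk : ∃ x ∈ D.periodic s, x.1 = k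
  · obtain ⟨x, hx, rfl⟩ := hk
    obtain ⟨b, hb⟩ := (I.mem_rim_periodic S h1 hx).mp hq
    have hFx := S.edgeMap_mem_periodic h hx
    rw [← (S.edgeMap_periodic_eq h hx).1, I.mem_rim_periodic S h1 hFx]
    rcases I.depth_edgeMap h S hx with ⟨hs, -⟩ | ⟨hs, -⟩
    · rw [I.extMap_of_shift S h1 hx hs hb.1 (hb.ht_nonneg I) (hb.pos I S h hx)]
      exact ⟨b, hb.pushOut I S h1 hx hs⟩
    · rw [I.extMap_of_not_shift S (hb.ht_nonneg I) (I.shift_ne_one S h1 hx hs hb.1)]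
      exact ⟨b, hb.slide I S h hx hs⟩
  · push Not at hk
    obtain ⟨h2, h3, h4⟩ := (I.mem_rim_of_not_periodic S h hk).mp hq
    rw [I.extMap_of_not_shift S h3.ge (fun x hx hxq => absurd (hxq.trans h2) (hk x hx)),
      slide, h3, h2]
    have := I.edgeMap_mem_rim S h1 (a := S.head k)
      (fun x hx hc => hk x hx (by rw [← S.src_head x.1, ← hc, S.src_head]))
      (u := s.co q) (by rwa [S.src_head])
    exact this

theorem edgeMap_mem_rim_of_neg (S : D.SideModel s) (h1 : 1 < lam) {q : Pt n}
    (hq : q ∈ D.edges s) (h0 : D.ht s q < 0) :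
    D.edgeMap s q ∈ I.rim s (D.edgeMap s q).1 := by
  obtain ⟨a, u, hu, rfl⟩ := (S.mem_edges q).mp hq
  rw [S.edgeMap_pt, pt_fst]
  refine I.edgeMap_mem_rim S h1 (fun x hx hc => ?_) hu
  rw [ht_pt, hc, S.dep_head, neg_zero] at h0
  exact lt_irrefl _ h0

theorem extMap_mapsTo (h1 : 1 < lam) : Set.MapsTo (I.extMap S) (I.seam s) (I.seam s) := by
  intro q hq
  rcases (I.mem_seam S h1).mp hq with ⟨hq1, hq2⟩ | hq
  · rw [I.extMap_of_neg S hq2]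
    exact (I.mem_seam S h1).mpr (Or.inr (I.edgeMap_mem_rim_of_neg S h1 hq1 hq2))
  · exact Or.inr (Set.mem_iUnion.mpr ⟨_, I.extMap_mem_rim S h1 hq⟩)

theorem extMap_injOn (h1 : 1 < lam) (k : Fin (n + 1)) : Set.InjOn (I.extMap S) (I.rim s k) := by
  have h : 0 < lam := one_pos.trans h1
  intro q hq q' hq' he
  have f1 := I.rim_fst_ht S h1 hq
  have f2 := I.rim_fst_ht S h1 hq'
  by_cases hk : ∃ x ∈ D.periodic s, x.1 = k ∧ I.shift s x = 1
  · obtain ⟨x, hx, rfl, hs⟩ := hk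
    obtain ⟨b, hb⟩ := (I.mem_rim_periodic S h1 hx).mp hq
    obtain ⟨b', hb'⟩ := (I.mem_rim_periodic S h1 hx).mp hq'
    rw [I.extMap_of_shift S h1 hx hs hb.1 f1.2 (hb.pos I S h hx),
      I.extMap_of_shift S h1 hx hs hb'.1 f2.2 (hb'.pos I S h hx)] at he
    have hFx := S.edgeMap_mem_periodic h hx
    have p1 := (hb.pushOut I S h1 hx hs).pos I S h hFx
    have p2 := (hb'.pushOut I S h1 hx hs).pos I S h hFx
    rw [← he] at p2
    -- The images remain on arms `b` and `b'` and are equal, so the position relative to the image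
    -- periodic point forces the arms to agree.
    obtain rfl : b = b' := (sg_mul_pos_iff b _ p1).symm.trans (sg_mul_pos_iff b' _ p2)
    exact hb.pushOut_inj I S h1 hx hs hb' he
  · have hk' : ∀ y ∈ D.periodic s, y.1 = k → I.shift s y ≠ 1 := fun y hy h2 h3 =>
      hk ⟨y, hy, h2, h3⟩
    rw [I.extMap_of_not_shift S f1.2 (by rw [f1.1]; exact hk'),
      I.extMap_of_not_shift S f2.2 (by rw [f2.1]; exact hk')] at he
    exact slide_inj S h (f1.1.trans f2.1.symm) he

/-- The segment where `pushOut` differs from the edge map is the image of the side of the root under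
`depth - 1` iterates, with the depth taken at the next point. At a shift step this exponent is the
one in the definition of the switch set, `period + stage` forwards and `period` at an initial point
backwards. -/
theorem mem_switch_of_le (S : D.SideModel s) (h1 : 1 < lam) (hx : x ∈ D.periodic s)
    (hs : I.shift s x = 1) {b : Bool} {q : Pt n} (hq1 : q.1 = x.1) (hq0 : D.ht s q = 0)
    (hp : 0 < sg b * (s.co q - s.co x))
    (hq : sg b * (s.co q - s.co x) ≤ lam * I.reach s b (D.edgeMap s x)) : q ∈ I.switch s := by
  have h : 0 < lam := one_pos.trans h1
  obtain ⟨h2, h3, h4, h5⟩ := I.depth_spec hx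
  have hd : I.depth s (D.edgeMap s x) + D.period s x = I.depth s x + 1 := by
    rcases I.depth_edgeMap h S hx with ⟨-, h2⟩ | ⟨h2, -⟩
    · exact h2
    · rw [hs] at h2; exact absurd h2 one_ne_zero
  have h6 := (I.depth_spec (S.edgeMap_mem_periodic h hx)).2.2.2
  have hpe : D.period s (D.edgeMap s x) = D.period s x := period_iterate hx 1
  have hpp := period_pos hx
  have hrm := I.iterate_depth_pred S h hx
  have hr0 := S.periodic_side h (I.subset s h2)
  have hmem : q ∈ (D.edgeMap s)^[I.depth s (D.edgeMap s x) - 1] '' D.edge s (I.root s x).1 := by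
    rw [S.mem_iterate_image_edge h hr0.1 hrm]
    refine ⟨hq1, hq0, ?_⟩
    have g := fun b => mul_nonneg (pow_pos (inv_pos.mpr h) (I.depth s (D.edgeMap s x) - 1)).le
      (periodic_gap_nonneg S h (I.subset s h2) b)
    have g1 := g false
    have g2 := g true
    rw [I.reach_edgeMap S h hx, mul_inv_cancel_left₀ h.ne'] at hq
    generalize (lam⁻¹) ^ (I.depth s (D.edgeMap s x) - 1) = w at hq g1 g2 ⊢
    cases b <;> simp only [sg] at hq hp <;> norm_num at hq hp
    · exact ⟨by linarith, by linarith⟩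
    · exact ⟨by linarith, by linarith⟩
  refine ⟨x, hx, ?_⟩
  rcases hf : s.forward with _ | _
  · right; left
    have hm : x ∈ I.pts s := by
      by_contra hm
      rw [shift, if_neg (by simp [hf]), if_neg hm] at hs
      exact zero_ne_one hs
    have hst : I.stage s x = 0 := I.stage_eq_backward hf hx hpp (by simpa using hm)
    have hrx : I.root s x = x := by
      rw [root, if_neg (by simp [hf]), hst]; rfl
    have hdx : I.depth s x = 2 * D.period s x := by rw [depth, if_neg (by simp [hf]), hst]; rfl
    have hde : I.depth s (D.edgeMap s x) - 1 = D.period s x := by omega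
    rw [hrx, hde] at hmem
    exact ⟨rfl, hm, hmem⟩
  · left
    have hdx : I.depth s x = 2 * D.period s x + I.stage s x := by rw [depth, if_pos hf]
    have hde : I.depth s (D.edgeMap s x) - 1 = D.period s x + I.stage s x := by omega
    rw [hde] at hmem
    exact ⟨rfl, hmem⟩

theorem extMap_eq_edgeMap (h1 : 1 < lam) {q : Pt n} (hq : q ∈ I.seam s ∩ D.edges s)
    (hsw : q ∉ I.switch s) : I.extMap S q = D.edgeMap s q := by
  have h : 0 < lam := one_pos.trans h1
  rcases (I.mem_seam S h1).mp hq.1 with ⟨-, h0⟩ | hr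
  · exact I.extMap_of_neg S h0
  have h0 : D.ht s q = 0 :=
    le_antisymm (S.ht_nonpos_of_mem_edges hq.2) (I.rim_fst_ht S h1 hr).2
  by_cases hk : ∃ x ∈ D.periodic s, x.1 = q.1 ∧ I.shift s x = 1
  · obtain ⟨x, hx, hxq, hs⟩ := hk
    rw [← hxq, I.mem_rim_periodic S h1 hx] at hr
    obtain ⟨b, hb⟩ := hr
    have hpos := hb.pos I S h hx
    have hlt : lam * I.reach s b (D.edgeMap s x) < sg b * (s.co q - s.co x) := by
      by_contra hc
      exact hsw (I.mem_switch_of_le S h1 hx hs hxq.symm h0 hpos (not_lt.mp hc))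
    have hlt' : I.reach s b (D.edgeMap s x) < lam⁻¹ * (sg b * (s.co q - s.co x)) := by
      rw [lt_inv_mul_iff₀ h]; exact hlt
    have hr := I.reach_lt_lam_mul S h1 hx hs hb.2.1
    obtain ⟨e1, e2⟩ := S.edgeMap_periodic_eq h hx
    rw [I.extMap_of_shift S h1 hx hs hb.1 h0.ge hpos]
    conv_rhs => rw [D.eq_pt rfl rfl h0, S.edgeMap_side]
    refine D.eq_pt ?_ ?_ ?_
    · rw [pushOut, pt_fst, e1, hxq]
    · rw [pushOut, co_pt, max_eq_right hlt'.le, e2, ← hxq]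
      have := sg_mul_sg b
      linear_combination lam⁻¹ * (s.co q - s.co x) * this
    · rw [pushOut, ht_pt, h0, max_eq_left, add_zero]
      exact div_nonpos_of_nonpos_of_nonneg (by linarith) (by linarith)
  · rw [I.extMap_of_not_shift S h0.ge fun x hx h2 h3 => hk ⟨x, hx, h2, h3⟩]
    exact slide_side S h0

/-- On the ray the distance from `x` equals the reach, so the fraction added by `pushOut` is exactly
1; elsewhere bases go to bases and heights are kept. -/
theorem extMap_eq_shift (h1 : 1 < lam) (hx : x ∈ D.periodic s) {b : Bool}
    (hb : ¬ I.IsOuter s b x) {w : ℝ} (hw : 0 ≤ w) :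
    I.extMap S (push s w (I.baseEnd s b x)) =
      push s (w + I.shift s x) (I.baseEnd s b (D.edgeMap s x)) := by
  have h : 0 < lam := one_pos.trans h1
  have hFx := S.edgeMap_mem_periodic h hx
  rw [I.isOuter_iff S h1 hx, not_not] at hb
  rw [I.baseEnd_eq S h hx, I.baseEnd_eq S h hFx, D.push_pt, D.push_pt, zero_add, zero_add]
  have hz : sg b * (I.endCo s b x - s.co x) = I.reach s b x := I.sg_mul_endCo s b x
  obtain ⟨e1, e2⟩ := S.edgeMap_periodic_eq h hx
  rcases I.depth_edgeMap h S hx with ⟨hs, -⟩ | ⟨hs, -⟩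
  · have hr := I.reach_lt_lam_mul S h1 hx hs hb
    have hr' : lam⁻¹ * I.reach s b x ≤ I.reach s b (D.edgeMap s x) := by
      rw [inv_mul_le_iff₀ h]; exact hr.le
    rw [I.extMap_of_shift S h1 hx hs (b := b) (by simp) (by simpa using hw)
      (by rw [co_pt, hz]; exact I.reach_pos S h hx hb)]
    refine D.eq_pt ?_ ?_ ?_
    · rw [pushOut, pt_fst]
    · rw [pushOut, co_pt, co_pt, hz, max_eq_left hr', endCo]
    · rw [pushOut, ht_pt, co_pt, hz, ht_pt, div_self (by linarith), hs, max_eq_right zero_le_one]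
  · rw [I.extMap_of_not_shift S (by simpa using hw) (I.shift_ne_one S h1 hx hs (by simp))]
    refine D.eq_pt ?_ ?_ ?_
    · rw [slide, pt_fst, pt_fst, e1]
    · rw [slide, co_pt, co_pt, pt_fst, endCo, endCo, I.reach_edgeMap_of_not_shift S h hx hs, e2]
      ring
    · rw [slide, ht_pt, ht_pt, hs, add_zero]

theorem continuous_pushOut (b : Bool) : Continuous (I.pushOut s x b) := by
  refine (D.continuous_pt s (D.edgeMap s x).1).comp (Continuous.prodMk ?_ ?_)
  · have := s.continuous_co (n := n)
    fun_prop
  · have := s.continuous_co (n := n)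
    have := D.continuous_ht s
    fun_prop

/-- Locally one formula applies: edges inside a rectangle occur at finitely many depths, and the two
arms of an extended side are separated by the position of the periodic point. -/
theorem extMap_continuousOn (h1 : 1 < lam) : ContinuousOn (I.extMap S) (I.seam s) := by
  have h : 0 < lam := one_pos.trans h1
  have hco := s.continuous_co (n := n)
  have hht := D.continuous_ht s
  have hopen : ∀ k : Fin (n + 1), IsOpen {q : Pt n | q.1 = k} := fun k =>
    (isOpen_discrete {k}).preimage continuous_fst
  have hfin : Finite S.ι := S.finite
  intro q₀ hq₀
  have main : ∀ (U : Set (Pt n)) (g : Pt n → Pt n), IsOpen U → q₀ ∈ U → Continuous g →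
      (∀ q ∈ I.seam s, q ∈ U → I.extMap S q = g q) →
      ContinuousWithinAt (I.extMap S) (I.seam s) q₀ := by
    intro U g hU hqU hg heq
    refine (hg.continuousWithinAt (s := I.seam s)).congr_of_eventuallyEq ?_ (heq q₀ hq₀ hqU)
    filter_upwards [self_mem_nhdsWithin, mem_nhdsWithin_of_mem_nhds (hU.mem_nhds hqU)] with q h2 h3
    exact heq q h2 h3
  rcases (I.mem_seam S h1).mp hq₀ with ⟨hq1, hq2⟩ | hr
  · obtain ⟨a, u, hu, rfl⟩ := (S.mem_edges q₀).mp hq1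
    rw [ht_pt] at hq2
    -- The depths of all other edges; removing this finite set isolates the edge `a` within its
    -- rectangle.
    set T : Set ℝ := Set.range (fun a => -S.dep a) \ {-S.dep a} with hT
    have hTc : IsClosed T := ((Set.finite_range _).subset Set.sdiff_subset).isClosed
    refine main ({q | q.1 = S.src a} ∩ ({q | D.ht s q < 0} ∩ (D.ht s) ⁻¹' Tᶜ))
      (fun q => D.pt s (S.tgt a) (S.off a + lam⁻¹ * s.co q) 0) ?_ ?_ ?_ ?_
    · exact (hopen _).inter ((isOpen_lt hht continuous_const).inter
        (hTc.isOpen_compl.preimage hht))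
    · refine ⟨by simp, by simpa using hq2, ?_⟩
      simp [hT]
    · exact (D.continuous_pt s (S.tgt a)).comp (Continuous.prodMk (by fun_prop) continuous_const)
    · rintro q hqs ⟨hqa, hqn, hqT⟩
      rcases (I.mem_seam S h1).mp hqs with ⟨hqe, -⟩ | hqr
      · rw [I.extMap_of_neg S hqn]
        obtain ⟨a', u', hu', rfl⟩ := (S.mem_edges q).mp hqe
        simp only [Set.mem_preimage, ht_pt, hT, Set.mem_compl_iff, Set.mem_sdiff, Set.mem_range,
          exists_apply_eq_apply, true_and, Set.mem_singleton_iff, not_not] at hqT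
        have hsrc : S.src a' = S.src a := by
          have : (D.pt s (S.src a') u' (-S.dep a')).1 = S.src a := hqa
          rwa [pt_fst] at this
        obtain rfl : a' = a := S.dep_inj a' a hsrc (neg_injective hqT)
        rw [S.edgeMap_pt, co_pt]
      · exact absurd hqn (not_lt.mpr (I.rim_fst_ht S h1 hqr).2)
  · set T : Set ℝ := Set.range (fun a => -S.dep a) \ {0} with hT
    have hTc : IsClosed T := ((Set.finite_range _).subset Set.sdiff_subset).isClosed
    have hge := (I.rim_fst_ht S h1 hr).2
    have hV : IsOpen ({q : Pt n | q.1 = q₀.1} ∩ (D.ht s) ⁻¹' Tᶜ) :=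
      (hopen _).inter (hTc.isOpen_compl.preimage hht)
    have hqV : q₀ ∈ {q : Pt n | q.1 = q₀.1} ∩ (D.ht s) ⁻¹' Tᶜ := by
      refine ⟨rfl, ?_⟩
      rintro ⟨⟨a, ha⟩, hne⟩
      have := S.dep_nonneg a
      simp only at ha
      exact hne (by rw [Set.mem_singleton_iff]; linarith)
    have hrim : ∀ q ∈ I.seam s, q ∈ {q : Pt n | q.1 = q₀.1} ∩ (D.ht s) ⁻¹' Tᶜ →
        q ∈ I.rim s q₀.1 := by
      rintro q hqs ⟨hqk, hqT⟩
      rcases (I.mem_seam S h1).mp hqs with ⟨hqe, hqn⟩ | hqr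
      · exfalso
        apply hqT
        obtain ⟨a', u', hu', rfl⟩ := (S.mem_edges q).mp hqe
        rw [ht_pt] at hqn ⊢
        exact ⟨⟨a', rfl⟩, fun h0 => hqn.ne h0⟩
      · have hqk' : q.1 = q₀.1 := hqk
        rwa [hqk'] at hqr
    by_cases hk : ∃ x ∈ D.periodic s, x.1 = q₀.1 ∧ I.shift s x = 1
    · obtain ⟨x, hx, hxq, hs⟩ := hk
      rw [← hxq, I.mem_rim_periodic S h1 hx] at hr
      obtain ⟨b, hb⟩ := hr
      refine main (({q : Pt n | q.1 = q₀.1} ∩ (D.ht s) ⁻¹' Tᶜ) ∩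
        {q | 0 < sg b * (s.co q - s.co x)}) (I.pushOut s x b)
        (hV.inter (isOpen_lt continuous_const (by fun_prop))) ⟨hqV, hb.pos I S h hx⟩
        (I.continuous_pushOut b) ?_
      rintro q hqs ⟨hqU, hqp⟩
      have hqr := hrim q hqs hqU
      exact I.extMap_of_shift S h1 hx hs ((I.rim_fst_ht S h1 hqr).1.trans hxq.symm)
        (I.rim_fst_ht S h1 hqr).2 hqp
    · refine main _ (fun q => D.pt s (S.next q₀.1) (S.shiftOff q₀.1 + lam⁻¹ * s.co q) (D.ht s q))
        hV hqV ((D.continuous_pt s _).comp (Continuous.prodMk (by fun_prop) hht)) ?_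
      intro q hqs hqU
      have hqr := I.rim_fst_ht S h1 (hrim q hqs hqU)
      rw [I.extMap_of_not_shift S hqr.2, slide, hqr.1]
      rw [hqr.1]
      exact fun x hx h2 h3 => hk ⟨x, hx, h2, h3⟩

theorem nonempty_extendedEdgeMaps (h1 : 1 < lam) : Nonempty (ExtendedEdgeMaps I) := by
  have S : ∀ s, D.SideModel s := fun s =>
    Classical.choice (D.nonempty_sideModel (one_pos.trans h1) s)
  exact ⟨{
    map := fun s => I.extMap (S s)
    mapsTo := fun s => I.extMap_mapsTo (S s) h1
    continuousOn := fun s => I.extMap_continuousOn (S s) h1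
    injOn := fun s k => I.extMap_injOn (S s) h1 k
    eq_edgeMap := fun s q hq hsw => I.extMap_eq_edgeMap (S s) h1 hq hsw
    eq_shift := fun s x hx b hb w hw _ => I.extMap_eq_shift (S s) h1 hx hb hw }⟩

end InitialPoints

/-! ### Existence of compatible initial points. -/

namespace PieceData

variable {n : ℕ} {M : Matrix (Fin (n + 1)) (Fin (n + 1)) ℕ} {lam : ℝ} (D : PieceData M lam)

/-- At a corner, the strip used by the forward edge map has as image the horizontal strip used by
the backward one, so the two affine branches are inverse to each other. -/
theorem edgeMap_edgeMap_corner (h : 0 < lam) {s t : Side} (hs : s.forward = true)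
    (ht : t.forward = false) {y : Pt n} (h1 : D.ht s y = 0) (h2 : D.ht t y = 0) :
    D.edgeMap t (D.edgeMap s y) = y := by
  have key : ∀ a, D.edgeMap s y = D.branch y.1 a y.2 → D.edgeMap t (D.edgeMap s y) = y := by
    intro a ha
    rw [ha]
    cases t
    · simp [Side.forward] at ht
    · simp [Side.forward] at ht
    · have him : y.2.im = D.η y.1 := by simp only [PieceData.ht] at h2; linarith
      rw [D.edgeMap_top h (t := D.image y.1 a)]
      · exact D.branchInv_branch h y.1 a y.2
      · change D.hBot (D.target y.1 a) (D.image y.1 a) + lam⁻¹ * y.2.im = _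
        rw [him, D.hBot_add_image]
        rfl
    · have him : y.2.im = 0 := by simp only [PieceData.ht] at h2; linarith
      rw [D.edgeMap_bottom h (t := D.image y.1 a)]
      · exact D.branchInv_branch h y.1 a y.2
      · change D.hBot (D.target y.1 a) (D.image y.1 a) + lam⁻¹ * y.2.im = _
        rw [him, mul_zero, add_zero]
        rfl
  cases s
  · obtain ⟨a, ha⟩ := D.exists_vLeft_eq_zero h y.1
    refine key a (D.edgeMap_left h ?_)
    simp only [PieceData.ht] at h1
    rw [ha]; linarith
  · obtain ⟨a, ha⟩ := D.exists_vRight_eq h y.1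
    refine key a (D.edgeMap_right h ?_)
    simp only [PieceData.ht] at h1
    rw [ha]; linarith
  · simp [Side.forward] at hs
  · simp [Side.forward] at hs

/-- The forward orbit of a point under an edge map. -/
def orbit (s : Side) (x : Pt n) : Set (Pt n) := {y | ∃ j : ℕ, (D.edgeMap s)^[j] x = y}

theorem orbit_iterate {s : Side} {x : Pt n} (hx : x ∈ D.periodic s) (j : ℕ) :
    D.orbit s ((D.edgeMap s)^[j] x) = D.orbit s x := by
  ext y
  constructor
  · rintro ⟨i, rfl⟩
    exact ⟨i + j, Function.iterate_add_apply _ _ _ _⟩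
  · rintro ⟨i, rfl⟩
    obtain ⟨m, hm⟩ := SideModel.exists_iterate_eq hx (m := j) rfl
    exact ⟨i + m, by rw [Function.iterate_add_apply, hm]⟩

/-- A corner orbit of a forward edge map consists of corners of the same kind, since vanishing of
the gap persists along periodic orbits. There the backward map retraces it, so the two orbits are
the same set. -/
theorem orbit_eq_of_forward (h : 0 < lam) {s t : Side} (hs : s.forward = true)
    (ht : t.forward = false) {x : Pt n} (hxs : x ∈ D.periodic s) (hxt : x ∈ D.periodic t) :
    D.orbit s x = D.orbit t x := by
  obtain ⟨S⟩ := D.nonempty_sideModel h s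
  obtain ⟨T⟩ := D.nonempty_sideModel h t
  have h0s := S.periodic_side h hxs
  have h0t := T.periodic_side h hxt
  obtain ⟨b, hb⟩ : ∃ b, ∀ y : Pt n, D.ht s y = 0 → (D.ht t y = 0 ↔ D.gap s b y = 0) := by
    cases s <;> cases t <;> simp only [Side.forward, reduceCtorEq] at hs ht
    · exact ⟨true, fun y _ => by
        simp only [gap_true, PieceData.ht, len, Side.co]; constructor <;> intro h <;> linarith⟩
    · exact ⟨false, fun y _ => by
        simp only [gap_false, PieceData.ht, Side.co]; constructor <;> intro h <;> linarith⟩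
    · exact ⟨true, fun y _ => by
        simp only [gap_true, PieceData.ht, len, Side.co]; constructor <;> intro h <;> linarith⟩
    · exact ⟨false, fun y _ => by
        simp only [gap_false, PieceData.ht, Side.co]; constructor <;> intro h <;> linarith⟩
  have hcorner : ∀ m : ℕ, D.ht t ((D.edgeMap s)^[m] x) = 0 := by
    intro m
    have hm := S.iterate_mem_periodic h hxs m
    have hm0 := S.periodic_side h hm
    rw [hb _ hm0.1]
    refine le_antisymm (not_lt.mp fun hc => ?_) (gap_nonneg hm0.2)
    rw [← S.gap_pos_iff h hxs (m := m) rfl, (hb x h0s.1).mp h0t.1] at hc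
    exact lt_irrefl _ hc
  have hback : ∀ j m : ℕ, (D.edgeMap t)^[j] ((D.edgeMap s)^[j + m] x) = (D.edgeMap s)^[m] x := by
    intro j
    induction j with
    | zero => intro m; simp
    | succ j ih =>
      intro m
      rw [Function.iterate_succ_apply, show j + 1 + m = (j + m) + 1 by ring,
        Function.iterate_succ_apply' (D.edgeMap s), D.edgeMap_edgeMap_corner h hs ht
          (S.iterate_side h0s.1 _).2 (hcorner _)]
      exact ih m
  have hp := SideModel.period_pos hxs
  have hmul : ∀ m : ℕ, (D.edgeMap s)^[D.period s x * m] x = x := fun m =>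
    (Function.isPeriodicPt_minimalPeriod (D.edgeMap s) x).mul_const m
  have hle : ∀ m : ℕ, m ≤ D.period s x * m := fun m => Nat.le_mul_of_pos_left m hp
  ext y
  constructor
  · rintro ⟨m, rfl⟩
    refine ⟨D.period s x * m - m, ?_⟩
    have := hback (D.period s x * m - m) m
    rwa [Nat.sub_add_cancel (hle m), hmul] at this
  · rintro ⟨m, rfl⟩
    refine ⟨D.period s x * m - m, ?_⟩
    have := hback m (D.period s x * m - m)
    rw [Nat.add_sub_cancel' (hle m), hmul] at this
    exact this.symm

/-- Opposite sides of a rectangle are disjoint, so two different edge maps share a periodic point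
only at a corner, where one map is forward and the other backward. -/
theorem orbit_eq (h : 0 < lam) {s t : Side} {x : Pt n} (hxs : x ∈ D.periodic s)
    (hxt : x ∈ D.periodic t) : D.orbit s x = D.orbit t x := by
  obtain ⟨S⟩ := D.nonempty_sideModel h s
  obtain ⟨T⟩ := D.nonempty_sideModel h t
  have h0s := (S.periodic_side h hxs).1
  have h0t := (T.periodic_side h hxt).1
  have hη := D.η_pos x.1
  have hω := D.ω_pos x.1
  cases s <;> cases t <;> first
    | rfl
    | exact D.orbit_eq_of_forward h rfl rfl hxs hxt
    | exact (D.orbit_eq_of_forward h rfl rfl hxt hxs).symm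
    | (simp only [PieceData.ht] at h0s h0t; exfalso; linarith)

-- The initial point is chosen as a function of the orbit as a set. This gives one point per orbit,
-- and compatibility holds because edge maps with a common periodic point have the same orbit there.
open Classical in
theorem nonempty_initialPoints (h : 0 < lam) : Nonempty (InitialPoints D) := by
  let pick : Set (Pt n) → Pt n := fun A => if hA : A.Nonempty then hA.some else (0, 0)
  have hpick : ∀ s x, pick (D.orbit s x) ∈ D.orbit s x := by
    intro s x
    have hne : (D.orbit s x).Nonempty := ⟨x, 0, rfl⟩
    simp only [pick, dif_pos hne]
    exact hne.some_mem
  refine ⟨{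
    pts := fun s => {x | x ∈ D.periodic s ∧ pick (D.orbit s x) = x}
    subset := fun s x hx => hx.1
    existsUnique := ?_
    compat := ?_ }⟩
  · intro s x hx
    obtain ⟨S⟩ := D.nonempty_sideModel h s
    obtain ⟨j, hj⟩ := hpick s x
    have ho := D.orbit_iterate hx j
    rw [hj] at ho
    refine ⟨pick (D.orbit s x), ⟨⟨hj ▸ S.iterate_mem_periodic h hx j, by rw [ho]⟩, ?_⟩, ?_⟩
    · exact SideModel.exists_iterate_eq hx hj
    · rintro y ⟨⟨hy, hy'⟩, i, rfl⟩
      rw [D.orbit_iterate hy]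
      exact hy'.symm
  · rintro s t x hxs hxt ⟨-, hx⟩
    exact ⟨hxt, by rw [← D.orbit_eq h hxs hxt]; exact hx⟩

end PieceData

/-! ### Permutations for which the corner is periodic. -/

theorem exists_not_before {n : ℕ} {m : Fin (n + 1) → ℕ}
    [Nonempty ((i : Fin (n + 1)) × Fin (m i))] :
    ∃ a : (i : Fin (n + 1)) × Fin (m i), ∀ b, ¬ Before b a := by
  obtain ⟨a, -, ha⟩ := wellFounded_before.has_min (Set.univ : Set ((i : Fin (n + 1)) × Fin (m i)))
    Set.univ_nonempty
  exact ⟨a, fun b => ha b (Set.mem_univ b)⟩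

/-- In a primitive matrix there is a choice of successors leading from every index to `0`. -/
theorem IsPrimitiveWithRadius.exists_successor {n : ℕ}
    {M : Matrix (Fin (n + 1)) (Fin (n + 1)) ℕ} {lam : ℝ} (hM : IsPrimitiveWithRadius M lam) :
    ∃ nxt : Fin (n + 1) → Fin (n + 1), (∀ k, 0 < M (nxt k) k) ∧ 0 ∈ Function.periodicPts nxt := by
  classical
  obtain ⟨⟨N, hN0, hN⟩, -⟩ := hM
  have hex : ∀ k, ∃ m, 0 < (M ^ m) 0 k := fun k => ⟨N, hN 0 k⟩
  have hstep : ∀ m k, 0 < (M ^ (m + 1)) 0 k → ∃ i, 0 < (M ^ m) 0 i ∧ 0 < M i k := by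
    intro m k hmk
    rw [pow_succ, Matrix.mul_apply] at hmk
    obtain ⟨i, -, hi⟩ := Finset.exists_ne_zero_of_sum_ne_zero hmk.ne'
    exact ⟨i, Nat.pos_of_ne_zero (left_ne_zero_of_mul hi),
      Nat.pos_of_ne_zero (right_ne_zero_of_mul hi)⟩
  -- The successor reduces the least exponent `m` with `(M ^ m) 0 k` positive, so iteration reaches
  -- `0`; at `0` itself any successor will do.
  have hch : ∀ k, ∃ i, 0 < M i k ∧ (k ≠ 0 → Nat.find (hex i) < Nat.find (hex k)) := by
    intro k
    by_cases hk : k = 0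
    · obtain ⟨N', rfl⟩ := Nat.exists_eq_succ_of_ne_zero hN0.ne'
      obtain ⟨i, -, hi⟩ := hstep N' k (hN 0 k)
      exact ⟨i, hi, fun h => absurd hk h⟩
    · have hs := Nat.find_spec (hex k)
      obtain ⟨m, hm⟩ : ∃ m, Nat.find (hex k) = m + 1 := by
        refine Nat.exists_eq_succ_of_ne_zero fun h0 => ?_
        rw [h0, pow_zero, Matrix.one_apply_ne (Ne.symm hk)] at hs
        exact lt_irrefl _ hs
      rw [hm] at hs ⊢
      obtain ⟨i, hi, hik⟩ := hstep m k hs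
      exact ⟨i, hik, fun _ => Nat.lt_succ_of_le (Nat.find_le hi)⟩
  choose nxt h1 h2 using hch
  have hreach : ∀ d k, Nat.find (hex k) = d → ∃ j, nxt^[j] k = 0 := by
    intro d
    induction d using Nat.strong_induction_on with
    | _ d ih =>
      intro k hk
      by_cases h0 : k = 0
      · exact ⟨0, h0⟩
      · obtain ⟨j, hj⟩ := ih _ (hk ▸ h2 k h0) (nxt k) rfl
        exact ⟨j + 1, hj⟩
  obtain ⟨j, hj⟩ := hreach _ (nxt 0) rfl
  exact ⟨nxt, h1, j + 1, Nat.succ_pos j, hj⟩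

open Classical in
/-- For every primitive matrix the permutations can be chosen so that the top left corner of the
first rectangle is periodic. -/
theorem IsPrimitiveWithRadius.exists_cornerPeriodic {n : ℕ}
    {M : Matrix (Fin (n + 1)) (Fin (n + 1)) ℕ} {lam : ℝ} (hM : IsPrimitiveWithRadius M lam)
    (h : 0 < lam) : ∃ D : PieceData M lam, D.CornerPeriodic := by
  obtain ⟨η, ω, hη, hω, hηe, hωe⟩ := hM.exists_eigenvectors h
  obtain ⟨nxt, hnxt, hper⟩ := hM.exists_successor
  let D₀ : PieceData M lam :=
    { η := η, ω := ω, η_pos := hη, ω_pos := hω, η_eigen := hηe, ω_eigen := hωe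
      σ := fun _ => Equiv.refl _, τ := fun _ => Equiv.refl _ }
  have hv : ∀ k, ∃ a : (i : Fin (n + 1)) × Fin (M i k), ∀ b, ¬ Before b a := fun k => by
    have := D₀.nonempty_vStrips h k
    exact exists_not_before
  have hh : ∀ i, ∃ a : (k : Fin (n + 1)) × Fin (M i k), ∀ b, ¬ Before b a := fun i => by
    have := D₀.nonempty_hStrips h i
    exact exists_not_before (m := fun k => M i k)
  choose fv hfv using hv
  choose fh hfh using hh
  -- Successors are injective on periodic indices, so the top strip of each rectangle is claimed by
  -- at most one of them.
  have hinj : ∀ k ∈ Function.periodicPts nxt, ∀ l ∈ Function.periodicPts nxt,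
      nxt k = nxt l → k = l := fun k hk l hl hkl => (Function.bijOn_periodicPts nxt).injOn hk hl hkl
  let σ : ∀ i, Equiv.Perm ((k : Fin (n + 1)) × Fin (M i k)) := fun i =>
    if hi : ∃ r : (k : Fin (n + 1)) × Fin (M i k), (r.2 : ℕ) = 0 ∧ r.1 ∈ Function.periodicPts nxt ∧
      nxt r.1 = i then Equiv.swap hi.choose (fh i) else Equiv.refl _
  let D : PieceData M lam :=
    { η := η, ω := ω, η_pos := hη, ω_pos := hω, η_eigen := hηe, ω_eigen := hωe
      -- The leftmost vertical strip of `Q_k` is labelled with the successor of `k`, and for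
      -- periodic `k` the corresponding horizontal strip is moved to the top of `Q_(nxt k)`. Thus
      -- the left edge map sends top left corner to top left corner.
      σ := σ, τ := fun k => Equiv.swap (fv k) ⟨nxt k, ⟨0, hnxt k⟩⟩ }
  have hσ : ∀ k ∈ Function.periodicPts nxt, σ (nxt k) ⟨k, ⟨0, hnxt k⟩⟩ = fh (nxt k) := by
    intro k hk
    have hi : ∃ r : (l : Fin (n + 1)) × Fin (M (nxt k) l), (r.2 : ℕ) = 0 ∧
        r.1 ∈ Function.periodicPts nxt ∧ nxt r.1 = nxt k := ⟨⟨k, ⟨0, hnxt k⟩⟩, rfl, hk, rfl⟩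
    have hr : hi.choose = ⟨k, ⟨0, hnxt k⟩⟩ := by
      have hsp := hi.choose_spec
      generalize hi.choose = r at hsp
      obtain ⟨l, j⟩ := r
      obtain ⟨e1, e2, e3⟩ := hsp
      obtain rfl : l = k := hinj l e2 k hk e3
      congr 1
      exact Fin.ext e1
    simp only [σ]
    rw [dif_pos hi, hr]
    exact Equiv.swap_apply_left _ _
  have himage : ∀ k ∈ Function.periodicPts nxt,
      D.imageSigma ⟨k, fv k⟩ = ⟨nxt k, fh (nxt k)⟩ := by
    intro k hk
    have e : D.τ k (fv k) = ⟨nxt k, ⟨0, hnxt k⟩⟩ := Equiv.swap_apply_left _ _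
    have e2 := congrArg (fun r : (i : Fin (n + 1)) × Fin (M i k) =>
      (⟨r.1, D.σ r.1 ⟨k, r.2⟩⟩ : (i : Fin (n + 1)) × ((l : Fin (n + 1)) × Fin (M i l)))) e
    refine Eq.trans e2 ?_
    exact congrArg (Sigma.mk (nxt k)) (hσ k hk)
  have hvl : ∀ k, D.vLeft k (fv k) = 0 := fun k =>
    Finset.sum_eq_zero fun b hb => absurd (Finset.mem_filter.mp hb).2 (hfv k b)
  have hht : ∀ i, D.hTop i (fh i) = D.η i := fun i => by
    unfold PieceData.hTop
    rw [Finset.sum_eq_zero fun b hb => absurd (Finset.mem_filter.mp hb).2 (hfh i b), sub_zero]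
  have hstep : ∀ k ∈ Function.periodicPts nxt,
      D.edgeMap Side.left (D.corner Side.left true k) = D.corner Side.left true (nxt k) := by
    intro k hk
    rw [D.edgeMap_left h (s := fv k) (by simp [PieceData.corner, hvl])]
    have e1 : D.target k (fv k) = nxt k := congrArg Sigma.fst (himage k hk)
    have e2 : D.hTop (D.target k (fv k)) (D.image k (fv k)) = D.η (nxt k) := by
      have := congrArg (fun x : (i : Fin (n + 1)) × ((l : Fin (n + 1)) × Fin (M i l)) =>
        D.hTop x.1 x.2) (himage k hk)
      exact this.trans (hht (nxt k))
    refine Prod.ext e1 (Complex.ext ?_ ?_)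
    · simp [PieceData.branch, PieceData.corner, hvl]
    · simp only [PieceData.branch, PieceData.corner, if_true]
      rw [D.hBot_add_image, e2]
  have hiter : ∀ j, (D.edgeMap Side.left)^[j] (D.corner Side.left true 0) =
      D.corner Side.left true (nxt^[j] 0) := by
    intro j
    induction j with
    | zero => rfl
    | succ j ih =>
      rw [Function.iterate_succ_apply', ih, hstep, Function.iterate_succ_apply']
      obtain ⟨p, hp, hpp⟩ := hper
      exact ⟨p, hp, hpp.apply_iterate j⟩
  refine ⟨D, ?_, ?_⟩
  · rw [D.corner_eq]
    obtain ⟨S⟩ := D.nonempty_sideModel h Side.left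
    exact S.pt_mem_edges (D.cor_mem _ _ _)
  · obtain ⟨p, hp, hpp⟩ := hper
    refine ⟨p, hp, ?_⟩
    have := hiter p
    rwa [hpp] at this

/-! ### Iterated images of a rectangle under the piece map. -/

namespace PieceData

variable {n : ℕ} {M : Matrix (Fin (n + 1)) (Fin (n + 1)) ℕ} {lam : ℝ} (D : PieceData M lam)

theorem exists_target_eq {i k : Fin (n + 1)} (h : 0 < M i k) : ∃ s, D.target k s = i :=
  ⟨(D.τ k).symm ⟨i, ⟨0, h⟩⟩, by rw [target, Equiv.apply_symm_apply]⟩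

theorem pos_of_target (k s) : 0 < M (D.target k s) k := Fin.pos (D.τ k s).2

theorem exists_of_pow_succ_pos {N : ℕ} {i k : Fin (n + 1)} (h : 0 < (M ^ (N + 1)) i k) :
    ∃ l, 0 < (M ^ N) i l ∧ 0 < M l k := by
  rw [pow_succ, Matrix.mul_apply] at h
  obtain ⟨l, -, hl⟩ := Finset.exists_ne_zero_of_sum_ne_zero h.ne'
  exact ⟨l, Nat.pos_of_ne_zero (left_ne_zero_of_mul hl),
    Nat.pos_of_ne_zero (right_ne_zero_of_mul hl)⟩

/-- An iterated image of a rectangle contains a strip of full width in every rectangle that it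
meets. -/
theorem exists_strip_subset_pieceImage (h : 0 < lam) (m : ℕ) (i : Fin (n + 1))
    (hi : 0 < (M ^ m) i 0) : ∃ a b : ℝ, 0 ≤ a ∧ a < b ∧ b ≤ D.η i ∧
      ∀ z : ℂ, z.re ∈ Set.Ioo 0 (D.ω i) → z.im ∈ Set.Ioo a b →
        (i, z) ∈ D.pieceImage^[m] (D.rect 0) := by
  induction m generalizing i with
  | zero =>
    have hi0 : i = 0 := by
      by_contra hne
      rw [pow_zero, Matrix.one_apply_ne hne] at hi
      exact lt_irrefl _ hi
    subst hi0
    exact ⟨0, D.η 0, le_rfl, D.η_pos 0, le_rfl, fun z h1 h2 =>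
      ⟨rfl, Set.Ioo_subset_Icc_self h1, Set.Ioo_subset_Icc_self h2⟩⟩
  | succ m ih =>
    rw [pow_succ', Matrix.mul_apply] at hi
    obtain ⟨k, -, hk⟩ := Finset.exists_ne_zero_of_sum_ne_zero hi.ne'
    obtain ⟨s, rfl⟩ := D.exists_target_eq (Nat.pos_of_ne_zero (left_ne_zero_of_mul hk))
    obtain ⟨a, b, ha, hab, hb, hsub⟩ := ih k (Nat.pos_of_ne_zero (right_ne_zero_of_mul hk))
    have hl : 0 < lam⁻¹ := inv_pos.mpr h
    set c := D.hBot (D.target k s) (D.image k s) with hc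
    have hc0 : 0 ≤ c := D.hBot_nonneg h _ _
    have hc1 : c + lam⁻¹ * D.η k ≤ D.η (D.target k s) := by
      rw [hc, D.hBot_add_image]; exact D.hTop_le h _ _
    have hb' : lam⁻¹ * b ≤ lam⁻¹ * D.η k := mul_le_mul_of_nonneg_left hb hl.le
    -- A full-width strip of `Q_k` crosses the whole vertical strip `s`, so its image has full width
    -- in the target, with vertical extent compressed by `lam⁻¹` and placed at the bottom `c` of the
    -- image strip.
    refine ⟨c + lam⁻¹ * a, c + lam⁻¹ * b, by positivity,
      by have := mul_lt_mul_of_pos_left hab hl; linarith, by linarith, fun z h1 h2 => ?_⟩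
    rw [Function.iterate_succ_apply']
    have hw := D.lam_mul_vWidth h k s
    have e1 : lam⁻¹ * D.ω (D.target k s) = D.vWidth k s := rfl
    have r1 : 0 < lam⁻¹ * z.re := mul_pos hl h1.1
    have r2 : lam⁻¹ * z.re < lam⁻¹ * D.ω (D.target k s) := mul_lt_mul_of_pos_left h1.2 hl
    have r3 : D.vRight k s = D.vLeft k s + D.vWidth k s := rfl
    have r4 := D.vLeft_nonneg h k s
    have r5 := D.vRight_le h k s
    have i1 : a < lam * (z.im - c) := by
      have := mul_lt_mul_of_pos_left (show lam⁻¹ * a < z.im - c by linarith [h2.1]) h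
      rwa [mul_inv_cancel_left₀ h.ne'] at this
    have i2 : lam * (z.im - c) < b := by
      have := mul_lt_mul_of_pos_left (show z.im - c < lam⁻¹ * b by linarith [h2.2]) h
      rwa [mul_inv_cancel_left₀ h.ne'] at this
    refine ⟨k, s, (k, ⟨D.vLeft k s + lam⁻¹ * z.re, lam * (z.im - c)⟩), ⟨?_, ?_⟩, ?_⟩
    · exact hsub _ ⟨by simp only; linarith, by simp only; linarith⟩ ⟨i1, i2⟩
    · exact ⟨rfl, ⟨by simp only; linarith, by simp only; linarith⟩,
        by simp only; linarith, by simp only; linarith⟩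
    · refine Prod.ext rfl (Complex.ext ?_ ?_)
      · simp only [branch]
        rw [add_sub_cancel_left, mul_inv_cancel_left₀ h.ne']
      · simp only [branch]
        rw [inv_mul_cancel_left₀ h.ne']
        ring

theorem exists_pieceImage_meets (hM : IsPrimitiveWithRadius M lam) (h : 0 < lam) :
    ∃ k : ℕ, 1 ≤ k ∧ ∀ i, (D.pieceImage^[k] (D.rect 0) ∩ D.rect i).Nonempty := by
  obtain ⟨⟨k, hk0, hk⟩, -⟩ := hM
  refine ⟨k, hk0, fun i => ?_⟩
  obtain ⟨a, b, ha, hab, hb, hsub⟩ := D.exists_strip_subset_pieceImage h k i (hk i 0)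
  have hω := D.ω_pos i
  refine ⟨(i, ⟨D.ω i / 2, (a + b) / 2⟩), hsub _ ?_ ?_, rfl, ?_, ?_⟩
  · exact ⟨by simp only; linarith, by simp only; linarith⟩
  · exact ⟨by simp only; linarith, by simp only; linarith⟩
  · exact ⟨by simp only; linarith, by simp only; linarith⟩
  · exact ⟨by simp only; linarith, by simp only; linarith⟩

end PieceData

/-! ### The switch set, and a parametrisation of the arms. -/

namespace InitialPoints

open PieceData SideModel

variable {n : ℕ} {M : Matrix (Fin (n + 1)) (Fin (n + 1)) ℕ} {lam : ℝ} {D : PieceData M lam}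
  (I : InitialPoints D) {s : Side} {x : Pt n}

theorem iterate_root_forward (hs : s.forward = true) (hx : x ∈ D.periodic s) :
    (D.edgeMap s)^[D.period s x + I.stage s x] (I.root s x) = x := by
  obtain ⟨-, h3, h4, -⟩ := I.depth_spec hx
  have h5 : I.depth s x = D.period s x + I.stage s x + D.period s (I.root s x) := by
    rw [h4, depth, if_pos hs]; omega
  rwa [h5, Function.iterate_add_apply, iterate_period] at h3

/-- The switch set lies in the extended sides with a periodic point, at bounded height. -/
theorem switch_bounds (S : D.SideModel s) (h : 0 < lam) {q : Pt n} (hq : q ∈ I.switch s) :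
    (∃ x ∈ D.periodic s, q.1 = x.1) ∧ 0 ≤ D.ht s q ∧ D.ht s q ≤ 1 := by
  obtain ⟨x, hx, ⟨hs, hq⟩ | ⟨-, -, hq⟩ | ⟨-, -, b, w, hw, rfl⟩⟩ := hq
  · have hr := S.periodic_side h (I.subset s (I.depth_spec hx).1)
    obtain ⟨h2, h3, -⟩ := (S.mem_iterate_image_edge h hr.1 (I.iterate_root_forward hs hx)).mp hq
    exact ⟨⟨x, hx, h2⟩, h3.ge, h3.le.trans zero_le_one⟩
  · obtain ⟨h2, h3, -⟩ := (S.mem_iterate_image_edge h (S.periodic_side h hx).1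
      (iterate_period x)).mp hq
    exact ⟨⟨x, hx, h2⟩, h3.ge, h3.le.trans zero_le_one⟩
  · rw [I.baseEnd_eq S h hx, D.push_pt, pt_fst, ht_pt, zero_add]
    exact ⟨⟨x, hx, rfl⟩, hw⟩

/-- The switch segment on a vertical side has at least one period of contraction, so it stops
strictly before an end that is not itself periodic. -/
theorem corner_notMem_switch (S : D.SideModel s) (h1 : 1 < lam) (hs : s.forward = true)
    (hx : x ∈ D.periodic s) {b : Bool} (hb : 0 < D.gap s b x) :
    D.corner s b x.1 ∉ I.switch s := by
  have h : 0 < lam := one_pos.trans h1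
  rintro ⟨y, hy, ⟨-, hq⟩ | ⟨hc, -⟩ | ⟨hc, -⟩⟩
  · obtain ⟨hr1, -, hr2, -⟩ := I.depth_spec hy
    have hm := I.iterate_root_forward hs hy
    have hr := I.subset s hr1
    obtain ⟨h2, -, h4⟩ := (S.mem_iterate_image_edge h (S.periodic_side h hr).1 hm).mp hq
    rw [D.corner_eq, pt_fst] at h2
    obtain rfl := S.periodic_unique h1 hx hy h2
    have h5 := S.pow_mul_gap_lt h1 hr hm (by rw [hr2]; omega)
      ((I.root_gap_pos_iff S h hx b).mpr hb)
    rw [D.corner_eq, co_pt, cor_eq] at h4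
    generalize (lam⁻¹) ^ (D.period s x + I.stage s x) = w at h4 h5
    cases b <;> simp only [sg] at h4 h5 <;> norm_num at h4 h5 <;> linarith [h4.1, h4.2]
  · rw [hs] at hc; exact Bool.noConfusion hc
  · rw [hs] at hc; exact Bool.noConfusion hc

/-- A parametrisation of the side `b` of the infinite strip at `x`: positive parameters lie on the
boundary ray, negative ones on the edge. -/
noncomputable def arm (s : Side) (x : Pt n) (b : Bool) (r : ℝ) : Pt n :=
  D.pt s x.1 (s.co x + sg b * (I.reach s b x + max 0 (-r))) (max 0 r)

theorem continuous_arm (b : Bool) : Continuous (I.arm s x b) := by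
  refine (D.continuous_pt s x.1).comp (Continuous.prodMk ?_ ?_) <;> fun_prop

theorem co_arm (b : Bool) (r : ℝ) :
    sg b * (s.co (I.arm s x b r) - s.co x) = I.reach s b x + max 0 (-r) := by
  rw [arm, co_pt, add_sub_cancel_left, ← mul_assoc, sg_mul_sg, one_mul]

theorem arm_injective (b : Bool) : Function.Injective (I.arm s x b) := by
  intro r r' h
  have h2 := congrArg (D.ht s) h
  have h3 := I.co_arm (s := s) (x := x) b r
  rw [h, I.co_arm] at h3
  simp only [arm, ht_pt] at h2
  rcases le_total 0 r with h4 | h4 <;> rcases le_total 0 r' with h5 | h5 <;>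
    simp [max_def] at h2 h3 <;> split_ifs at h2 h3 <;> linarith

/-- The lower bound on `r` is the parameter of the corner, and 0 is the parameter of the end of the
base. -/
theorem onArm_arm {b : Bool} (hb : 0 < D.gap s b x) {r : ℝ}
    (hr : I.reach s b x - D.gap s b x ≤ r) : I.OnArm s x b (I.arm s x b r) := by
  refine ⟨pt_fst _ _ _ _ _, hb, ?_⟩
  rw [I.co_arm, arm, ht_pt]
  rcases lt_or_ge r 0 with h | h
  · left
    rw [max_eq_left h.le, max_eq_right (by linarith)]
    exact ⟨rfl, by linarith, by linarith⟩
  · right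
    rw [max_eq_right h, max_eq_left (by linarith), add_zero]
    exact ⟨rfl, h⟩

theorem OnArm.exists_arm (S : D.SideModel s) (h1 : 1 < lam) (hx : x ∈ D.periodic s) {b : Bool}
    {q : Pt n} (hq : I.OnArm s x b q) :
    ∃ r, I.reach s b x - D.gap s b x ≤ r ∧ q = I.arm s x b r := by
  have hle := I.reach_le S h1 hx b
  obtain ⟨hq1, hb, h2⟩ := hq
  have hz : s.co q = s.co x + sg b * (sg b * (s.co q - s.co x)) := by
    rw [← mul_assoc, sg_mul_sg]; ring
  generalize sg b * (s.co q - s.co x) = z at h2 hz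
  -- On an arm either the height vanishes or the distance equals the reach, so this difference
  -- recovers both.
  refine ⟨D.ht s q - (z - I.reach s b x), ?_, D.eq_pt hq1 ?_ ?_⟩
  · rcases h2 with ⟨h2, h3, h4⟩ | ⟨h2, h3⟩ <;> rw [h2] <;> linarith
  · rw [hz]
    rcases h2 with ⟨h2, h3, h4⟩ | ⟨h2, h3⟩
    · rw [h2, max_eq_right (by linarith)]; ring
    · rw [h2, max_eq_left (by linarith)]; ring
  · rcases h2 with ⟨h2, h3, h4⟩ | ⟨h2, h3⟩
    · rw [h2, max_eq_left (by linarith)]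
    · rw [h2, max_eq_right (by linarith)]; ring

theorem rim_subset_seam (k) : I.rim s k ⊆ I.seam s :=
  fun _ hq => Or.inr (Set.mem_iUnion.mpr ⟨k, hq⟩)

theorem OnArm.mem_seam (S : D.SideModel s) (h1 : 1 < lam) (hx : x ∈ D.periodic s) {b : Bool}
    {q : Pt n} (hq : I.OnArm s x b q) : q ∈ I.seam s :=
  I.rim_subset_seam x.1 ((I.mem_rim_periodic S h1 hx).mpr ⟨b, hq⟩)

theorem OnArm.co_le (S : D.SideModel s) (h1 : 1 < lam) (hx : x ∈ D.periodic s) {b : Bool}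
    {q : Pt n} (hq : I.OnArm s x b q) : sg b * (s.co q - s.co x) ≤ D.gap s b x := by
  obtain ⟨-, hb, ⟨-, -, h⟩ | ⟨h, -⟩⟩ := hq
  · exact h
  · exact h.trans_le (I.reach_le S h1 hx b)

theorem rim_co (S : D.SideModel s) (h1 : 1 < lam) {k : Fin (n + 1)} {q : Pt n}
    (hq : q ∈ I.rim s k) : s.co q ∈ Set.Icc 0 (D.len s k) := by
  by_cases hk : ∃ x ∈ D.periodic s, x.1 = k
  · obtain ⟨x, hx, rfl⟩ := hk
    obtain ⟨b, hb⟩ := (I.mem_rim_periodic S h1 hx).mp hq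
    have h2 := hb.co_le I S h1 hx
    have h3 := hb.pos I S (one_pos.trans h1) hx
    have h4 := (S.periodic_side (one_pos.trans h1) hx).2
    cases b <;> simp only [gap_false, gap_true, sg] at h2 h3 <;> norm_num at h2 h3
    · exact ⟨by linarith, by linarith [h4.2]⟩
    · exact ⟨by linarith [h4.1], by linarith⟩
  · push Not at hk
    exact ((I.mem_rim_of_not_periodic S (one_pos.trans h1) hk).mp hq).2.2

end InitialPoints

/-! ### Arbitrary extended edge maps: action on the arms. -/

namespace ExtendedEdgeMaps

open PieceData SideModel InitialPoints

variable {n : ℕ} {M : Matrix (Fin (n + 1)) (Fin (n + 1)) ℕ} {lam : ℝ} {D : PieceData M lam}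
  {I : InitialPoints D} (E : ExtendedEdgeMaps I) {s : Side} {x : Pt n}

theorem map_of_neg (S : D.SideModel s) (h1 : 1 < lam) {q : Pt n} (hq : q ∈ D.edges s)
    (h0 : D.ht s q < 0) : E.map s q = D.edgeMap s q :=
  E.eq_edgeMap s q ⟨(I.mem_seam S h1).mpr (Or.inl ⟨hq, h0⟩), hq⟩ fun hc =>
    h0.not_ge (I.switch_bounds S (one_pos.trans h1) hc).2.1

/-- Above height 1 the ray is free of the switch set, so the map is the prescribed translation
there. This anchors the connectedness arguments for the unspecified part. -/
theorem map_arm (S : D.SideModel s) (h1 : 1 < lam) (hx : x ∈ D.periodic s) {b : Bool}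
    (hb : 0 < D.gap s b x) {r : ℝ} (hr : 1 < r) :
    E.map s (I.arm s x b r) = I.arm s (D.edgeMap s x) b (r + I.shift s x) := by
  have h : 0 < lam := one_pos.trans h1
  have hs : 0 ≤ I.shift s x := by
    rcases I.depth_edgeMap h S hx with ⟨h2, -⟩ | ⟨h2, -⟩ <;> rw [h2]; exact zero_le_one
  have h2 := E.eq_shift s x hx b (by rwa [I.isOuter_iff S h1 hx, not_not]) r (by linarith)
  have h3 : ∀ y ∈ D.periodic s, ∀ r, 0 ≤ r → I.arm s y b r = push s r (I.baseEnd s b y) := by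
    intro y hy r hr
    rw [I.baseEnd_eq S h hy, D.push_pt, arm, endCo, max_eq_right hr,
      max_eq_left (by linarith : -r ≤ 0)]
    simp
  rw [← h3 x hx r (by linarith), ← h3 _ (S.edgeMap_mem_periodic h hx) _ (by linarith)] at h2
  refine h2 fun hc => ?_
  have h4 := (I.switch_bounds S h hc).2.2
  rw [arm, ht_pt, max_eq_right (by linarith)] at h4
  linarith

/-- An extended edge map carries each side of an infinite strip to the same side of an infinite
strip. -/
theorem map_onArm (S : D.SideModel s) (h1 : 1 < lam) (hx : x ∈ D.periodic s) {b : Bool} {q : Pt n}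
    (hq : I.OnArm s x b q) : I.OnArm s (D.edgeMap s x) b (E.map s q) := by
  have h : 0 < lam := one_pos.trans h1
  have hFx := S.edgeMap_mem_periodic h hx
  have hb := hq.2.1
  have hb' : 0 < D.gap s b (D.edgeMap s x) := (gap_edgeMap_pos_iff S h hx b).mpr hb
  have hs : 0 ≤ I.shift s x := by
    rcases I.depth_edgeMap h S hx with ⟨h2, -⟩ | ⟨h2, -⟩ <;> rw [h2]; exact zero_le_one
  have harm : ∀ r, I.reach s b x - D.gap s b x ≤ r → I.arm s x b r ∈ I.seam s := fun r hr =>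
    (I.onArm_arm hb hr).mem_seam I S h1 hx
  obtain ⟨r₀, hr₀, rfl⟩ := hq.exists_arm I S h1 hx
  -- A parameter beyond the switch set, where the image is known to lie on arm `b`. The image of the
  -- path from `r₀` to `R` is connected, which controls the unknown part.
  set R := max r₀ 2 with hR
  have hR2 : 2 ≤ R := le_max_right _ _
  have hfar := E.map_arm S h1 hx hb (r := R) (by linarith)
  have hfarm : I.OnArm s (D.edgeMap s x) b (E.map s (I.arm s x b R)) := by
    rw [hfar]
    exact I.onArm_arm hb' (by linarith [I.reach_lt S h1 hFx hb'])
  have hcont : ContinuousOn (fun r => E.map s (I.arm s x b r)) (Set.Icc r₀ R) :=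
    (E.continuousOn s).comp (I.continuous_arm b).continuousOn fun r hr => harm r (hr₀.trans hr.1)
  have hfst : ∀ r ∈ Set.Icc r₀ R, (E.map s (I.arm s x b r)).1 = (D.edgeMap s x).1 := by
    intro r hr
    rw [← hfarm.1]
    exact isPreconnected_Icc.constant (continuous_fst.comp_continuousOn hcont) hr
      (Set.right_mem_Icc.mpr (le_max_left _ _))
  have hrim : ∀ r ∈ Set.Icc r₀ R, E.map s (I.arm s x b r) ∈ I.rim s (D.edgeMap s x).1 := by
    intro r hr
    have hseam := E.mapsTo s (harm r (hr₀.trans hr.1))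
    rw [← hfst r hr]
    refine ((I.mem_seam S h1).mp hseam).resolve_left fun hc => ?_
    have hneg := hc.2
    -- If the path started on an edge inside a rectangle, its height would sweep an interval of
    -- negative values, whereas the seam has only finitely many negative heights.
    have hsub : Set.Ioo (D.ht s (E.map s (I.arm s x b r))) 0 ⊆ Set.range fun a => -S.dep a := by
      intro v hv
      have hpos : 0 ≤ D.ht s (E.map s (I.arm s x b R)) := hfarm.ht_nonneg I
      obtain ⟨r', hr', rfl⟩ := intermediate_value_Icc hr.2
        ((D.continuous_ht s).comp_continuousOn (hcont.mono (Set.Icc_subset_Icc_left hr.1)))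
        ⟨hv.1.le, hv.2.le.trans hpos⟩
      have h5 := E.mapsTo s (harm r' (hr₀.trans (hr.1.trans hr'.1)))
      rcases (I.mem_seam S h1).mp h5 with ⟨h6, -⟩ | h6
      · obtain ⟨a, u, -, h7⟩ := (S.mem_edges _).mp h6
        refine ⟨a, ?_⟩
        rw [Function.comp_apply, h7, ht_pt]
      · exact absurd hv.2 (not_lt.mpr (I.rim_fst_ht S h1 h6).2)
    have hfin : Finite S.ι := S.finite
    exact Set.Ioo_infinite hneg ((Set.finite_range _).subset hsub)
  have hl : r₀ ∈ Set.Icc r₀ R := Set.left_mem_Icc.mpr (le_max_left _ _)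
  obtain ⟨c, hc⟩ := (I.mem_rim_periodic S h1 hFx).mp (hrim r₀ hl)
  have hcb : c = b := by
    -- To change arms the image would have to pass the position of the periodic point, over which
    -- the extended side has no point.
    have hp : 0 < sg b * (s.co (E.map s (I.arm s x b r₀)) - s.co (D.edgeMap s x)) := by
      by_contra hn
      obtain ⟨r, hr, h0⟩ := intermediate_value_Icc (le_max_left r₀ 2)
        ((((Side.continuous_co s).comp_continuousOn hcont).sub
          (continuousOn_const (c := s.co (D.edgeMap s x)))).const_mul (sg b))
        ⟨not_lt.mp hn, (hfarm.pos I S h hFx).le⟩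
      obtain ⟨d, hd⟩ := (I.mem_rim_periodic S h1 hFx).mp (hrim r hr)
      have h5 := hd.pos I S h hFx
      change sg b * (s.co (E.map s (I.arm s x b r)) - s.co (D.edgeMap s x)) = 0 at h0
      rcases mul_eq_zero.mp h0 with h0 | h0
      · cases b <;> norm_num [sg] at h0
      · rw [h0, mul_zero] at h5
        exact lt_irrefl _ h5
    exact (sg_mul_pos_iff c _ (hc.pos I S h hFx)).symm.trans (sg_mul_pos_iff b _ hp)
  exact hcb ▸ hc

theorem map_corner (S : D.SideModel s) (h1 : 1 < lam) (hs : s.forward = true)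
    (hx : x ∈ D.periodic s) {b : Bool} (hb : 0 < D.gap s b x) :
    E.map s (D.corner s b x.1) = D.pt s (D.edgeMap s x).1
      (s.co (D.edgeMap s x) + sg b * (lam⁻¹ * D.gap s b x)) 0 := by
  have h : 0 < lam := one_pos.trans h1
  have h2 := S.iterate_corner (x := D.edgeMap s x) (S.periodic_side h hx).1 (m := 1) rfl b
  rw [pow_one] at h2
  rw [← h2]
  refine E.eq_edgeMap s _ ⟨?_, ?_⟩ (I.corner_notMem_switch S h1 hs hx hb)
  · refine I.rim_subset_seam x.1 ((I.mem_rim_periodic S h1 hx).mpr ⟨b, ?_, hb, Or.inl ?_⟩)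
    · rw [D.corner_eq, pt_fst]
    · rw [D.corner_eq, ht_pt, co_pt, cor_eq, add_sub_cancel_left, ← mul_assoc, sg_mul_sg, one_mul]
      exact ⟨rfl, I.reach_lt S h1 hx hb, le_rfl⟩
  · rw [D.corner_eq]
    exact S.pt_mem_edges (cor_mem s b x.1)

/-- The extended edge maps of the left and right sides do not move a point of a side beyond the
image of the end of that side. -/
theorem map_co_le (S : D.SideModel s) (h1 : 1 < lam) (hs : s.forward = true)
    (hx : x ∈ D.periodic s) {b : Bool} {q : Pt n} (hq : I.OnArm s x b q) :
    sg b * (s.co (E.map s q) - s.co (D.edgeMap s x)) ≤ lam⁻¹ * D.gap s b x := by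
  by_contra! hlt
  have h : 0 < lam := one_pos.trans h1
  have hb := hq.2.1
  have hFx := S.edgeMap_mem_periodic h hx
  have hlt' := I.reach_edgeMap_lt S h1 hx hb
  have hsh : 0 ≤ I.shift s x := by
    rcases I.depth_edgeMap h S hx with ⟨h2, -⟩ | ⟨h2, -⟩ <;> rw [h2]; exact zero_le_one
  obtain ⟨r₀, hr₀, rfl⟩ := hq.exists_arm I S h1 hx
  have hR2 : 2 ≤ max r₀ 2 := le_max_right _ _
  have hcont : ContinuousOn (fun r => E.map s (I.arm s x b r)) (Set.Icc r₀ (max r₀ 2)) :=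
    (E.continuousOn s).comp (I.continuous_arm b).continuousOn fun r hr =>
      (I.onArm_arm hb (hr₀.trans hr.1)).mem_seam I S h1 hx
  have hR : sg b * (s.co (E.map s (I.arm s x b (max r₀ 2))) - s.co (D.edgeMap s x)) ≤
      lam⁻¹ * D.gap s b x := by
    rw [E.map_arm S h1 hx hb (by linarith), I.co_arm, max_eq_left (by linarith), add_zero]
    exact hlt'.le
  -- Far out on the ray the image position is the reach, which is below the bound. A point
  -- overshooting the bound would thus be followed by one with the same image as the corner; by
  -- injectivity that point is the corner, and the overshooting point then coincides with it.
  obtain ⟨r, hr, h3⟩ := intermediate_value_Icc' (le_max_left r₀ 2)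
    ((((Side.continuous_co s).comp_continuousOn hcont).sub
      (continuousOn_const (c := s.co (D.edgeMap s x)))).const_mul (sg b)) ⟨hR, hlt.le⟩
  change sg b * (s.co (E.map s (I.arm s x b r)) - s.co (D.edgeMap s x)) = _ at h3
  have hon := E.map_onArm S h1 hx (I.onArm_arm hb (hr₀.trans hr.1))
  have h0 : D.ht s (E.map s (I.arm s x b r)) = 0 := by
    obtain ⟨-, -, ⟨h4, -⟩ | ⟨h4, -⟩⟩ := hon
    · exact h4
    · linarith
  have heq : E.map s (I.arm s x b r) = E.map s (D.corner s b x.1) := by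
    rw [E.map_corner S h1 hs hx hb, ← h3, ← mul_assoc, sg_mul_sg, one_mul]
    exact D.eq_pt hon.1 (by ring) h0
  have hcor : D.corner s b x.1 = I.arm s x b (I.reach s b x - D.gap s b x) := by
    have := I.reach_lt S h1 hx hb
    rw [D.corner_eq, cor_eq, arm, max_eq_right (by linarith), max_eq_left (by linarith)]
    congr 3; ring
  have hrim := fun r hr => (I.mem_rim_periodic S h1 hx).mpr ⟨b, I.onArm_arm hb (r := r) hr⟩
  rw [hcor] at heq
  have h5 := I.arm_injective b
    (E.injOn s x.1 (hrim r (hr₀.trans hr.1)) (hrim _ le_rfl) heq)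
  have h6 : r₀ = I.reach s b x - D.gap s b x := le_antisymm (h5 ▸ hr.1) hr₀
  rw [h6, ← hcor, E.map_corner S h1 hs hx hb, co_pt, add_sub_cancel_left, ← mul_assoc, sg_mul_sg,
    one_mul] at hlt
  exact lt_irrefl _ hlt

end ExtendedEdgeMaps

/-! ### Extended edge maps on whole pieces, and injectivity away from their ends. -/

namespace ExtendedEdgeMaps

open PieceData SideModel InitialPoints

variable {n : ℕ} {M : Matrix (Fin (n + 1)) (Fin (n + 1)) ℕ} {lam : ℝ} {D : PieceData M lam}
  {I : InitialPoints D} (E : ExtendedEdgeMaps I) {s : Side} {x : Pt n}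

theorem map_of_not_periodic (S : D.SideModel s) (h1 : 1 < lam) {k : Fin (n + 1)}
    (hk : ∀ x ∈ D.periodic s, x.1 ≠ k) {q : Pt n} (hq : q ∈ I.rim s k) :
    E.map s q = D.pt s (S.next k) (S.shiftOff k + lam⁻¹ * s.co q) 0 := by
  have h : 0 < lam := one_pos.trans h1
  obtain ⟨h2, h3, h4⟩ := (I.mem_rim_of_not_periodic S h hk).mp hq
  rw [E.eq_edgeMap s q ⟨I.rim_subset_seam k hq, S.side_mem_edges h3 (by rwa [h2])⟩ fun hc => by
    obtain ⟨⟨x, hx, hqx⟩, -⟩ := I.switch_bounds S h hc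
    exact hk x hx (hqx.symm.trans h2)]
  rw [← S.edgeMap_side, ← D.eq_pt h2 rfl h3]

theorem map_mem_rim (S : D.SideModel s) (h1 : 1 < lam) {k : Fin (n + 1)} {q : Pt n}
    (hq : q ∈ I.rim s k) : E.map s q ∈ I.rim s (S.next k) := by
  have h : 0 < lam := one_pos.trans h1
  by_cases hk : ∃ x ∈ D.periodic s, x.1 = k
  · obtain ⟨x, hx, rfl⟩ := hk
    obtain ⟨b, hb⟩ := (I.mem_rim_periodic S h1 hx).mp hq
    rw [← (edgeMap_periodic_eq S h hx).1]
    exact (I.mem_rim_periodic S h1 (S.edgeMap_mem_periodic h hx)).mpr ⟨b, E.map_onArm S h1 hx hb⟩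
  · push Not at hk
    rw [E.map_of_not_periodic S h1 hk hq]
    refine I.edgeMap_mem_rim S h1 (a := S.head k)
      (fun x hx hc => hk x hx (by rw [← S.src_head x.1, ← hc, S.src_head])) ?_
    rw [S.src_head]
    exact ((I.mem_rim_of_not_periodic S h hk).mp hq).2.2

theorem map_mem_rim_of_seam (S : D.SideModel s) (h1 : 1 < lam) {q : Pt n} (hq : q ∈ I.seam s) :
    E.map s q ∈ I.rim s (E.map s q).1 := by
  rcases (I.mem_seam S h1).mp hq with ⟨h2, h3⟩ | h2
  · rw [E.map_of_neg S h1 h2 h3]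
    exact I.edgeMap_mem_rim_of_neg S h1 h2 h3
  · have h3 := E.map_mem_rim S h1 h2
    rwa [(I.rim_fst_ht S h1 h3).1]

theorem iterate_map_mem_seam {q : Pt n} (hq : q ∈ I.seam s) (N : ℕ) :
    (E.map s)^[N] q ∈ I.seam s := (E.mapsTo s).iterate N hq

theorem iterate_map_mem_rim (S : D.SideModel s) (h1 : 1 < lam) {q : Pt n} (hq : q ∈ I.seam s)
    {N : ℕ} (hN : 1 ≤ N) : (E.map s)^[N] q ∈ I.rim s ((E.map s)^[N] q).1 := by
  obtain ⟨m, rfl⟩ := Nat.exists_eq_add_of_le' hN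
  rw [Function.iterate_succ_apply']
  exact E.map_mem_rim_of_seam S h1 (E.iterate_map_mem_seam hq m)

/-- On a side with a periodic point the outer bound is `map_co_le` and the inner one comes from
preservation of arms; otherwise the map is the affine one. Consequently switching cannot make images
of different pieces overlap. -/
theorem map_co_mem (S : D.SideModel s) (h1 : 1 < lam) (hs : s.forward = true) {k : Fin (n + 1)}
    {q : Pt n} (hq : q ∈ I.rim s k) :
    s.co (E.map s q) ∈ Set.Icc (S.shiftOff k) (S.shiftOff k + lam⁻¹ * D.len s k) := by
  have h : 0 < lam := one_pos.trans h1
  have hl : 0 < lam⁻¹ := inv_pos.mpr h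
  by_cases hk : ∃ x ∈ D.periodic s, x.1 = k
  · obtain ⟨x, hx, rfl⟩ := hk
    obtain ⟨b, hb⟩ := (I.mem_rim_periodic S h1 hx).mp hq
    have h2 := E.map_co_le S h1 hs hx hb
    have h3 := (E.map_onArm S h1 hx hb).pos I S h (S.edgeMap_mem_periodic h hx)
    have h4 := (edgeMap_periodic_eq S h hx).2
    have h5 := (S.periodic_side h hx).2
    have h6 := mul_nonneg hl.le h5.1
    have h7 := mul_le_mul_of_nonneg_left h5.2 hl.le
    cases b <;> simp only [gap_false, gap_true, sg, mul_sub] at h2 h3 <;> norm_num at h2 h3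
    · constructor <;> linarith
    · constructor <;> linarith
  · push Not at hk
    rw [E.map_of_not_periodic S h1 hk hq, co_pt]
    have h5 := ((I.mem_rim_of_not_periodic S h hk).mp hq).2.2
    exact ⟨le_add_of_nonneg_right (mul_nonneg hl.le h5.1),
      add_le_add_right (mul_le_mul_of_nonneg_left h5.2 hl.le) _⟩

/-- The points of a seam that move together with the edge piece `a` of the model. -/
def OnPiece (I : InitialPoints D) (S : D.SideModel s) (a : S.ι) (q : Pt n) : Prop :=
  q.1 = S.src a ∧ ((q ∈ I.rim s q.1 ∧ a = S.head q.1) ∨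
    (q ∈ D.edges s ∧ D.ht s q < 0 ∧ D.ht s q = -S.dep a))

theorem exists_onPiece (S : D.SideModel s) (h1 : 1 < lam) {q : Pt n} (hq : q ∈ I.seam s) :
    ∃ a, OnPiece I S a q := by
  rcases (I.mem_seam S h1).mp hq with ⟨h2, h3⟩ | h2
  · obtain ⟨a, u, hu, rfl⟩ := (S.mem_edges q).mp h2
    exact ⟨a, pt_fst _ _ _ _ _, Or.inr ⟨h2, h3, ht_pt _ _ _ _ _⟩⟩
  · exact ⟨S.head q.1, (S.src_head _).symm, Or.inl ⟨h2, rfl⟩⟩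

theorem OnPiece.map_eq (S : D.SideModel s) (h1 : 1 < lam) {a : S.ι} {q : Pt n}
    (hq : q ∈ D.edges s ∧ D.ht s q < 0 ∧ D.ht s q = -S.dep a) (h : q.1 = S.src a) :
    E.map s q = D.pt s (S.tgt a) (S.off a + lam⁻¹ * s.co q) 0 := by
  rw [E.map_of_neg S h1 hq.1 hq.2.1, ← S.edgeMap_pt, ← D.eq_pt h rfl hq.2.2]

theorem OnPiece.map_mem (S : D.SideModel s) (h1 : 1 < lam) (hs : s.forward = true) {a : S.ι}
    {q : Pt n} (hq : OnPiece I S a q) : (E.map s q).1 = S.tgt a ∧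
      s.co (E.map s q) ∈ Set.Icc (S.off a) (S.off a + lam⁻¹ * D.len s (S.src a)) := by
  have hl : 0 < lam⁻¹ := inv_pos.mpr (one_pos.trans h1)
  obtain ⟨h, ⟨h2, h3⟩ | h2⟩ := hq
  · subst h3
    rw [S.src_head]
    exact ⟨(I.rim_fst_ht S h1 (E.map_mem_rim S h1 h2)).1, E.map_co_mem S h1 hs h2⟩
  · rw [OnPiece.map_eq E S h1 h2 h, pt_fst, co_pt]
    have h5 := S.co_mem_of_mem_edges h2.1
    rw [h] at h5
    exact ⟨rfl, le_add_of_nonneg_right (mul_nonneg hl.le h5.1),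
      add_le_add_right (mul_le_mul_of_nonneg_left h5.2 hl.le) _⟩

theorem OnPiece.injective (S : D.SideModel s) (h1 : 1 < lam) {a : S.ι} {q q' : Pt n}
    (hq : OnPiece I S a q) (hq' : OnPiece I S a q') (he : E.map s q = E.map s q') : q = q' := by
  obtain ⟨h, h2⟩ := hq
  obtain ⟨h', h2'⟩ := hq'
  have hqq := h.trans h'.symm
  rcases h2 with ⟨h2, h3⟩ | h2 <;> rcases h2' with ⟨h2', h3'⟩ | h2'
  · exact E.injOn s q.1 h2 (hqq ▸ h2') he
  · rw [h3, S.dep_head] at h2'; linarith [h2'.2.1, h2'.2.2]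
  · rw [h3', S.dep_head] at h2; linarith [h2.2.1, h2.2.2]
  · rw [OnPiece.map_eq E S h1 h2 h, OnPiece.map_eq E S h1 h2' h'] at he
    have h4 := congrArg s.co he
    rw [co_pt, co_pt] at h4
    have h5 := mul_left_cancel₀ (inv_pos.mpr (one_pos.trans h1)).ne' (add_left_cancel h4)
    rw [D.eq_pt h h5 h2.2.2, ← D.eq_pt h' rfl h2'.2.2]

/-- The end points of the images of the edge pieces. -/
def pieceEnds (S : D.SideModel s) : Set (Pt n) :=
  Set.range fun c : S.ι × Bool =>
    D.pt s (S.tgt c.1) (S.off c.1 + lam⁻¹ * D.cor s c.2 (S.src c.1)) 0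

theorem finite_pieceEnds (S : D.SideModel s) : (pieceEnds S).Finite := by
  have : Finite S.ι := S.finite
  exact Set.finite_range _

/-- On an infinite strip the preimage under an extended edge map lies on the infinite strip at the
preceding periodic point. -/
theorem OnPiece.eq_head (S : D.SideModel s) (h1 : 1 < lam) {a : S.ι} {q : Pt n}
    (hq : OnPiece I S a q) (hpos : D.ht s (E.map s q) ≠ 0) :
    ∃ x ∈ D.periodic s, q.1 = x.1 ∧ a = S.head x.1 ∧ (E.map s q).1 = (D.edgeMap s x).1 := by
  have h : 0 < lam := one_pos.trans h1
  obtain ⟨h0, ⟨h2, h3⟩ | h2⟩ := hq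
  · by_cases hk : ∃ x ∈ D.periodic s, x.1 = q.1
    · obtain ⟨x, hx, hxq⟩ := hk
      refine ⟨x, hx, hxq.symm, by rw [h3, hxq], ?_⟩
      rw [← hxq] at h2
      rw [(edgeMap_periodic_eq S h hx).1, (I.rim_fst_ht S h1 (E.map_mem_rim S h1 h2)).1]
    · push Not at hk
      rw [E.map_of_not_periodic S h1 hk h2, ht_pt] at hpos
      exact absurd rfl hpos
  · rw [OnPiece.map_eq E S h1 h2 h0, ht_pt] at hpos
    exact absurd rfl hpos

/-- Images of different pieces lie over segments with disjoint interiors, so a common value at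
height zero is an end point. A common value on a ray comes from extended sides with periodic points;
those have the same image, hence are equal, since an edge map is injective on periodic points. -/
theorem eq_of_map_eq (S : D.SideModel s) (h1 : 1 < lam) (hs : s.forward = true) {q q' : Pt n}
    (hq : q ∈ I.seam s) (hq' : q' ∈ I.seam s) (he : E.map s q = E.map s q')
    (hne : E.map s q ∉ pieceEnds S) : q = q' := by
  have h : 0 < lam := one_pos.trans h1
  obtain ⟨a, ha⟩ := exists_onPiece S h1 hq
  obtain ⟨b, hb⟩ := exists_onPiece S h1 hq'
  by_cases hab : a = b
  · subst hab
    exact ha.injective E S h1 hb he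
  · exfalso
    have ha' := ha.map_mem E S h1 hs
    have hb' := hb.map_mem E S h1 hs
    rw [← he] at hb'
    have hends : ∀ c : S.ι, ∀ d : Bool, (E.map s q).1 = S.tgt c →
        s.co (E.map s q) ≠ S.off c + lam⁻¹ * D.cor s d (S.src c) ∨ D.ht s (E.map s q) ≠ 0 := by
      intro c d h2
      by_contra! hc
      exact hne ⟨(c, d), (D.eq_pt h2 hc.1 hc.2).symm⟩
    have hht : D.ht s (E.map s q) ≠ 0 := by
      have e1 := hends a true ha'.1
      have e2 := hends a false ha'.1
      simp only [cor] at e1 e2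
      norm_num at e1 e2
      rcases S.disjoint a b hab (ha'.1.symm.trans hb'.1) with h3 | h3
      · exact e1.resolve_left (not_not.mpr (le_antisymm ha'.2.2 (h3.trans hb'.2.1)))
      · exact e2.resolve_left (not_not.mpr (le_antisymm (hb'.2.2.trans h3) ha'.2.1))
    obtain ⟨x, hx, -, hax, h4⟩ := ha.eq_head E S h1 hht
    obtain ⟨y, hy, -, hby, h5⟩ := hb.eq_head E S h1 (he ▸ hht)
    rw [← he, h4] at h5
    have h6 := S.periodic_unique h1 (S.edgeMap_mem_periodic h hx) (S.edgeMap_mem_periodic h hy) h5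
    have h7 : x = y := (Function.bijOn_periodicPts (D.edgeMap s)).injOn hx.2 hy.2 h6
    exact hab (by rw [hax, hby, h7])

end ExtendedEdgeMaps

/-! ### Extended sides of different kinds meet only at corners. -/

namespace PieceData

variable {n : ℕ} {M : Matrix (Fin (n + 1)) (Fin (n + 1)) ℕ} {lam : ℝ} (D : PieceData M lam)

/-- The corners of the rectangles. -/
def corners : Set (Pt n) :=
  Set.range fun c : Fin (n + 1) × Bool × Bool =>
    (c.1, ⟨if c.2.1 then D.ω c.1 else 0, if c.2.2 then D.η c.1 else 0⟩)

theorem finite_corners : D.corners.Finite := Set.finite_range _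

theorem mem_corners {q : Pt n} : q ∈ D.corners ↔
    (q.2.re = 0 ∨ q.2.re = D.ω q.1) ∧ (q.2.im = 0 ∨ q.2.im = D.η q.1) := by
  constructor
  · rintro ⟨⟨k, b, c⟩, rfl⟩
    cases b <;> cases c <;> simp
  · obtain ⟨k, z⟩ := q
    rintro ⟨h1, h2⟩
    have e : ∀ b c : Bool, z.re = (if b then D.ω k else 0) → z.im = (if c then D.η k else 0) →
        (k, z) ∈ D.corners := fun b c hb hc =>
      ⟨(k, b, c), Prod.ext rfl (Complex.ext hb.symm hc.symm)⟩
    rcases h1 with h1 | h1 <;> rcases h2 with h2 | h2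
    · exact e false false h1 h2
    · exact e false true h1 h2
    · exact e true false h1 h2
    · exact e true true h1 h2

/-- The extended sides of a rectangle meet only at its corners. -/
theorem mem_corners_of_ht_nonneg {s t : Side} (hst : s ≠ t) {q : Pt n}
    (h1 : 0 ≤ D.ht s q) (h2 : s.co q ∈ Set.Icc 0 (D.len s q.1))
    (h3 : 0 ≤ D.ht t q) (h4 : t.co q ∈ Set.Icc 0 (D.len t q.1)) : q ∈ D.corners := by
  rw [mem_corners]
  have hω := D.ω_pos q.1
  have hη := D.η_pos q.1
  obtain ⟨h5, h6⟩ := h2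
  obtain ⟨h7, h8⟩ := h4
  cases s <;> cases t <;> simp only [ht, len, Side.co] at h1 h3 h5 h6 h7 h8 <;>
    first
    | exact absurd rfl hst
    | (exfalso; linarith)
    | exact ⟨Or.inl (by linarith), Or.inl (by linarith)⟩
    | exact ⟨Or.inl (by linarith), Or.inr (by linarith)⟩
    | exact ⟨Or.inr (by linarith), Or.inl (by linarith)⟩
    | exact ⟨Or.inr (by linarith), Or.inr (by linarith)⟩

end PieceData

namespace InitialPoints

open PieceData SideModel

variable {n : ℕ} {M : Matrix (Fin (n + 1)) (Fin (n + 1)) ℕ} {lam : ℝ} {D : PieceData M lam}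
  (I : InitialPoints D) {s t : Side} {x : Pt n}

theorem endCo_mem (S : D.SideModel s) (h1 : 1 < lam) (hx : x ∈ D.periodic s) (b : Bool) :
    I.endCo s b x ∈ Set.Icc 0 (D.len s x.1) := by
  have h2 := I.reach_le S h1 hx b
  have h3 := I.reach_nonneg S (one_pos.trans h1) hx b
  have h4 := (S.periodic_side (one_pos.trans h1) hx).2
  cases b <;> simp only [gap_false, gap_true, sg, endCo] at h2 ⊢ <;> norm_num at h2 ⊢
  · exact ⟨by linarith, by linarith [h4.2]⟩
  · exact ⟨by linarith [h4.1], by linarith⟩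

theorem rim_inter_rim (S : D.SideModel s) (T : D.SideModel t) (h1 : 1 < lam) (hst : s ≠ t)
    {k l : Fin (n + 1)} {q : Pt n} (hq : q ∈ I.rim s k) (hq' : q ∈ I.rim t l) :
    q ∈ D.corners := by
  have e1 := I.rim_fst_ht S h1 hq
  have e2 := I.rim_fst_ht T h1 hq'
  refine D.mem_corners_of_ht_nonneg hst e1.2 ?_ e2.2 ?_
  · rw [e1.1]; exact I.rim_co S h1 hq
  · rw [e2.1]; exact I.rim_co T h1 hq'

theorem rim_inter_outerBoundary (S : D.SideModel s) (h1 : 1 < lam) {k : Fin (n + 1)} {q : Pt n}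
    (hq : q ∈ I.rim s k) (hq' : q ∈ I.outerBoundary) : q ∈ D.corners := by
  have h : 0 < lam := one_pos.trans h1
  obtain ⟨t, x, hx, b, hb, hr⟩ := hq'
  obtain ⟨T⟩ := D.nonempty_sideModel h t
  have e1 := I.rim_fst_ht S h1 hq
  have e2 := I.rim_co S h1 hq
  rw [← e1.1] at e2
  obtain ⟨f1, f2, f3⟩ := (I.mem_ray T h hx).mp hr
  by_cases hst : s = t
  · subst hst
    exfalso
    rw [← e1.1, f1] at hq
    obtain ⟨c, hc⟩ := (I.mem_rim_periodic S h1 hx).mp hq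
    have h3 := hc.pos I S h hx
    rw [I.isOuter_iff S h1 hx] at hb
    rw [f2, endCo, I.reach_eq_zero S h hx hb, mul_zero, add_zero, sub_self, mul_zero] at h3
    exact lt_irrefl _ h3
  · refine D.mem_corners_of_ht_nonneg hst e1.2 e2 f3 ?_
    rw [f1, f2]
    exact I.endCo_mem T h1 hx b

theorem rim_left_seam_right (h1 : 1 < lam) {k : Fin (n + 1)} {q : Pt n}
    (hq : q ∈ I.rim Side.left k) (hq' : q ∈ I.seam Side.right) : False := by
  have h : 0 < lam := one_pos.trans h1
  have e1 := (I.rim_fst_ht (D.leftModel h) h1 hq).2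
  simp only [ht] at e1
  have hω := D.ω_pos q.1
  rcases (I.mem_seam (D.rightModel h) h1).mp hq' with ⟨⟨-, s, hs⟩, -⟩ | h2
  · have h3 := D.vLeft_nonneg h q.1 s
    have h4 := D.vLeft_lt_vRight h q.1 s
    linarith
  · have h3 := (I.rim_fst_ht (D.rightModel h) h1 h2).2
    simp only [ht] at h3
    linarith

theorem rim_right_seam_left (h1 : 1 < lam) {k : Fin (n + 1)} {q : Pt n}
    (hq : q ∈ I.rim Side.right k) (hq' : q ∈ I.seam Side.left) : False := by
  have h : 0 < lam := one_pos.trans h1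
  have e1 := (I.rim_fst_ht (D.rightModel h) h1 hq).2
  simp only [ht] at e1
  have hω := D.ω_pos q.1
  rcases (I.mem_seam (D.leftModel h) h1).mp hq' with ⟨⟨-, s, hs⟩, -⟩ | h2
  · have h3 := D.vRight_le h q.1 s
    have h4 := D.vLeft_lt_vRight h q.1 s
    linarith
  · have h3 := (I.rim_fst_ht (D.leftModel h) h1 h2).2
    simp only [ht] at h3
    linarith

end InitialPoints

/-! ### Generic points and their gluing classes. -/

namespace ExtendedEdgeMaps

open PieceData SideModel InitialPoints

variable {n : ℕ} {M : Matrix (Fin (n + 1)) (Fin (n + 1)) ℕ} {lam : ℝ} {D : PieceData M lam}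
  {I : InitialPoints D} (E : ExtendedEdgeMaps I) {s : Side} {x : Pt n}

/-- A point whose forward orbit avoids the ends of the pieces determines the backward orbits of the
points of its forward orbit. -/
theorem eq_iterate_of_iterate_eq (S : D.SideModel s) (h1 : 1 < lam) (hs : s.forward = true)
    (hx : x ∈ I.seam s) (hneg : D.ht s x < 0) (havoid : ∀ m, (E.map s)^[m + 1] x ∉ pieceEnds S)
    {y : Pt n} (hy : y ∈ I.seam s) {N' N : ℕ} (he : (E.map s)^[N'] y = (E.map s)^[N] x) :
    ∃ m, N = N' + m ∧ y = (E.map s)^[m] x := by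
  induction N' generalizing N with
  | zero => exact ⟨N, by omega, he⟩
  | succ N' ih =>
    rcases N with _ | j
    · exfalso
      have h2 := E.iterate_map_mem_rim S h1 hy (Nat.le_add_left 1 N')
      rw [he] at h2
      exact hneg.not_ge (I.rim_fst_ht S h1 h2).2
    · have h2 := havoid j
      rw [← he] at h2
      rw [Function.iterate_succ_apply', Function.iterate_succ_apply'] at he
      rw [Function.iterate_succ_apply'] at h2
      obtain ⟨m, hm, hym⟩ := ih (E.eq_of_map_eq S h1 hs (E.iterate_map_mem_seam hy N')
        (E.iterate_map_mem_seam hx j) he h2)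
      exact ⟨m, by omega, hym⟩

/-- The first step is affine on an edge inside a rectangle and lands in one extended side; every
further step is injective on each extended side. -/
theorem iterate_piece (S : D.SideModel s) (h1 : 1 < lam) {a : S.ι} (ha : 0 < S.dep a) (m : ℕ) :
    (∀ u ∈ Set.Icc 0 (D.len s (S.src a)),
      (E.map s)^[m + 1] (D.pt s (S.src a) u (-S.dep a)) ∈ I.rim s (S.next^[m] (S.tgt a))) ∧
    Set.InjOn (fun u => (E.map s)^[m + 1] (D.pt s (S.src a) u (-S.dep a)))
      (Set.Icc 0 (D.len s (S.src a))) := by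
  have hmem : ∀ u ∈ Set.Icc 0 (D.len s (S.src a)),
      D.pt s (S.src a) u (-S.dep a) ∈ D.edges s := fun u hu => (S.mem_edges _).mpr ⟨a, u, hu, rfl⟩
  induction m with
  | zero =>
    have hmap : ∀ u ∈ Set.Icc 0 (D.len s (S.src a)), E.map s (D.pt s (S.src a) u (-S.dep a)) =
        D.pt s (S.tgt a) (S.off a + lam⁻¹ * u) 0 := fun u hu => by
      rw [E.map_of_neg S h1 (hmem u hu) (by rw [ht_pt]; linarith), S.edgeMap_pt]
    refine ⟨fun u hu => ?_, fun u hu v hv huv => ?_⟩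
    · have := E.map_mem_rim_of_seam S h1
        ((I.mem_seam S h1).mpr (Or.inl ⟨hmem u hu, by rw [ht_pt]; linarith⟩))
      rw [hmap u hu, pt_fst] at this
      rw [zero_add, Function.iterate_one, hmap u hu]
      exact this
    · simp only [zero_add, Function.iterate_one] at huv
      rw [hmap u hu, hmap v hv] at huv
      have h4 := congrArg s.co huv
      rw [co_pt, co_pt] at h4
      exact mul_left_cancel₀ (inv_pos.mpr (one_pos.trans h1)).ne' (add_left_cancel h4)
  | succ m ih =>
    refine ⟨fun u hu => ?_, fun u hu v hv huv => ?_⟩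
    · rw [Function.iterate_succ_apply' (E.map s), Function.iterate_succ_apply' S.next]
      exact E.map_mem_rim S h1 (ih.1 u hu)
    · simp only [Function.iterate_succ_apply' (E.map s) (m + 1)] at huv
      exact ih.2 hu hv (E.injOn s _ (ih.1 u hu) (ih.1 v hv) huv)

/-- For each iterate, injectivity leaves only finitely many parameters whose image lies in `F`, and
there are countably many iterates. -/
theorem countable_iterate_mem (S : D.SideModel s) (h1 : 1 < lam) {a : S.ι} (ha : 0 < S.dep a)
    {F : Set (Pt n)} (hF : F.Finite) :
    {u ∈ Set.Icc 0 (D.len s (S.src a)) |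
      ∃ m, (E.map s)^[m + 1] (D.pt s (S.src a) u (-S.dep a)) ∈ F}.Countable := by
  have h2 : {u ∈ Set.Icc 0 (D.len s (S.src a)) |
      ∃ m, (E.map s)^[m + 1] (D.pt s (S.src a) u (-S.dep a)) ∈ F} ⊆
      ⋃ m, {u ∈ Set.Icc 0 (D.len s (S.src a)) |
        (E.map s)^[m + 1] (D.pt s (S.src a) u (-S.dep a)) ∈ F} := by
    rintro u ⟨hu, m, hm⟩
    exact Set.mem_iUnion.mpr ⟨m, hu, hm⟩
  refine (Set.countable_iUnion fun m => ?_).mono h2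
  refine Set.countable_of_injective_of_countable_image
    (((E.iterate_piece S h1 ha m).2).mono fun u hu => hu.1) ?_
  refine hF.countable.mono ?_
  rintro _ ⟨u, ⟨-, hu⟩, rfl⟩
  exact hu

/-- If the only generating relation touching `z` or `w` is the one between them, then `{z, w}` is
saturated for the generated equivalence relation. -/
theorem equiv_iff_of_glue {z w : Pt n}
    (hzw : ∀ p q, E.Glue p q → (p = z ∨ p = w ∨ q = z ∨ q = w) → p = z ∧ q = w) {p q : Pt n}
    (h : E.Equiv₂ p q) : (p = z ∨ p = w) ↔ (q = z ∨ q = w) := by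
  induction h with
  | rel p q h =>
    constructor
    · intro h2
      exact Or.inr (hzw p q h (by tauto)).2
    · intro h2
      exact Or.inl (hzw p q h (by tauto)).1
  | refl p => rfl
  | symm p q _ ih => exact ih.symm
  | trans p q r _ _ ih1 ih2 => exact ih1.trans ih2

/-- For a generic common point of the edges of two adjacent strips, the two points glued to each
other under the `N`-th iterates are glued to no other point. -/
theorem glue_generic (h1 : 1 < lam) (h : 0 < lam) (hxl : x ∈ I.seam Side.left)
    (hxr : x ∈ I.seam Side.right)
    (hl : D.ht Side.left x < 0) (hr : D.ht Side.right x < 0)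
    (hal : ∀ m, (E.map Side.left)^[m + 1] x ∉ pieceEnds (D.leftModel h) ∪ D.corners)
    (har : ∀ m, (E.map Side.right)^[m + 1] x ∉ pieceEnds (D.rightModel h) ∪ D.corners) (N : ℕ)
    {p q : Pt n} (hg : E.Glue p q)
    (hpq : p = (E.map Side.left)^[N + 1] x ∨ p = (E.map Side.right)^[N + 1] x ∨
      q = (E.map Side.left)^[N + 1] x ∨ q = (E.map Side.right)^[N + 1] x) :
    p = (E.map Side.left)^[N + 1] x ∧ q = (E.map Side.right)^[N + 1] x := by
  have hzl := E.iterate_map_mem_rim (D.leftModel h) h1 hxl (Nat.le_add_left 1 N)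
  have hwr := E.iterate_map_mem_rim (D.rightModel h) h1 hxr (Nat.le_add_left 1 N)
  have hzc : (E.map Side.left)^[N + 1] x ∉ D.corners := fun hc => hal N (Or.inr hc)
  have hwc : (E.map Side.right)^[N + 1] x ∉ D.corners := fun hc => har N (Or.inr hc)
  rcases hg with ⟨y, ⟨hyl, hyr⟩, N', hN', rfl, rfl⟩ | ⟨y, ⟨hyt, hyb⟩, N', hN', rfl, rfl⟩
  · have hpl := E.iterate_map_mem_rim (D.leftModel h) h1 hyl hN'
    have hqr := E.iterate_map_mem_rim (D.rightModel h) h1 hyr hN'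
    -- Backward uniqueness makes `y` a forward iterate of `x`; a positive iterate lies on an
    -- extended left (or right) side, disjoint from the opposite seam, so `y = x`. Mixed
    -- coincidences of left and right would be corners.
    have key : N + 1 = N' ∧ y = x := by
      rcases hpq with e | e | e | e
      · obtain ⟨m, hm, hy⟩ := E.eq_iterate_of_iterate_eq (D.leftModel h) h1 rfl hxl hl
          (fun m hc => hal m (Or.inl hc)) hyl e
        rcases m with _ | m
        · exact ⟨hm, hy⟩
        · have := E.iterate_map_mem_rim (D.leftModel h) h1 hxl (Nat.le_add_left 1 m)
          rw [← hy] at this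
          exact (I.rim_left_seam_right h1 this hyr).elim
      · rw [← e] at hwr hwc
        exact absurd (I.rim_inter_rim (D.leftModel h) (D.rightModel h) h1 (by simp) hpl hwr) hwc
      · rw [← e] at hzl hzc
        exact absurd (I.rim_inter_rim (D.rightModel h) (D.leftModel h) h1 (by simp) hqr hzl) hzc
      · obtain ⟨m, hm, hy⟩ := E.eq_iterate_of_iterate_eq (D.rightModel h) h1 rfl hxr hr
          (fun m hc => har m (Or.inl hc)) hyr e
        rcases m with _ | m
        · exact ⟨hm, hy⟩
        · have := E.iterate_map_mem_rim (D.rightModel h) h1 hxr (Nat.le_add_left 1 m)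
          rw [← hy] at this
          exact (I.rim_right_seam_left h1 this hyl).elim
    rw [key.1, key.2]
    exact ⟨rfl, rfl⟩
  · exfalso
    have hp := E.iterate_map_mem_rim (D.topModel h) h1 hyt hN'
    have hq := E.iterate_map_mem_rim (D.bottomModel h) h1 hyb hN'
    rcases hpq with e | e | e | e
    · rw [e] at hp; exact hzc (I.rim_inter_rim (D.leftModel h) (D.topModel h) h1 (by simp) hzl hp)
    · rw [e] at hp; exact hwc (I.rim_inter_rim (D.rightModel h) (D.topModel h) h1 (by simp) hwr hp)
    · rw [e] at hq; exact hzc (I.rim_inter_rim (D.leftModel h) (D.bottomModel h) h1 (by simp) hzl hq)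
    · rw [e] at hq
      exact hwc (I.rim_inter_rim (D.rightModel h) (D.bottomModel h) h1 (by simp) hwr hq)

/-- The side of the image of a strip is glued to the side of the image of an adjacent strip at some
nonsingular point. -/
theorem exists_glue_of_adjacent (h1 : 1 < lam) (h : 0 < lam) {G : Set (Pt n)}
    (hG : G ⊆ I.outerBoundary)
    {k : Fin (n + 1)} {a b : (i : Fin (n + 1)) × Fin (M i k)} (hab : D.vRight k a = D.vLeft k b)
    (N : ℕ) : ∃ z w, z ∈ I.rim Side.left ((D.leftModel h).next^[N] (D.target k b)) ∧
      w ∈ I.rim Side.right ((D.rightModel h).next^[N] (D.target k a)) ∧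
      z ∉ E.singular G ∧ w ∉ E.singular G ∧ E.Equiv₂ z w := by
  have hF := fun s (S : D.SideModel s) => (finite_pieceEnds S).union D.finite_corners
  have hposl : 0 < D.vLeft k b := by
    rw [← hab]; exact (D.vLeft_nonneg h k a).trans_lt (D.vLeft_lt_vRight h k a)
  have hposr : 0 < D.ω k - D.vRight k a := by
    rw [hab, sub_pos]; exact (D.vLeft_lt_vRight h k b).trans_le (D.vRight_le h k b)
  have hpt : ∀ u, D.pt Side.right k u (-(D.ω k - D.vRight k a)) =
      D.pt Side.left k u (-D.vLeft k b) := fun u =>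
    Prod.ext rfl (Complex.ext (by simp [pt, hab]) rfl)
  have c1 := E.countable_iterate_mem (D.leftModel h) h1 (a := ⟨k, b⟩) hposl
    (hF _ (D.leftModel h))
  have c2 := E.countable_iterate_mem (D.rightModel h) h1 (a := ⟨k, a⟩) hposr
    (hF _ (D.rightModel h))
  have c3 : ¬ (Set.Icc 0 (D.η k)).Countable := fun hc =>
    (D.η_pos k).not_ge (Cardinal.Real.Icc_countable_iff.mp hc)
  -- Only countably many heights on the common edge of the two strips have an iterate at a piece end
  -- or a corner, so a generic height exists.
  obtain ⟨u, hu, hnu⟩ : ∃ u ∈ Set.Icc 0 (D.η k), u ∉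
      {u ∈ Set.Icc 0 (D.len Side.left k) | ∃ m, (E.map Side.left)^[m + 1]
        (D.pt Side.left k u (-D.vLeft k b)) ∈ pieceEnds (D.leftModel h) ∪ D.corners} ∪
      {u ∈ Set.Icc 0 (D.len Side.right k) | ∃ m, (E.map Side.right)^[m + 1]
        (D.pt Side.right k u (-(D.ω k - D.vRight k a))) ∈
          pieceEnds (D.rightModel h) ∪ D.corners} := by
    by_contra! hc
    exact c3 ((c1.union c2).mono hc)
  set x := D.pt Side.left k u (-D.vLeft k b) with hxdef
  have hl : D.ht Side.left x < 0 := by rw [hxdef, ht_pt]; linarith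
  have hr : D.ht Side.right x < 0 := by rw [hxdef, ← hpt, ht_pt]; linarith
  have hxl : x ∈ I.seam Side.left := (I.mem_seam (D.leftModel h) h1).mpr
    (Or.inl ⟨((D.leftModel h).mem_edges _).mpr ⟨⟨k, b⟩, u, hu, rfl⟩, hl⟩)
  have hxr : x ∈ I.seam Side.right := (I.mem_seam (D.rightModel h) h1).mpr
    (Or.inl ⟨((D.rightModel h).mem_edges _).mpr ⟨⟨k, a⟩, u, hu, (hpt u).symm⟩, hr⟩)
  have hal : ∀ m, (E.map Side.left)^[m + 1] x ∉ pieceEnds (D.leftModel h) ∪ D.corners :=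
    fun m hc => hnu (Or.inl ⟨hu, m, hc⟩)
  have har : ∀ m, (E.map Side.right)^[m + 1] x ∉ pieceEnds (D.rightModel h) ∪ D.corners :=
    fun m hc => hnu (Or.inr ⟨hu, m, by rw [hpt]; exact hc⟩)
  have hz := (E.iterate_piece (D.leftModel h) h1 (a := ⟨k, b⟩) hposl N).1 u hu
  have hw := (E.iterate_piece (D.rightModel h) h1 (a := ⟨k, a⟩) hposr N).1 u hu
  have hw' : (E.map Side.right)^[N + 1] x ∈
      I.rim Side.right ((D.rightModel h).next^[N] (D.target k a)) := by
    rw [hxdef, ← hpt]; exact hw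
  have hcl := fun p q => E.equiv_iff_of_glue (p := p) (q := q)
    fun p q => E.glue_generic h1 h hxl hxr hl hr hal har N
  have hfin : ∀ p, (p = (E.map Side.left)^[N + 1] x ∨ p = (E.map Side.right)^[N + 1] x) →
      {q | E.Equiv₂ p q}.Finite := fun p hp =>
    (Set.toFinite {(E.map Side.left)^[N + 1] x, (E.map Side.right)^[N + 1] x}).subset
      fun q hq => (hcl p q hq).mp hp
  refine ⟨_, _, hz, hw', ?_, ?_, Relation.EqvGen.rel _ _
    (Or.inl ⟨x, ⟨hxl, hxr⟩, N + 1, Nat.le_add_left 1 N, rfl, rfl⟩)⟩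
  · rintro (⟨-, hinf⟩ | hGz)
    · exact hinf (hfin _ (Or.inl rfl))
    · exact hal N (Or.inr (I.rim_inter_outerBoundary (D.leftModel h) h1 hz (hG hGz)))
  · rintro (⟨-, hinf⟩ | hGw)
    · exact hinf (hfin _ (Or.inr rfl))
    · exact har N (Or.inr (I.rim_inter_outerBoundary (D.rightModel h) h1 hw' (hG hGw)))

end ExtendedEdgeMaps

/-! ### Connected cells: a rectangle together with its infinite strips. -/

namespace PieceData

variable {n : ℕ} {M : Matrix (Fin (n + 1)) (Fin (n + 1)) ℕ} {lam : ℝ} (D : PieceData M lam)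

/-- The extent of a rectangle in the direction transverse to one of its sides. -/
def wid : Side → Fin (n + 1) → ℝ
  | Side.left => D.ω
  | Side.right => D.ω
  | Side.top => D.η
  | Side.bottom => D.η

theorem wid_pos (s k) : 0 < D.wid s k := by
  cases s
  · exact D.ω_pos k
  · exact D.ω_pos k
  · exact D.η_pos k
  · exact D.η_pos k

theorem mem_rect_iff {i : Fin (n + 1)} (s : Side) {q : Pt n} : q ∈ D.rect i ↔
    q.1 = i ∧ D.ht s q ∈ Set.Icc (-D.wid s i) 0 ∧ s.co q ∈ Set.Icc 0 (D.len s i) := by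
  constructor
  · rintro ⟨rfl, ⟨h1, h2⟩, h3, h4⟩
    refine ⟨rfl, ?_⟩
    cases s <;> simp only [ht, wid, len, Side.co] <;>
      exact ⟨⟨by linarith, by linarith⟩, by linarith, by linarith⟩
  · rintro ⟨rfl, ⟨h1, h2⟩, h3, h4⟩
    refine ⟨rfl, ?_⟩
    cases s <;> simp only [ht, wid, len, Side.co] at h1 h2 h3 h4 <;>
      exact ⟨⟨by linarith, by linarith⟩, by linarith, by linarith⟩

/-- The open rectangle `Q_i`. -/
def openRect (i : Fin (n + 1)) : Set (Pt n) :=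
  {q | q.1 = i ∧ q.2.re ∈ Set.Ioo 0 (D.ω i) ∧ q.2.im ∈ Set.Ioo 0 (D.η i)}

theorem mem_openRect_iff {i : Fin (n + 1)} (s : Side) {q : Pt n} : q ∈ D.openRect i ↔
    q.1 = i ∧ D.ht s q ∈ Set.Ioo (-D.wid s i) 0 ∧ s.co q ∈ Set.Ioo 0 (D.len s i) := by
  constructor
  · rintro ⟨rfl, ⟨h1, h2⟩, h3, h4⟩
    refine ⟨rfl, ?_⟩
    cases s <;> simp only [ht, wid, len, Side.co] <;>
      exact ⟨⟨by linarith, by linarith⟩, by linarith, by linarith⟩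
  · rintro ⟨rfl, ⟨h1, h2⟩, h3, h4⟩
    refine ⟨rfl, ?_⟩
    cases s <;> simp only [ht, wid, len, Side.co] at h1 h2 h3 h4 <;>
      exact ⟨⟨by linarith, by linarith⟩, by linarith, by linarith⟩

theorem openRect_eq (s i) :
    D.openRect i = (fun v : ℝ × ℝ => D.pt s i v.1 v.2) ''
      (Set.Ioo 0 (D.len s i) ×ˢ Set.Ioo (-D.wid s i) 0) := by
  ext q
  rw [D.mem_openRect_iff s]
  constructor
  · rintro ⟨h1, h2, h3⟩
    exact ⟨(s.co q, D.ht s q), ⟨h3, h2⟩, (D.eq_pt h1 rfl rfl).symm⟩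
  · rintro ⟨v, ⟨h2, h3⟩, rfl⟩
    simp only [pt_fst, ht_pt, co_pt]
    exact ⟨trivial, h3, h2⟩

theorem ht_neg_of_co_mem {s t : Side} (hst : t ≠ s) {q : Pt n} (h1 : 0 ≤ D.ht s q)
    (h2 : s.co q ∈ Set.Ioo 0 (D.len s q.1)) : D.ht t q < 0 := by
  have hω := D.ω_pos q.1
  have hη := D.η_pos q.1
  obtain ⟨h3, h4⟩ := h2
  cases s <;> cases t <;> simp only [ht, len, Side.co] at h1 h3 h4 ⊢ <;>
    first
    | exact absurd rfl hst
    | linarith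

end PieceData

namespace InitialPoints

open PieceData SideModel

variable {n : ℕ} {M : Matrix (Fin (n + 1)) (Fin (n + 1)) ℕ} {lam : ℝ} {D : PieceData M lam}
  (I : InitialPoints D) {s t : Side} {x : Pt n}

theorem endCo_lt (S : D.SideModel s) (h : 0 < lam) (hx : x ∈ D.periodic s) :
    I.endCo s false x < I.endCo s true x := by
  have r1 := I.reach_nonneg S h hx false
  have r2 := I.reach_nonneg S h hx true
  have h3 : 0 < I.reach s false x ∨ 0 < I.reach s true x := by
    have hl := D.len_pos s x.1
    rcases lt_or_ge 0 (s.co x) with h4 | h4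
    · exact Or.inl (I.reach_pos S h hx (by rwa [gap_false]))
    · exact Or.inr (I.reach_pos S h hx (by rw [gap_true]; linarith))
  simp only [endCo, sg]
  norm_num
  rcases h3 with h3 | h3 <;> linarith

theorem mem_strip (S : D.SideModel s) (h : 0 < lam) (hx : x ∈ D.periodic s) {q : Pt n} :
    q ∈ I.strip s x ↔ q.1 = x.1 ∧ s.co q ∈ Set.Icc (I.endCo s false x) (I.endCo s true x) ∧
      0 ≤ D.ht s q := by
  constructor
  · rintro ⟨e, he, w, hw, rfl⟩
    obtain ⟨h1, h2, h3⟩ := (I.mem_base S h hx).mp he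
    rw [D.eq_pt h1 rfl h2, D.push_pt, pt_fst, co_pt, ht_pt, zero_add]
    exact ⟨rfl, h3, hw⟩
  · rintro ⟨h1, h2, h3⟩
    refine ⟨D.pt s x.1 (s.co q) 0, (I.mem_base S h hx).mpr ?_, D.ht s q, h3, ?_⟩
    · rw [pt_fst, ht_pt, co_pt]
      exact ⟨rfl, rfl, h2⟩
    · rw [D.push_pt, zero_add]
      exact D.eq_pt h1 rfl rfl

/-- The infinite open strip at `x`, prolonged through the rectangle. -/
def openStrip (s : Side) (x : Pt n) : Set (Pt n) :=
  (fun v : ℝ × ℝ => D.pt s x.1 v.1 v.2) ''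
    (Set.Ioo (I.endCo s false x) (I.endCo s true x) ×ˢ Set.Ioi (-D.wid s x.1))

/-- The open rectangle `Q_i` together with the open infinite strips that are glued to it. -/
def cell (i : Fin (n + 1)) : Set (Pt n) :=
  D.openRect i ∪ ⋃ s, ⋃ x ∈ {x ∈ D.periodic s | x.1 = i}, I.openStrip s x

theorem openStrip_subset_cell {i : Fin (n + 1)} (hx : x ∈ D.periodic s) (hi : x.1 = i) :
    I.openStrip s x ⊆ I.cell i :=
  fun _ hq => Or.inr (Set.mem_iUnion.mpr ⟨s, Set.mem_biUnion (⟨hx, hi⟩ : _ ∧ _) hq⟩)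

theorem isPreconnected_cell (h1 : 1 < lam) (i : Fin (n + 1)) : IsPreconnected (I.cell i) := by
  have h : 0 < lam := one_pos.trans h1
  have hR : IsPreconnected (D.openRect i) := by
    rw [D.openRect_eq Side.left]
    exact (isPreconnected_Ioo.prod isPreconnected_Ioo).image _ (D.continuous_pt _ _).continuousOn
  obtain ⟨c, hne⟩ : (D.openRect i).Nonempty := by
    have hω := D.ω_pos i
    have hη := D.η_pos i
    exact ⟨(i, ⟨D.ω i / 2, D.η i / 2⟩), rfl, ⟨by simpa using hω, by simpa using hω⟩,
      by simpa using hη, by simpa using hη⟩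
  refine isPreconnected_of_forall c fun q hq => ?_
  rcases hq with hq | hq
  · exact ⟨D.openRect i, Set.subset_union_left, hne, hq, hR⟩
  · obtain ⟨s, hq⟩ := Set.mem_iUnion.mp hq
    obtain ⟨x, ⟨hx, rfl⟩, hqx⟩ := Set.mem_iUnion₂.mp hq
    obtain ⟨S⟩ := D.nonempty_sideModel h s
    have hV : IsPreconnected (I.openStrip s x) :=
      (isPreconnected_Ioo.prod isPreconnected_Ioi).image _ (D.continuous_pt _ _).continuousOn
    refine ⟨D.openRect x.1 ∪ I.openStrip s x,
      Set.union_subset Set.subset_union_left (I.openStrip_subset_cell hx rfl), Or.inl hne,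
      Or.inr hqx, hR.union' ?_ hV⟩
    have hlt := I.endCo_lt S h hx
    have hw := D.wid_pos s x.1
    have e1 := (I.endCo_mem S h1 hx false).1
    have e2 := (I.endCo_mem S h1 hx true).2
    refine ⟨D.pt s x.1 ((I.endCo s false x + I.endCo s true x) / 2) (-D.wid s x.1 / 2), ?_, ?_⟩
    · rw [D.mem_openRect_iff s, pt_fst, ht_pt, co_pt]
      exact ⟨rfl, ⟨by linarith, by linarith⟩, by linarith, by linarith⟩
    · exact ⟨(_, _), ⟨⟨by dsimp only; linarith, by dsimp only; linarith⟩,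
        by rw [Set.mem_Ioi]; dsimp only; linarith⟩, rfl⟩

/-- The last clause separates the cell from the extended sides and the outer rays: a cell point on
or outside a side lies strictly between the boundary rays of its strip. -/
theorem mem_cell (h1 : 1 < lam) {i : Fin (n + 1)} {q : Pt n} (hq : q ∈ I.cell i) :
    q.1 = i ∧ q ∈ I.expanded ∧ ∀ t, 0 ≤ D.ht t q → ∃ x ∈ D.periodic t, q.1 = x.1 ∧
      t.co q ∈ Set.Ioo (I.endCo t false x) (I.endCo t true x) := by
  have h : 0 < lam := one_pos.trans h1
  have hR : ∀ q, q ∈ D.openRect i → q.1 = i ∧ q ∈ I.expanded ∧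
      ∀ t, 0 ≤ D.ht t q → ∃ x ∈ D.periodic t, q.1 = x.1 ∧
      t.co q ∈ Set.Ioo (I.endCo t false x) (I.endCo t true x) := by
    intro q hq
    refine ⟨hq.1, Or.inl (Set.mem_iUnion.mpr ⟨i, hq.1, ⟨hq.2.1.1.le, hq.2.1.2.le⟩,
      hq.2.2.1.le, hq.2.2.2.le⟩), fun t h0 => ?_⟩
    exact absurd ((D.mem_openRect_iff t).mp hq).2.1.2 (not_lt.mpr h0)
  rcases hq with hq | hq
  · exact hR q hq
  · obtain ⟨s', hq⟩ := Set.mem_iUnion.mp hq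
    obtain ⟨x, ⟨hx, rfl⟩, ⟨v, ⟨h2, h3⟩, rfl⟩⟩ := Set.mem_iUnion₂.mp hq
    obtain ⟨S⟩ := D.nonempty_sideModel h s'
    have e1 := (I.endCo_mem S h1 hx false).1
    have e2 := (I.endCo_mem S h1 hx true).2
    rcases lt_or_ge v.2 0 with hv | hv
    · apply hR
      rw [D.mem_openRect_iff s', pt_fst, ht_pt, co_pt]
      exact ⟨rfl, ⟨h3, hv⟩, e1.trans_lt h2.1, h2.2.trans_le e2⟩
    · refine ⟨pt_fst _ _ _ _ _, ?_, fun t h0 => ?_⟩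
      · refine Or.inr (Set.mem_iUnion.mpr ⟨s', Set.mem_biUnion hx ((I.mem_strip S h hx).mpr ?_)⟩)
        simp only [pt_fst, co_pt, ht_pt]
        exact ⟨trivial, ⟨h2.1.le, h2.2.le⟩, hv⟩
      · by_cases hts : t = s'
        · subst hts
          refine ⟨x, hx, pt_fst _ _ _ _ _, ?_⟩
          simp only [co_pt]
          exact h2
        · refine absurd (D.ht_neg_of_co_mem hts (q := D.pt s' x.1 v.1 v.2) ?_ ?_) (not_lt.mpr h0)
          · rwa [ht_pt]
          · rw [co_pt, pt_fst]
            exact ⟨e1.trans_lt h2.1, h2.2.trans_le e2⟩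

theorem notMem_rim_of_mem_cell (S : D.SideModel s) (h1 : 1 < lam) {i k : Fin (n + 1)} {q : Pt n}
    (hq : q ∈ I.cell i) : q ∉ I.rim s k := by
  intro hr
  have h2 := I.rim_fst_ht S h1 hr
  obtain ⟨x, hx, hqx, h3, h4⟩ := (I.mem_cell h1 hq).2.2 s h2.2
  rw [← h2.1, hqx] at hr
  obtain ⟨b, hb⟩ := (I.mem_rim_periodic S h1 hx).mp hr
  have h5 := hb.reach_le I
  simp only [endCo] at h3 h4
  cases b <;> simp only [sg] at h3 h4 h5 <;> norm_num at h3 h4 h5 <;> linarith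

theorem notMem_outerBoundary_of_mem_cell (h1 : 1 < lam) {i : Fin (n + 1)} {q : Pt n}
    (hq : q ∈ I.cell i) : q ∉ I.outerBoundary := by
  have h : 0 < lam := one_pos.trans h1
  rintro ⟨t, x, hx, b, hb, hr⟩
  obtain ⟨T⟩ := D.nonempty_sideModel h t
  obtain ⟨h2, h3, h4⟩ := (I.mem_ray T h hx).mp hr
  obtain ⟨y, hy, hqy, h5, h6⟩ := (I.mem_cell h1 hq).2.2 t h4
  obtain rfl := T.periodic_unique h1 hx hy (h2.symm.trans hqy)
  rw [h3] at h5 h6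
  cases b
  · exact lt_irrefl _ h5
  · exact lt_irrefl _ h6

/-- Closed rectangles and closed strips are closures of their open parts, in the coordinates of a
side. -/
theorem expanded_subset_closure_cell (h1 : 1 < lam) {q : Pt n} (hq : q ∈ I.expanded) :
    q ∈ closure (I.cell q.1) := by
  have h : 0 < lam := one_pos.trans h1
  rcases hq with hq | hq
  · obtain ⟨i, hq⟩ := Set.mem_iUnion.mp hq
    obtain ⟨h2, h3, h4⟩ := (D.mem_rect_iff Side.left).mp hq
    subst h2
    refine closure_mono (Set.subset_union_left : D.openRect q.1 ⊆ _) ?_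
    rw [D.openRect_eq Side.left]
    refine image_closure_subset_closure_image (D.continuous_pt _ _) ?_
    rw [closure_prod_eq, closure_Ioo (D.len_pos _ _).ne,
      closure_Ioo (by linarith [D.wid_pos Side.left q.1] : -D.wid Side.left q.1 < 0).ne]
    exact ⟨(Side.left.co q, D.ht Side.left q), ⟨h4, h3⟩, D.pt_co_ht _ _⟩
  · obtain ⟨s, hq⟩ := Set.mem_iUnion.mp hq
    obtain ⟨x, hx, hq⟩ := Set.mem_iUnion₂.mp hq
    obtain ⟨S⟩ := D.nonempty_sideModel h s
    obtain ⟨h2, h3, h4⟩ := (I.mem_strip S h hx).mp hq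
    refine closure_mono (I.openStrip_subset_cell hx h2.symm) ?_
    refine image_closure_subset_closure_image (D.continuous_pt _ _) ?_
    rw [closure_prod_eq, closure_Ioo (I.endCo_lt S h hx).ne, closure_Ioi]
    refine ⟨(s.co q, D.ht s q), ⟨h3, ?_⟩, (D.eq_pt h2 rfl rfl).symm⟩
    exact (neg_nonpos.mpr (D.wid_pos s x.1).le).trans h4

theorem rim_subset_expanded (S : D.SideModel s) (h1 : 1 < lam) {k : Fin (n + 1)} :
    I.rim s k ⊆ I.expanded := by
  have h : 0 < lam := one_pos.trans h1
  rintro q (⟨hq, -⟩ | ⟨x, hx, -, b, -, hq⟩)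
  · refine Or.inl (Set.mem_iUnion.mpr ⟨k, (D.mem_rect_iff s).mpr ?_⟩)
    obtain ⟨h2, h3, h4⟩ := D.mem_edge.mp hq
    exact ⟨h2, ⟨by rw [h3]; linarith [D.wid_pos s k], h3.le⟩, h4⟩
  · refine Or.inr (Set.mem_iUnion.mpr ⟨s, Set.mem_biUnion hx ((I.mem_strip S h hx).mpr ?_)⟩)
    obtain ⟨h2, h3, h4⟩ := (I.mem_ray S h hx).mp hq
    have hlt := (I.endCo_lt S h hx).le
    refine ⟨h2, ?_, h4⟩
    rw [h3]
    cases b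
    · exact ⟨le_rfl, hlt⟩
    · exact ⟨hlt, le_rfl⟩

end InitialPoints

/-! ### Cells consist of nonsingular points. -/

namespace ExtendedEdgeMaps

open PieceData SideModel InitialPoints

variable {n : ℕ} {M : Matrix (Fin (n + 1)) (Fin (n + 1)) ℕ} {lam : ℝ} {D : PieceData M lam}
  {I : InitialPoints D} (E : ExtendedEdgeMaps I)

theorem Glue.mem_rim (h1 : 1 < lam) {p q : Pt n} (hg : E.Glue p q) :
    (∃ s, p ∈ I.rim s p.1) ∧ ∃ s, q ∈ I.rim s q.1 := by
  have h : 0 < lam := one_pos.trans h1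
  rcases hg with ⟨y, ⟨hy, hy'⟩, N, hN, rfl, rfl⟩ | ⟨y, ⟨hy, hy'⟩, N, hN, rfl, rfl⟩
  · exact ⟨⟨_, E.iterate_map_mem_rim (D.leftModel h) h1 hy hN⟩,
      _, E.iterate_map_mem_rim (D.rightModel h) h1 hy' hN⟩
  · exact ⟨⟨_, E.iterate_map_mem_rim (D.topModel h) h1 hy hN⟩,
      _, E.iterate_map_mem_rim (D.bottomModel h) h1 hy' hN⟩

/-- All generating pairs lie on extended sides, so a point off these is alone in its class. -/
theorem eq_of_equiv (h1 : 1 < lam) {p q : Pt n} (hp : ∀ s, p ∉ I.rim s p.1)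
    (hpq : E.Equiv₂ p q) : q = p := by
  have key := (E.equiv_iff_of_glue (z := p) (w := p) (fun a b hab h2 => ?_) hpq).mp (Or.inl rfl)
  · exact key.elim id id
  · exfalso
    obtain ⟨⟨s, hs⟩, ⟨t, ht⟩⟩ := Glue.mem_rim E h1 hab
    rcases h2 with rfl | rfl | rfl | rfl
    · exact hp s hs
    · exact hp s hs
    · exact hp t ht
    · exact hp t ht

theorem notMem_singular (h1 : 1 < lam) {G : Set (Pt n)} {p : Pt n} (hp : ∀ s, p ∉ I.rim s p.1)
    (hG : p ∉ G) : p ∉ E.singular G := by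
  rintro (⟨-, hinf⟩ | hpG)
  · exact hinf ((Set.finite_singleton p).subset fun q hq => E.eq_of_equiv h1 hp hq)
  · exact hG hpG

theorem cell_subset (h1 : 1 < lam) {G : Set (Pt n)} (hG : G ⊆ I.outerBoundary)
    (i : Fin (n + 1)) : I.cell i ⊆ I.expanded \ E.singular G := by
  intro q hq
  refine ⟨(I.mem_cell h1 hq).2.1, E.notMem_singular h1 (fun s => ?_)
    fun hc => I.notMem_outerBoundary_of_mem_cell h1 hq (hG hc)⟩
  obtain ⟨S⟩ := D.nonempty_sideModel (one_pos.trans h1) s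
  exact I.notMem_rim_of_mem_cell S h1 hq

end ExtendedEdgeMaps

/-! ### Continuity of the direction maps. -/

theorem continuousOn_direction {n : ℕ} (q : Pt n) :
    ContinuousOn (direction q) {q}ᶜ := by
  intro p hp
  refine ContinuousAt.continuousWithinAt ?_
  -- The rectangle index is locally constant, so the case distinction in `direction` does not affect
  -- continuity.
  have hloc : ∀ᶠ p' in nhds p, p'.1 = p.1 :=
    ((isOpen_discrete {p.1}).preimage (continuous_fst : Continuous (Prod.fst : Pt n → _))).mem_nhds
      rfl
  by_cases h : p.1 = q.1
  · have hne : p.2 - q.2 ≠ 0 := fun hc => hp (Prod.ext h (sub_eq_zero.mp hc))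
    have hc : ContinuousAt (fun p' : Pt n => (p'.2 - q.2) / (‖p'.2 - q.2‖ : ℂ)) p := by
      refine ContinuousAt.div (by fun_prop) (by fun_prop) ?_
      exact_mod_cast norm_ne_zero_iff.mpr hne
    refine hc.congr ?_
    filter_upwards [hloc] with p' hp'
    rw [direction, if_pos (hp'.trans h)]
  · refine (continuousAt_const (y := (0 : ℂ))).congr ?_
    filter_upwards [hloc] with p' hp'
    rw [direction, if_neg (by rwa [hp'])]

/-- The points of a set together with the directions from the points of `S`. -/
noncomputable def directionGraph {n : ℕ} (S : Set (Pt n)) (p : Pt n) : Pt n × (S → ℂ) :=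
  (p, fun s : S => direction s.1 p)

theorem continuousOn_directionGraph {n : ℕ} (S : Set (Pt n)) :
    ContinuousOn (directionGraph S) Sᶜ := by
  refine continuousOn_id.prodMk (continuousOn_pi.mpr fun s => ?_)
  exact (continuousOn_direction s.1).mono fun p hp hc => hp (Set.mem_singleton_iff.mp hc ▸ s.2)

/-! ### Combinatorial connectivity of the rectangles. -/

namespace PieceData

variable {n : ℕ} {M : Matrix (Fin (n + 1)) (Fin (n + 1)) ℕ} {lam : ℝ} (D : PieceData M lam)

/-- Following right sides is an admissible itinerary of strips, so it is counted by the power of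
`M`. -/
theorem pow_next_right_pos (h : 0 < lam) (N : ℕ) (l : Fin (n + 1)) :
    0 < (M ^ N) ((D.rightModel h).next^[N] l) l := by
  induction N generalizing l with
  | zero => simp
  | succ N ih =>
    rw [Function.iterate_succ_apply, pow_succ, Matrix.mul_apply]
    refine Finset.sum_pos' (fun _ _ => Nat.zero_le _)
      ⟨(D.rightModel h).next l, Finset.mem_univ _, Nat.mul_pos (ih _) ?_⟩
    exact D.pos_of_target _ _

/-- An equivalence relation on the rectangles that relates the iterated images of the sides of
adjacent strips relates all rectangles that meet an iterated image of one rectangle. -/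
theorem rel_of_pow_pos (h : 0 < lam) {T : Fin (n + 1) → Fin (n + 1) → Prop} (hT : Equivalence T)
    (hadj : ∀ k a b, D.vRight k a = D.vLeft k b → ∀ N,
      T ((D.leftModel h).next^[N] (D.target k b)) ((D.rightModel h).next^[N] (D.target k a)))
    (N : ℕ) (i k : Fin (n + 1)) (hik : 0 < (M ^ N) i k) : T ((D.leftModel h).next^[N] k) i := by
  induction N generalizing i k with
  | zero =>
    obtain rfl : i = k := by
      by_contra hne
      rw [pow_zero, Matrix.one_apply_ne hne] at hik
      exact lt_irrefl _ hik
    exact hT.refl _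
  | succ N ih =>
    obtain ⟨l, hl, hlk⟩ := exists_of_pow_succ_pos hik
    obtain ⟨s, rfl⟩ := D.exists_target_eq hlk
    refine hT.trans ?_ (ih _ _ hl)
    clear hl hlk hik
    rw [Function.iterate_succ_apply]
    -- Move from the leftmost strip to `s`. For the preceding strip `b`, the induction hypothesis
    -- for `N` joins the `N`-th left and right successors of its target, and adjacency joins this
    -- right successor to the left successor of the target of `s`.
    induction s using wellFounded_before.induction with
    | _ s ihs =>
    rcases sum_before_eq_zero_or_exists (D.vWidth k) s with h0 | ⟨b, hb, hbs⟩
    · obtain rfl : s = (D.exists_vLeft_eq_zero h k).choose :=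
        D.vLeft_injective h k (h0.trans (D.exists_vLeft_eq_zero h k).choose_spec.symm)
      exact hT.refl _
    · exact hT.trans (ihs b hb) (hT.trans (ih _ _ (D.pow_next_right_pos h N _))
        (hT.symm (hadj k b s hbs N)))

end PieceData

/-! ### Connectedness of the bordered surface and of its double. -/

namespace ExtendedEdgeMaps

open PieceData SideModel InitialPoints

variable {n : ℕ} {M : Matrix (Fin (n + 1)) (Fin (n + 1)) ℕ} {lam : ℝ} {D : PieceData M lam}
  {I : InitialPoints D} (E : ExtendedEdgeMaps I) {G : Set (Pt n)}

/-- The part of the blow-up over one extended rectangle. -/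
def blownCell (G : Set (Pt n)) (i : Fin (n + 1)) : Set (E.Blown G) :=
  Subtype.val ⁻¹' closure (directionGraph (E.singular G) '' I.cell i)

/-- The direction maps are continuous on the connected cell, which avoids the singular points, and
the closure of a connected set is connected. -/
theorem isPreconnected_blownCell (h1 : 1 < lam) (hG : G ⊆ I.outerBoundary) (i : Fin (n + 1)) :
    IsPreconnected (E.blownCell G i) := by
  have hsub := E.cell_subset h1 hG i
  rw [← Topology.IsInducing.subtypeVal.isPreconnected_image, blownCell,
    Subtype.image_preimage_coe, Set.inter_eq_right.mpr]
  · exact ((I.isPreconnected_cell h1 i).image _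
      ((continuousOn_directionGraph _).mono fun q hq => (hsub hq).2)).closure
  · exact closure_mono (Set.image_mono hsub)

theorem directionGraph_mem_closure (h1 : 1 < lam) (hG : G ⊆ I.outerBoundary) {p : Pt n}
    (hp : p ∈ I.expanded \ E.singular G) :
    directionGraph (E.singular G) p ∈ closure (directionGraph (E.singular G) '' I.cell p.1) := by
  refine ContinuousWithinAt.mem_closure_image
    ((continuousOn_directionGraph (E.singular G) p hp.2).mono fun q hq =>
      (E.cell_subset h1 hG p.1 hq).2) ?_
  exact I.expanded_subset_closure_cell h1 hp.1

/-- The finite union of the closed sets over the cells contains the graph over every nonsingular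
point, hence also its closure, the blow-up. -/
theorem iUnion_blownCell (h1 : 1 < lam) (hG : G ⊆ I.outerBoundary) :
    ⋃ i, E.blownCell G i = Set.univ := by
  refine Set.eq_univ_of_forall fun a => ?_
  have h2 : blowup I.expanded (E.singular G) ⊆
      ⋃ i, closure (directionGraph (E.singular G) '' I.cell i) := by
    refine closure_minimal ?_ (isClosed_iUnion_of_finite fun i => isClosed_closure)
    rintro _ ⟨p, hp, rfl⟩
    exact Set.mem_iUnion.mpr ⟨p.1, E.directionGraph_mem_closure h1 hG hp⟩
  obtain ⟨i, hi⟩ := Set.mem_iUnion.mp (h2 a.2)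
  exact Set.mem_iUnion.mpr ⟨i, hi⟩

/-- The point of the blow-up over a nonsingular point. -/
noncomputable def lift (G : Set (Pt n)) (p : Pt n) (hp : p ∈ I.expanded \ E.singular G) :
    E.Blown G :=
  ⟨directionGraph (E.singular G) p, subset_closure ⟨p, hp, rfl⟩⟩

/-- The images of the blown-up cells are connected and cover the space; generic gluings make them
intersect along chains, and by primitivity all rectangles lie in one chain. -/
theorem preconnectedSpace_bordered (hM : IsPrimitiveWithRadius M lam) (h1 : 1 < lam)
    (hG : G ⊆ I.outerBoundary) : PreconnectedSpace (E.Bordered G) := by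
  have h : 0 < lam := one_pos.trans h1
  set B : Fin (n + 1) → Set (E.Bordered G) := fun i =>
    Quotient.mk (E.blownSetoid G) '' E.blownCell G i with hB
  have hBpre : ∀ i, IsPreconnected (B i) := fun i =>
    (E.isPreconnected_blownCell h1 hG i).image _ continuous_quotient_mk'.continuousOn
  have hBuniv : ⋃ i, B i = Set.univ := by
    rw [hB, ← Set.image_iUnion, E.iUnion_blownCell h1 hG, Set.image_univ, Set.range_eq_univ]
    exact Quotient.mk_surjective
  let T := Relation.ReflTransGen fun i j => (B i ∩ B j).Nonempty
  have hsymm : Std.Symm fun i j => (B i ∩ B j).Nonempty :=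
    ⟨fun i j hij => by rwa [Set.inter_comm]⟩
  have hT : Equivalence T :=
    ⟨fun _ => Relation.ReflTransGen.refl,
      fun {i j} hij => Relation.ReflTransGen.stdSymm.symm i j hij, fun hij hjk => hij.trans hjk⟩
  have hadj : ∀ k a b, D.vRight k a = D.vLeft k b → ∀ N,
      T ((D.leftModel h).next^[N] (D.target k b)) ((D.rightModel h).next^[N] (D.target k a)) := by
    intro k a b hab N
    obtain ⟨z, w, hz, hw, hzs, hws, hzw⟩ := E.exists_glue_of_adjacent h1 h hG hab N
    have hz' : z ∈ I.expanded \ E.singular G := ⟨I.rim_subset_expanded (D.leftModel h) h1 hz, hzs⟩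
    have hw' : w ∈ I.expanded \ E.singular G := ⟨I.rim_subset_expanded (D.rightModel h) h1 hw, hws⟩
    have hrel : (Quotient.mk (E.blownSetoid G) (E.lift G z hz')) =
        Quotient.mk (E.blownSetoid G) (E.lift G w hw') :=
      -- Both points are nonsingular, so their gluing is literally part of the relation on the
      -- blow-up, without passing to a limit.
      Quotient.sound (Relation.EqvGen.rel _ _ (subset_closure ⟨hzs, hws, hzw⟩))
    refine Relation.ReflTransGen.single
      ⟨Quotient.mk (E.blownSetoid G) (E.lift G z hz'), ⟨_, ?_, rfl⟩, ⟨_, ?_, hrel.symm⟩⟩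
    · rw [← (I.rim_fst_ht (D.leftModel h) h1 hz).1]
      exact E.directionGraph_mem_closure h1 hG hz'
    · rw [← (I.rim_fst_ht (D.rightModel h) h1 hw).1]
      exact E.directionGraph_mem_closure h1 hG hw'
  obtain ⟨N, -, hN⟩ := hM.1
  have hall := fun i => D.rel_of_pow_pos h hT hadj N i 0 (hN i 0)
  refine ⟨?_⟩
  rw [← hBuniv]
  exact IsPreconnected.iUnion_of_reflTransGen hBpre fun i j => hT.trans (hT.symm (hall i)) (hall j)

/-- The boundary contains a point of the outer boundary line of the strip at the top left
corner. -/
theorem nonempty_border (h1 : 1 < lam) (hD : D.CornerPeriodic)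
    (hfin : ∀ C : Set (Pt n), IsCompact C → (G ∩ C).Finite) : (E.border G).Nonempty := by
  have h : 0 < lam := one_pos.trans h1
  have hxe : D.corner Side.left true 0 = D.pt Side.left 0 (D.η 0) 0 := by
    rw [D.corner_eq]; rfl
  set x := D.corner Side.left true 0 with hx
  have hx1 : x.1 = 0 := rfl
  have hgap : D.gap Side.left true x = 0 := by
    rw [gap_true, hxe, co_pt, pt_fst]; exact sub_self _
  have hend : I.endCo Side.left true x = D.η 0 := by
    rw [endCo, I.reach_eq_zero (D.leftModel h) h hD (by rw [hgap]; exact lt_irrefl _), mul_zero,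
      add_zero, hxe, co_pt]
  set γ : ℝ → Pt n := fun w => D.pt Side.left 0 (D.η 0) w with hγ
  have hγc : Continuous γ := (D.continuous_pt Side.left 0).comp (continuous_const.prodMk continuous_id)
  have hγi : Function.Injective γ := fun a b hab => by
    have := congrArg (D.ht Side.left) hab
    simpa [hγ] using this
  -- Local finiteness of `G` leaves a point on a compact part of the ray; heights from 1 on keep it
  -- away from the rectangle.
  obtain ⟨w, hw, hwG⟩ : ∃ w ∈ Set.Icc (1 : ℝ) 2, γ w ∉ G := by
    by_contra! hc
    have h2 : (γ '' Set.Icc 1 2).Finite := (hfin _ (isCompact_Icc.image hγc)).subset (by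
      rintro _ ⟨w, hw, rfl⟩
      exact ⟨hc w hw, w, hw, rfl⟩)
    exact Set.Icc_infinite (by norm_num : (1 : ℝ) < 2) (h2.of_finite_image hγi.injOn)
  have hη := D.η_pos 0
  have hmem : γ w ∈ I.expanded := by
    refine Or.inr (Set.mem_iUnion.mpr ⟨Side.left, Set.mem_biUnion hD
      ((I.mem_strip (D.leftModel h) h hD).mpr ?_)⟩)
    rw [hend]
    simp only [hγ, pt_fst, co_pt, ht_pt]
    exact ⟨rfl, ⟨hend ▸ (I.endCo_lt (D.leftModel h) h hD).le, le_rfl⟩, by linarith [hw.1]⟩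
  have hrim : ∀ s, γ w ∉ I.rim s (γ w).1 := by
    intro s hr
    have e2 : (γ w).1 = 0 := pt_fst _ _ _ _ _
    rw [e2] at hr
    cases s
    · obtain ⟨b, hb⟩ := (I.mem_rim_periodic (D.leftModel h) h1 hD).mp hr
      have := hb.pos I (D.leftModel h) h hD
      rw [← hx, hxe, co_pt, co_pt, sub_self, mul_zero] at this
      exact lt_irrefl _ this
    · have := (I.rim_fst_ht (D.rightModel h) h1 hr).2
      simp [hγ, ht, pt] at this
      linarith [hw.1, D.ω_pos 0]
    · have := (I.rim_co (D.topModel h) h1 hr).1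
      simp [hγ, Side.co, pt] at this
      linarith [hw.1]
    · have := (I.rim_fst_ht (D.bottomModel h) h1 hr).2
      simp [hγ, ht, pt] at this
      linarith
  have hns := E.notMem_singular h1 hrim hwG
  refine ⟨_, E.lift G (γ w) ⟨hmem, hns⟩, rfl, Or.inr ⟨⟨subset_closure hmem, ?_⟩,
    fun p hp => E.eq_of_equiv h1 hrim hp⟩⟩
  intro hint
  change γ w ∈ interior I.expanded at hint
  -- Points just above the ray lie outside every rectangle and every strip, so the chosen point is
  -- on the frontier.
  have hcont : Continuous fun e : ℝ => D.pt Side.left 0 (D.η 0 + e) w :=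
    (D.continuous_pt Side.left 0).comp ((continuous_const.add continuous_id).prodMk continuous_const)
  have hnear : ∀ᶠ e in nhds (0 : ℝ), D.pt Side.left 0 (D.η 0 + e) w ∈ I.expanded := by
    refine hcont.continuousAt.eventually_mem (mem_interior_iff_mem_nhds.mp ?_)
    simpa only [add_zero] using hint
  obtain ⟨e, he, hepos⟩ := ((hnear.filter_mono nhdsWithin_le_nhds).and
    (self_mem_nhdsWithin : ∀ᶠ e in nhdsWithin (0 : ℝ) (Set.Ioi 0), e ∈ Set.Ioi 0)).exists
  have hepos : 0 < e := hepos
  rcases he with he | he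
  · obtain ⟨k, -, he, -⟩ := Set.mem_iUnion.mp he
    have := he.1
    simp [pt] at this
    linarith [hw.1]
  · obtain ⟨s, he⟩ := Set.mem_iUnion.mp he
    obtain ⟨y, hy, he⟩ := Set.mem_iUnion₂.mp he
    obtain ⟨S⟩ := D.nonempty_sideModel h s
    obtain ⟨h2, h3, h4⟩ := (I.mem_strip S h hy).mp he
    have h5 : 0 ≤ s.co (D.pt Side.left 0 (D.η 0 + e) w) := (I.endCo_mem S h1 hy false).1.trans h3.1
    have h6 : s.co (D.pt Side.left 0 (D.η 0 + e) w) ≤ D.len s y.1 :=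
      h3.2.trans (I.endCo_mem S h1 hy true).2
    rw [← h2, pt_fst] at h6
    cases s <;> simp [pt, Side.co, len, ht] at h4 h5 h6
    · linarith
    · linarith [hw.1, D.ω_pos 0]
    · linarith [hw.1]
    · linarith

/-- The two connected copies share the image of a boundary point, so their union is connected. -/
theorem connectedSpace_surface (hM : IsPrimitiveWithRadius M lam) (h1 : 1 < lam)
    (hD : D.CornerPeriodic) (hG : G ⊆ I.outerBoundary)
    (hfin : ∀ C : Set (Pt n), IsCompact C → (G ∩ C).Finite) : ConnectedSpace (E.Surface G) := by
  have hpre := E.preconnectedSpace_bordered hM h1 hG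
  obtain ⟨y, hy⟩ := E.nonempty_border h1 hD hfin
  let ι : Bool → E.Bordered G → E.Surface G := fun b z => Quotient.mk (E.doubleSetoid G) (z, b)
  have hι : ∀ b, Continuous (ι b) := fun b =>
    continuous_quotient_mk'.comp (continuous_id.prodMk continuous_const)
  have heq : ι true y = ι false y := Quotient.sound ⟨rfl, Or.inr hy⟩
  have huniv : Set.range (ι true) ∪ Set.range (ι false) = Set.univ := by
    refine Set.eq_univ_of_forall fun a => ?_
    obtain ⟨⟨z, b⟩, rfl⟩ := Quotient.mk_surjective a
    cases b
    · exact Or.inr ⟨z, rfl⟩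
    · exact Or.inl ⟨z, rfl⟩
  have hconn : IsPreconnected (Set.univ : Set (E.Surface G)) := by
    rw [← huniv]
    exact (isPreconnected_range (hι true)).union (ι true y) ⟨y, rfl⟩ ⟨y, heq.symm⟩
      (isPreconnected_range (hι false))
  exact { isPreconnected_univ := hconn, toNonempty := ⟨ι true y⟩ }

end ExtendedEdgeMaps

theorem mainTheorem8 (lam : ℝ) (hlam : IsPerron lam) (h1 : 1 < lam) :
    (∃ (n : ℕ) (M : Matrix (Fin (n + 1)) (Fin (n + 1)) ℕ), IsPrimitiveWithRadius M lam) ∧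
    ∀ (n : ℕ) (M : Matrix (Fin (n + 1)) (Fin (n + 1)) ℕ), IsPrimitiveWithRadius M lam →
      (∃ (D : PieceData M lam) (I : InitialPoints D),
        D.CornerPeriodic ∧ Nonempty (ExtendedEdgeMaps I)) ∧
      ∀ D : PieceData M lam, D.CornerPeriodic →
        (∃ k : ℕ, 1 ≤ k ∧ ∀ i, (D.pieceImage^[k] (D.rect 0) ∩ D.rect i).Nonempty) ∧
        ∀ (I : InitialPoints D) (E : ExtendedEdgeMaps I) (G : Set (Pt n)),
          G ⊆ I.outerBoundary → (∀ C : Set (Pt n), IsCompact C → (G ∩ C).Finite) →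
          ConnectedSpace (E.Surface G) := by
  refine ⟨hlam.exists_isPrimitiveWithRadius h1, fun n M hM => ⟨?_, fun D h => ⟨?_, ?_⟩⟩⟩
  · obtain ⟨D, h⟩ := hM.exists_cornerPeriodic hlam.2.1
    obtain ⟨I⟩ := D.nonempty_initialPoints hlam.2.1
    exact ⟨D, I, h, I.nonempty_extendedEdgeMaps h1⟩
  · exact D.exists_pieceImage_meets hM hlam.2.1
  · exact fun I E G hG hfin => E.connectedSpace_surface hM h1 h hG hfin
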